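/- For $a,q\in\mathbb C$ and $m\in\mathbb N_0$ write $(a;q)_m=\prod_{i=0}^{m-1}(1-aq^i)$. For $|q|<1$ let $$R^{(3)}_3(q)=\sum_{n_3\ge n_2\ge n_1\ge 0}\frac{(-1)^{n_3}q^{n_3^2+2n_3}(q;q^2)_{n_3}}{(-q^2;q^2)_{n_3}}\,B_3(n_3,n_2,n_1;q^2),$$ $$B_3(n_3,n_2,n_1;q)=\frac{(-1)^{n_1}(-q;q)_{n_2}\,q^{\binom{n_2+1}{2}}\,q^{n_1}\,(-q;q)_{2n_1}}{(q;q)_{n_3-n_2}\,(q^2;q^2)_{n_2-n_1}\,(q^4;q^4)_{n_1}} .$$ **Theorem.** Let $M>0$. There exist $\beta>0$, a real constant $C$ and $N\in\mathbb N$ (depending only on $M$) such that for every integer $n\ge N$ and every real $u$ with $|u-\tfrac12|>Mv$, where $v=\frac{1}{\sqrt{192n}}$ and $q=e^{2\pi i(u+iv)}$, the series defining $R^{(3)}_3(q)$ converges absolutely and $$\bigl|R^{(3)}_3(q)\bigr|\le C\,e^{\pi\sqrt{n/12}\,(1-\beta)} .$$ -/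

import Mathlib

/-- The finite `q`-Pochhammer symbol `(a; q)_m = (1 - a) (1 - a q) ⋯ (1 - a q^(m-1))`. -/
noncomputable def qPochhammer (a q : ℂ) (m : ℕ) : ℂ :=
  ∏ i ∈ Finset.range m, (1 - a * q ^ i)

/-- The entries of a chain `n₁ ≤ ⋯ ≤ n_k`, numbered from `1` to `k` and stored as
`n : Fin k → ℕ`, with the convention `n₀ = 0` (positions beyond `k` are never used). -/
def chainEntry {k : ℕ} (n : Fin k → ℕ) (i : ℕ) : ℕ :=
  if h : 1 ≤ i ∧ i ≤ k then n ⟨i - 1, by omega⟩ else 0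

/-- The summand `B_k(n_k, …, n₁; q)`, where `(-q)_m = (-q; q)_m`. -/
noncomputable def baileyB (k : ℕ) (n : Fin k → ℕ) (q : ℂ) : ℂ :=
  (-1) ^ chainEntry n 1 * qPochhammer (-q) q (chainEntry n (k - 1))
    * q ^ (chainEntry n (k - 1) + 1).choose 2
    * (∏ j ∈ Finset.Icc 2 (k - 1),
        q ^ (2 ^ (j - 2) * chainEntry n (k - j))
          * qPochhammer (-q ^ 2 ^ (j - 2)) (q ^ 2 ^ (j - 2)) (2 * chainEntry n (k - j)))
    / ∏ j ∈ Finset.Icc 1 k,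
        qPochhammer (q ^ 2 ^ (j - 1)) (q ^ 2 ^ (j - 1))
          (chainEntry n (k - j + 1) - chainEntry n (k - j))

/-- The summand of `R^{(k)}_3(q)` at the chain `0 ≤ n₁ ≤ ⋯ ≤ n_k`. -/
noncomputable def baileyR3Term (k : ℕ) (q : ℂ) (n : Fin k → ℕ) : ℂ :=
  (-1) ^ chainEntry n k * q ^ (chainEntry n k ^ 2 + 2 * chainEntry n k)
    * qPochhammer q (q ^ 2) (chainEntry n k) / qPochhammer (-q ^ 2) (q ^ 2) (chainEntry n k)
    * baileyB k n (q ^ 2)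

/-- `R^{(k)}_3(q)`: the sum of the terms above over all chains `n_k ≥ ⋯ ≥ n₁ ≥ 0`. -/
noncomputable def baileyR3 (k : ℕ) (q : ℂ) : ℂ :=
  ∑' n : {n : Fin k → ℕ // Monotone n}, baileyR3Term k q n.1

/-- The nome `q = e^{2πiτ}`. -/
noncomputable def nome (τ : ℂ) : ℂ := Complex.exp (2 * Real.pi * Complex.I * τ)

open Finset Filter Topology

/-! Write q = -e^(-t + iφ) with t = 2πv and p = q². The target exponent is (π²/24)/t, so it suffices
to bound the series by C e^(A/t) with a fixed A < π²/24, for small t and uniformly in φ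
(`exists_norm_baileyR3_le`). The sum over n₁ collapses to the partial sum β_b = ∑_{a ≤ b}
(-p)^a/(p²; p²)_a (`sum_range_eq_qExpPartial`). The remaining double sum is treated in two ways.

For |φ| ≥ 3t/2, β_b belongs to a Bailey pair of Hecke type (`qExpPartial_eq_hecke`). The Bailey
lemma and the ₁φ₁ summation turn the series into (q; q²)_∞/(q²; q²)_∞ times a sum of size O((1 -
|q|)⁻³) (`hasSum_hecke`, `norm_baileyR3_le_product`). The logarithm of the product is -∑ q^m/(m(1 +
q^m)), and only exponents with q^m near -1 contribute at order 1/t. Near q = -1 these are the odd m,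
with total (π²/8) Re 1/(t - iφ) ≤ π²/(26t). Near q = ±i they are m ≡ 2 mod 4, with total π²/(32t).
Elsewhere m = 1, 2 are harmless and the trivial bound for the rest gives (π²/6 - 5/4)/t. All three
constants are below π²/24 (`exists_norm_product_le`).

For |φ| ≤ 3t/2 the product can reach size about e^(π²/8t), and bounding the Hecke sum in absolute
value is useless. Instead β_b is expanded in k with coefficients 1/(-p; p²)_{k+1}
(`qExpPartial_expansion`), after which the sum over b is a Gaussian binomial coefficient. Weighted
by |q|^(n²), this is at most (-|q|; |q|²)_∞, of size about e^(π²/24t), exactly the critical order.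
The exponential gain is the growth of |(-p; p²)_{k+1}| (`exp_le_norm_qPochhammer_short`,
`exp_le_norm_qPochhammer_long`). When k is too small for that growth, the Gaussian binomial has the
much smaller bound 1/(|q|²; |q|²)_{2k+1} (`realFactInv_le`).

The slope 3/2 works because √2 < 3/2 < π/2: the first inequality puts (π²/8)/(1 + (3/2)²) below
π²/24, the second gives Re e^(-z) > 0 for Re z ≤ 1 in the sector. Powers of 1/t are absorbed by
giving up part of the gap in the exponent. -/

/-! ### Finite q-Pochhammer symbols and terminating q-sums -/

lemma qPochhammer_zero (a q : ℂ) : qPochhammer a q 0 = 1 := by simp [qPochhammer]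

lemma qPochhammer_succ (a q : ℂ) (m : ℕ) :
    qPochhammer a q (m + 1) = qPochhammer a q m * (1 - a * q ^ m) := by
  simp [qPochhammer, Finset.prod_range_succ]

lemma qPochhammer_succ_left (a q : ℂ) (m : ℕ) :
    qPochhammer a q (m + 1) = (1 - a) * qPochhammer (a * q) q m := by
  simp only [qPochhammer, Finset.prod_range_succ', pow_zero, mul_one]
  rw [mul_comm]
  congr 1
  exact Finset.prod_congr rfl fun i _ => by ring

lemma qPochhammer_add (a q : ℂ) (m n : ℕ) :
    qPochhammer a q (m + n) = qPochhammer a q m * qPochhammer (a * q ^ m) q n := by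
  simp only [qPochhammer, Finset.prod_range_add]
  congr 1
  exact Finset.prod_congr rfl fun i _ => by ring

lemma qPochhammer_zero_left (q : ℂ) (m : ℕ) : qPochhammer 0 q m = 1 := by simp [qPochhammer]

lemma norm_mul_pow_lt_one {a q : ℂ} (ha : ‖a‖ < 1) (hq : ‖q‖ < 1) (i : ℕ) : ‖a * q ^ i‖ < 1 := by
  rw [norm_mul, norm_pow]
  have h := pow_le_one₀ (norm_nonneg q) hq.le (n := i)
  nlinarith [norm_nonneg a, norm_nonneg q, pow_nonneg (norm_nonneg q) i]

lemma one_sub_ne_zero_of_norm_lt_one {z : ℂ} (hz : ‖z‖ < 1) : 1 - z ≠ 0 := by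
  intro h
  rw [sub_eq_zero] at h
  rw [← h] at hz
  simp at hz

lemma norm_pow_succ_lt_one {p : ℂ} (hp : ‖p‖ < 1) (n : ℕ) : ‖p ^ (n + 1)‖ < 1 := by
  rw [norm_pow]
  exact pow_lt_one₀ (norm_nonneg p) hp (by omega)

lemma one_sub_pow_succ_ne_zero {p : ℂ} (hp : ‖p‖ < 1) (n : ℕ) : 1 - p ^ (n + 1) ≠ 0 :=
  one_sub_ne_zero_of_norm_lt_one (norm_pow_succ_lt_one hp n)

lemma qPochhammer_ne_zero {a q : ℂ} (ha : ‖a‖ < 1) (hq : ‖q‖ < 1) (m : ℕ) :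
    qPochhammer a q m ≠ 0 :=
  Finset.prod_ne_zero_iff.mpr fun i _ =>
    one_sub_ne_zero_of_norm_lt_one (norm_mul_pow_lt_one ha hq i)

/-- The reciprocal `1 / (p; p)_n`. -/
noncomputable def qFactInv (p : ℂ) (n : ℕ) : ℂ := (qPochhammer p p n)⁻¹

lemma qFactInv_zero (p : ℂ) : qFactInv p 0 = 1 := by simp [qFactInv, qPochhammer_zero]

lemma one_sub_mul_qFactInv_succ {p : ℂ} (hp : ‖p‖ < 1) (n : ℕ) :
    (1 - p ^ (n + 1)) * qFactInv p (n + 1) = qFactInv p n := by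
  have h1 := one_sub_pow_succ_ne_zero hp n
  rw [qFactInv, qPochhammer_succ, ← pow_succ', mul_inv, mul_left_comm, mul_inv_cancel₀ h1, mul_one,
    qFactInv]

lemma qFactInv_ne_zero {p : ℂ} (hp : ‖p‖ < 1) (n : ℕ) : qFactInv p n ≠ 0 :=
  inv_ne_zero (qPochhammer_ne_zero hp hp n)

/-- The factor 1 - p^i kills the term i = 0 and lowers 1/(p; p)_i by one index. Together with its
mirror image and a splitting such as 1 - p^(i+j) = (1 - p^j) + p^j (1 - p^i), this produces the
recursions behind the terminating sums below. -/
lemma sum_antidiagonal_one_sub_fst {p : ℂ} (hp : ‖p‖ < 1) (M : ℕ) (G : ℕ → ℕ → ℂ) :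
    ∑ x ∈ antidiagonal (M + 1), (1 - p ^ x.1) * qFactInv p x.1 * G x.1 x.2
      = ∑ x ∈ antidiagonal M, qFactInv p x.1 * G (x.1 + 1) x.2 := by
  rw [Finset.Nat.sum_antidiagonal_succ]
  simp [one_sub_mul_qFactInv_succ hp]

lemma sum_antidiagonal_one_sub_snd {p : ℂ} (hp : ‖p‖ < 1) (M : ℕ) (G : ℕ → ℕ → ℂ) :
    ∑ x ∈ antidiagonal (M + 1), (1 - p ^ x.2) * qFactInv p x.2 * G x.1 x.2
      = ∑ x ∈ antidiagonal M, qFactInv p x.2 * G x.1 (x.2 + 1) := by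
  rw [Finset.Nat.sum_antidiagonal_succ']
  simp [one_sub_mul_qFactInv_succ hp]

/-- The finite `q`-Chu–Vandermonde sum, the terminating form of the `₁φ₁` summation. -/
lemma sum_antidiagonal_qVandermonde {p : ℂ} (hp : ‖p‖ < 1) (y : ℂ) (M : ℕ) :
    ∀ a : ℂ, ‖a * y‖ < 1 →
    ∑ x ∈ antidiagonal M, qFactInv p x.1 * qFactInv p x.2 *
      ((-1) ^ x.1 * p ^ x.1.choose 2 * qPochhammer a p x.1 * (qPochhammer (a * y) p x.1)⁻¹ * y ^ x.1)
      = qFactInv p M * qPochhammer y p M * (qPochhammer (a * y) p M)⁻¹ := by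
  induction M with
  | zero => intro a _; simp [qFactInv_zero, qPochhammer_zero]
  | succ M ih =>
    intro a ha
    have ha' : ‖a * p * y‖ < 1 := by
      have := norm_mul_pow_lt_one ha hp 1
      rwa [pow_one, show a * y * p = a * p * y by ring] at this
    have hM := one_sub_pow_succ_ne_zero hp M
    apply mul_left_cancel₀ hM
    set c : ℕ → ℂ := fun i => (-1) ^ i * p ^ i.choose 2 * qPochhammer a p i *
      (qPochhammer (a * y) p i)⁻¹ * y ^ i with hc
    -- The first part is the sum for M with the same a, the second the sum for M with a replaced by
    -- ap; hence the induction must carry all a at once.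
    have h1 : (1 - p ^ (M + 1)) * ∑ x ∈ antidiagonal (M + 1),
          qFactInv p x.1 * qFactInv p x.2 * c x.1
        = ∑ x ∈ antidiagonal (M + 1), (1 - p ^ x.2) * qFactInv p x.2 * (qFactInv p x.1 * c x.1)
          + ∑ x ∈ antidiagonal (M + 1), (1 - p ^ x.1) * qFactInv p x.1 *
            (p ^ x.2 * qFactInv p x.2 * c x.1) := by
      rw [Finset.mul_sum, ← Finset.sum_add_distrib]
      refine Finset.sum_congr rfl fun x hx => ?_
      rw [← mem_antidiagonal.mp hx, pow_add]
      ring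
    rw [h1, sum_antidiagonal_one_sub_snd hp M (fun i _ => qFactInv p i * c i),
      sum_antidiagonal_one_sub_fst hp M (fun i j => p ^ j * qFactInv p j * c i)]
    have h2 : ∑ x ∈ antidiagonal M, qFactInv p x.2 * (qFactInv p x.1 * c x.1)
        = qFactInv p M * qPochhammer y p M * (qPochhammer (a * y) p M)⁻¹ := by
      rw [← ih a ha]
      exact Finset.sum_congr rfl fun x _ => by ring
    have h3 : ∑ x ∈ antidiagonal M, qFactInv p x.1 * (p ^ x.2 * qFactInv p x.2 * c (x.1 + 1))
        = -(y * (1 - a) * (1 - a * y)⁻¹ * p ^ M) *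
          (qFactInv p M * qPochhammer y p M * (qPochhammer (a * p * y) p M)⁻¹) := by
      rw [← ih (a * p) ha', Finset.mul_sum]
      refine Finset.sum_congr rfl fun x hx => ?_
      rw [← mem_antidiagonal.mp hx, hc]
      simp only [qPochhammer_succ_left, Nat.choose_succ_succ' x.1 1, Nat.choose_one_right, pow_add,
        mul_inv, show a * y * p = a * p * y by ring]
      ring
    rw [h2, h3]
    have n1 : 1 - a * y ≠ 0 := one_sub_ne_zero_of_norm_lt_one ha
    have n2 : qPochhammer (a * p * y) p M ≠ 0 := qPochhammer_ne_zero ha' hp M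
    have n3 : qPochhammer (a * y) p M ≠ 0 := qPochhammer_ne_zero ha hp M
    have n4 : 1 - a * y * p ^ M ≠ 0 :=
      one_sub_ne_zero_of_norm_lt_one (norm_mul_pow_lt_one ha hp M)
    have e1 : (1 - a * y) * qPochhammer (a * p * y) p M
        = qPochhammer (a * y) p M * (1 - a * y * p ^ M) := by
      rw [← qPochhammer_succ, qPochhammer_succ_left, show a * y * p = a * p * y by ring]
    have e2 : (1 - p ^ (M + 1)) * (qFactInv p (M + 1) * qPochhammer y p (M + 1) *
        (qPochhammer (a * y) p (M + 1))⁻¹) = qFactInv p M * (qPochhammer y p M * (1 - y * p ^ M)) *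
        ((qPochhammer (a * y) p M)⁻¹ * (1 - a * y * p ^ M)⁻¹) := by
      rw [← one_sub_mul_qFactInv_succ hp M, qPochhammer_succ, qPochhammer_succ, mul_inv]
      ring
    have e3 : (1 - a * y)⁻¹ * (qPochhammer (a * p * y) p M)⁻¹
        = (qPochhammer (a * y) p M)⁻¹ * (1 - a * y * p ^ M)⁻¹ := by
      rw [← mul_inv, e1, mul_inv]
    rw [e2]
    calc _ = qFactInv p M * qPochhammer y p M * ((qPochhammer (a * y) p M)⁻¹ -
          y * (1 - a) * p ^ M * ((1 - a * y)⁻¹ * (qPochhammer (a * p * y) p M)⁻¹)) := by ring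
      _ = _ := by
        rw [e3]
        field_simp
        ring

/-- The finite `q`-binomial theorem. -/
lemma sum_antidiagonal_qBinomial {p : ℂ} (hp : ‖p‖ < 1) (y : ℂ) (M : ℕ) :
    ∑ x ∈ antidiagonal M, qFactInv p x.1 * qFactInv p x.2 *
      ((-1) ^ x.1 * p ^ x.1.choose 2 * y ^ x.1) = qFactInv p M * qPochhammer y p M := by
  simpa [qPochhammer_zero_left] using sum_antidiagonal_qVandermonde hp y M 0 (by simp)

/-- Gauss's alternating sum of `q`-binomial coefficients. -/
lemma sum_antidiagonal_alternating {p : ℂ} (hp : ‖p‖ < 1) (n : ℕ) :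
    ∑ x ∈ antidiagonal (2 * n), (-1) ^ x.1 * (qFactInv p x.1 * qFactInv p x.2)
      = qFactInv (p ^ 2) n := by
  set g : ℕ → ℂ := fun N => ∑ x ∈ antidiagonal N, (-1) ^ x.1 * (qFactInv p x.1 * qFactInv p x.2)
    with hg
  -- Parity enters here: applying the q-recursion twice relates g (N + 2) to g N, because the
  -- contributions of g (N + 1) cancel.
  have step : ∀ N, (1 - p ^ (N + 2)) * g (N + 2) = g N := by
    intro N
    have h1 : (1 - p ^ (N + 2)) * g (N + 2)
        = ∑ x ∈ antidiagonal (N + 1 + 1), (1 - p ^ x.1) * qFactInv p x.1 *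
            ((-1) ^ x.1 * qFactInv p x.2)
          + ∑ x ∈ antidiagonal (N + 1 + 1), (1 - p ^ x.2) * qFactInv p x.2 *
            ((-1) ^ x.1 * p ^ x.1 * qFactInv p x.1) := by
      rw [hg, Finset.mul_sum, ← Finset.sum_add_distrib]
      refine Finset.sum_congr rfl fun x hx => ?_
      rw [← mem_antidiagonal.mp hx, pow_add]
      ring
    have h2 : ∑ x ∈ antidiagonal (N + 1), qFactInv p x.2 * ((-1) ^ x.1 * p ^ x.1 * qFactInv p x.1)
        = g (N + 1) - ∑ x ∈ antidiagonal (N + 1), (1 - p ^ x.1) * qFactInv p x.1 *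
            ((-1) ^ x.1 * qFactInv p x.2) := by
      rw [hg, ← Finset.sum_sub_distrib]
      exact Finset.sum_congr rfl fun x _ => by ring
    rw [h1, sum_antidiagonal_one_sub_fst hp (N + 1) (fun i j => (-1) ^ i * qFactInv p j),
      sum_antidiagonal_one_sub_snd hp (N + 1) (fun i _ => (-1) ^ i * p ^ i * qFactInv p i), h2,
      sum_antidiagonal_one_sub_fst hp N (fun i j => (-1) ^ i * qFactInv p j)]
    have h3 : ∑ x ∈ antidiagonal (N + 1), qFactInv p x.1 * ((-1) ^ (x.1 + 1) * qFactInv p x.2)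
        = - g (N + 1) := by
      rw [hg, ← Finset.sum_neg_distrib]
      exact Finset.sum_congr rfl fun x _ => by ring
    have h4 : ∑ x ∈ antidiagonal N, qFactInv p x.1 * ((-1) ^ (x.1 + 1) * qFactInv p x.2)
        = - g N := by
      rw [hg, ← Finset.sum_neg_distrib]
      exact Finset.sum_congr rfl fun x _ => by ring
    rw [h3, h4]
    ring
  have hp2 : ‖p ^ 2‖ < 1 := norm_pow_succ_lt_one hp 1
  change g (2 * n) = _
  induction n with
  | zero => simp [hg, qFactInv_zero]
  | succ n ih =>
    apply mul_left_cancel₀ (one_sub_pow_succ_ne_zero hp2 n)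
    rw [one_sub_mul_qFactInv_succ hp2, ← ih, ← step (2 * n), ← pow_mul]
    rfl

/-- A terminating `q`-binomial convolution. -/
lemma sum_antidiagonal_qBinomial_convolution {P : ℂ} (hP : ‖P‖ < 1) (x : ℂ) (n : ℕ) :
    ∑ i ∈ antidiagonal n, x ^ i.2 * qPochhammer x P i.1 * (qFactInv P i.1 * qFactInv P i.2)
      = qFactInv P n := by
  set Y : ℕ → ℂ := fun n => ∑ i ∈ antidiagonal n,
    x ^ i.2 * qPochhammer x P i.1 * (qFactInv P i.1 * qFactInv P i.2) with hY
  have split : ∀ n, (1 - P ^ (n + 1)) * Y (n + 1) = x * Y n +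
      (∑ i ∈ antidiagonal n, (x * P) ^ i.2 * qPochhammer x P i.1 *
        (qFactInv P i.1 * qFactInv P i.2) - x * P ^ n * Y n) := by
    intro n
    have h1 : (1 - P ^ (n + 1)) * Y (n + 1)
        = ∑ i ∈ antidiagonal (n + 1), (1 - P ^ i.2) * qFactInv P i.2 *
            (x ^ i.2 * qPochhammer x P i.1 * qFactInv P i.1)
          + ∑ i ∈ antidiagonal (n + 1), (1 - P ^ i.1) * qFactInv P i.1 *
            ((x * P) ^ i.2 * qPochhammer x P i.1 * qFactInv P i.2) := by
      rw [hY, Finset.mul_sum, ← Finset.sum_add_distrib]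
      refine Finset.sum_congr rfl fun i hi => ?_
      rw [← mem_antidiagonal.mp hi, pow_add, mul_pow]
      ring
    rw [h1, sum_antidiagonal_one_sub_snd hP n (fun i j => x ^ j * qPochhammer x P i * qFactInv P i),
      sum_antidiagonal_one_sub_fst hP n
        (fun i j => (x * P) ^ j * qPochhammer x P i * qFactInv P j), hY, Finset.mul_sum,
      Finset.mul_sum, ← Finset.sum_sub_distrib]
    congr 1
    · exact Finset.sum_congr rfl fun i _ => by ring
    · refine Finset.sum_congr rfl fun i hi => ?_
      rw [← mem_antidiagonal.mp hi, pow_add, qPochhammer_succ, mul_pow]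
      ring
  -- The recursion `split` involves a second sum, with x replaced by xP in the power. That sum is Y
  -- (n + 1) - x Y n, and the induction hypothesis eliminates Y n.
  have key : ∀ n, (1 - P ^ (n + 1)) * Y (n + 1) = Y n := by
    intro n
    induction n with
    | zero => rw [split]; simp [hY, qFactInv_zero, qPochhammer_zero]
    | succ n ih =>
      have h2 : ∑ i ∈ antidiagonal (n + 1), (x * P) ^ i.2 * qPochhammer x P i.1 *
          (qFactInv P i.1 * qFactInv P i.2) = Y (n + 1) - x * Y n := by
        have h3 : ∑ i ∈ antidiagonal (n + 1), (x * P) ^ i.2 * qPochhammer x P i.1 *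
          (qFactInv P i.1 * qFactInv P i.2) = Y (n + 1) - ∑ i ∈ antidiagonal (n + 1),
            (1 - P ^ i.2) * qFactInv P i.2 * (x ^ i.2 * qPochhammer x P i.1 * qFactInv P i.1) := by
          rw [hY, ← Finset.sum_sub_distrib]
          exact Finset.sum_congr rfl fun i _ => by rw [mul_pow]; ring
        rw [h3, sum_antidiagonal_one_sub_snd hP n
          (fun i j => x ^ j * qPochhammer x P i * qFactInv P i), hY, Finset.mul_sum]
        congr 1
        exact Finset.sum_congr rfl fun i _ => by ring
      rw [split, h2, ← ih]
      ring
  change Y n = _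
  induction n with
  | zero => simp [hY, qFactInv_zero, qPochhammer_zero]
  | succ n ih =>
    apply mul_left_cancel₀ (one_sub_pow_succ_ne_zero hP n)
    rw [key, one_sub_mul_qFactInv_succ hP, ih]

/-! ### Partial q-exponential sums -/

/-- The partial sums `∑_{a ≤ b} x^a / (P; P)_a`. -/
noncomputable def qExpPartial (P x : ℂ) (b : ℕ) : ℂ :=
  ∑ a ∈ range (b + 1), x ^ a * qFactInv P a

/-- Split 1 = (1 - P^j) + P^j with P = x². The first part is the sum for b. In the second, x^i P^j =
x^(b+1) x^j, so the convolution identity evaluates it as x^(b+1)/(P; P)_{b+1}, the next term of the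
partial sum. That base is the square of x is essential. -/
lemma sum_antidiagonal_eq_qExpPartial {x : ℂ} (hP : ‖x ^ 2‖ < 1) (b : ℕ) :
    ∑ i ∈ antidiagonal b, x ^ i.1 * qPochhammer x (x ^ 2) i.1 *
      (qFactInv (x ^ 2) i.1 * qFactInv (x ^ 2) i.2) = qExpPartial (x ^ 2) x b := by
  induction b with
  | zero => simp [qExpPartial, qPochhammer_zero]; simp [qFactInv_zero]
  | succ b ih =>
    have h1 : ∑ i ∈ antidiagonal (b + 1), x ^ i.1 * qPochhammer x (x ^ 2) i.1 *
          (qFactInv (x ^ 2) i.1 * qFactInv (x ^ 2) i.2)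
        = ∑ i ∈ antidiagonal (b + 1), (1 - (x ^ 2) ^ i.2) * qFactInv (x ^ 2) i.2 *
            (x ^ i.1 * qPochhammer x (x ^ 2) i.1 * qFactInv (x ^ 2) i.1)
          + x ^ (b + 1) * ∑ i ∈ antidiagonal (b + 1), x ^ i.2 * qPochhammer x (x ^ 2) i.1 *
            (qFactInv (x ^ 2) i.1 * qFactInv (x ^ 2) i.2) := by
      rw [Finset.mul_sum, ← Finset.sum_add_distrib]
      refine Finset.sum_congr rfl fun i hi => ?_
      rw [← mem_antidiagonal.mp hi, pow_add, ← pow_mul]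
      ring
    rw [h1, sum_antidiagonal_one_sub_snd hP b
      (fun i _ => x ^ i * qPochhammer x (x ^ 2) i * qFactInv (x ^ 2) i),
      sum_antidiagonal_qBinomial_convolution hP, qExpPartial, Finset.sum_range_succ,
      ← qExpPartial, ← ih]
    congr 1
    exact Finset.sum_congr rfl fun i _ => by ring

/-- The truncated form of (1 - x) e(x) = e(xP) for the q-exponential e(x) = 1/(x; P)_∞; the last
term is the boundary contribution of the truncation. -/
lemma one_sub_mul_qExpPartial {P : ℂ} (hP : ‖P‖ < 1) (x : ℂ) (b : ℕ) :
    (1 - x) * qExpPartial P x b = qExpPartial P (x * P) b - x ^ (b + 1) * qFactInv P b := by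
  induction b with
  | zero => simp [qExpPartial, qFactInv_zero]
  | succ b ih =>
    rw [qExpPartial, Finset.sum_range_succ, ← qExpPartial, mul_add, ih, qExpPartial, qExpPartial,
      Finset.sum_range_succ _ (b + 1), ← one_sub_mul_qFactInv_succ hP b]
    ring

/-- Truncated expansion of `∑_{a ≤ b} (-p)^a / (p²; p²)_a`. -/
lemma qExpPartial_expansion {p : ℂ} (hp : ‖p‖ < 1) (b N : ℕ) :
    qExpPartial (p ^ 2) (-p) b
      = (-p) ^ b * qFactInv (p ^ 2) b * ∑ k ∈ range N, p ^ (2 * k + 1) * p ^ (2 * k * b) *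
          (qPochhammer (-p) (p ^ 2) (k + 1))⁻¹
        + (qPochhammer (-p) (p ^ 2) N)⁻¹ * qExpPartial (p ^ 2) (-p ^ (2 * N + 1)) b := by
  have hp2 : ‖p ^ 2‖ < 1 := norm_pow_succ_lt_one hp 1
  induction N with
  | zero => simp [qPochhammer_zero]
  | succ N ih =>
    have hx : ‖-p ^ (2 * N + 1)‖ < 1 := by
      rw [norm_neg]; exact norm_pow_succ_lt_one hp _
    have hx0 : 1 - (-p ^ (2 * N + 1)) ≠ 0 := one_sub_ne_zero_of_norm_lt_one hx
    have h1 := one_sub_mul_qExpPartial hp2 (-p ^ (2 * N + 1)) b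
    -- One more iteration of the functional equation, at x = -p^(2N+1); the base p² carries x to
    -- -p^(2N+3).
    have h2 : qExpPartial (p ^ 2) (-p ^ (2 * N + 1)) b = (1 - (-p ^ (2 * N + 1)))⁻¹ *
        (qExpPartial (p ^ 2) (-p ^ (2 * (N + 1) + 1)) b -
          (-p ^ (2 * N + 1)) ^ (b + 1) * qFactInv (p ^ 2) b) := by
      rw [show -p ^ (2 * (N + 1) + 1) = -p ^ (2 * N + 1) * p ^ 2 by ring, ← h1,
        inv_mul_cancel_left₀ hx0]
    have h3 : qPochhammer (-p) (p ^ 2) (N + 1)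
        = qPochhammer (-p) (p ^ 2) N * (1 - (-p ^ (2 * N + 1))) := by
      rw [qPochhammer_succ, ← pow_mul]; ring
    rw [ih, Finset.sum_range_succ, h2, h3, mul_inv]
    have h4 : (-p ^ (2 * N + 1)) ^ (b + 1) = -((-p) ^ b * (p ^ (2 * N + 1) * p ^ (2 * N * b))) := by
      rw [neg_pow, neg_pow p b, pow_succ (-1 : ℂ), pow_succ, ← pow_mul]
      ring
    rw [h4]
    ring

/-! ### The Hecke-type Bailey pair -/

/-- The weights `1, -2, 2, -2, …` of a symmetric alternating sum. -/
noncomputable def alternatingWeight (j : ℕ) : ℂ := if j = 0 then 1 else 2 * (-1) ^ j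

/-- The theta-like polynomial `∑_{|j| ≤ r} (-1)^j p^(2r² - 2j² + r)`. -/
noncomputable def heckeCoeff (p : ℂ) (r : ℕ) : ℂ :=
  ∑ j ∈ range (r + 1), alternatingWeight j * p ^ (2 * ((r - j) * (r + j)) + r)

lemma sum_range_two_mul_add_one (f : ℕ → ℂ) (N : ℕ) :
    ∑ k ∈ range (2 * N + 1), f k = ∑ i ∈ range N, (f (N - 1 - i) + f (N + (i + 1))) + f N := by
  rw [show 2 * N + 1 = N + (N + 1) by omega, Finset.sum_range_add, Finset.sum_range_succ' _ N,
    ← Finset.sum_range_reflect _ N, Finset.sum_add_distrib, add_assoc, add_zero]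

/-- Gauss's alternating sum folded about its middle index N: the entries N - j and N + j carry the
same sign (-1)^(N+j), which gives the weight 2(-1)^j. -/
lemma sum_alternatingWeight {p : ℂ} (hp : ‖p‖ < 1) (N : ℕ) :
    ∑ j ∈ range (N + 1), alternatingWeight j * (qFactInv p (N - j) * qFactInv p (N + j))
      = (-1) ^ N * qFactInv (p ^ 2) N := by
  have hsq : ∀ m : ℕ, (-1 : ℂ) ^ m * (-1) ^ m = 1 := fun m => by rw [← mul_pow]; simp
  rw [← sum_antidiagonal_alternating hp N, Finset.Nat.sum_antidiagonal_eq_sum_range_succ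
    (f := fun i j => (-1) ^ i * (qFactInv p i * qFactInv p j)), Nat.succ_eq_add_one,
    sum_range_two_mul_add_one, Finset.sum_range_succ' _ N, mul_add, Finset.mul_sum]
  congr 1
  · refine Finset.sum_congr rfl fun i hi => ?_
    have hi' := Finset.mem_range.mp hi
    obtain ⟨d, rfl⟩ : ∃ d, N = i + 1 + d := ⟨N - i - 1, by omega⟩
    rw [show i + 1 + d - 1 - i = d by omega, show 2 * (i + 1 + d) - d = i + 1 + d + (i + 1) by omega,
      show i + 1 + d - (i + 1) = d by omega,
      show 2 * (i + 1 + d) - (i + 1 + d + (i + 1)) = d by omega, alternatingWeight,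
      if_neg (by omega), pow_add (-1 : ℂ) (i + 1 + d) (i + 1), pow_add (-1 : ℂ) (i + 1) d]
    linear_combination (-(-1) ^ (i + 1) * (qFactInv p d * qFactInv p (i + 1 + d + (i + 1)))) *
      (2 * hsq d + hsq (i + 1) * ((-1) ^ d * (-1) ^ d))
  · simp only [alternatingWeight, if_pos, Nat.sub_zero, add_zero, show 2 * N - N = N by omega]
    linear_combination (-(qFactInv p N * qFactInv p N)) * hsq N

lemma sum_range_triangle (f : ℕ → ℕ → ℂ) (n : ℕ) :
    ∑ r ∈ range n, ∑ j ∈ range (r + 1), f r j = ∑ j ∈ range n, ∑ r ∈ Ico j n, f r j := by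
  refine Finset.sum_comm' fun x y => ?_
  simp only [Finset.mem_range, Finset.mem_Ico]
  omega

lemma sum_Ico_sub_succ (U : ℕ → ℂ) {j n : ℕ} (h : j ≤ n) :
    ∑ r ∈ Ico j n, (U r - U (r + 1)) = U j - U n := by
  induction n, h using Nat.le_induction with
  | base => simp
  | succ n hn ih => rw [Finset.sum_Ico_succ_top hn, ih]; ring

/-- For fixed j the summand is a difference U r - U (r + 1). Setting U to 0 beyond N lets the last
term r = N follow the same pattern. -/
lemma sum_hecke_telescope {p : ℂ} (hp : ‖p‖ < 1) {j N : ℕ} (hj : j ≤ N) :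
    ∑ r ∈ Ico j (N + 1), (1 - p ^ (2 * r + 1)) * p ^ (2 * ((r - j) * (r + j)) + r) *
        (qFactInv p (N - r) * qFactInv p (N + r + 1) *
          (1 - (1 - p ^ (N - r)) * (1 - p ^ (N + r + 1))))
      = p ^ N * (qFactInv p (N - j) * qFactInv p (N + j)) := by
  set U : ℕ → ℂ := fun r => if r ≤ N then
    p ^ (2 * ((r - j) * (r + j)) + N) * (qFactInv p (N - r) * qFactInv p (N + r)) else 0 with hU
  have h1 : ∀ r ∈ Ico j (N + 1), (1 - p ^ (2 * r + 1)) * p ^ (2 * ((r - j) * (r + j)) + r) *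
        (qFactInv p (N - r) * qFactInv p (N + r + 1) *
          (1 - (1 - p ^ (N - r)) * (1 - p ^ (N + r + 1)))) = U r - U (r + 1) := by
    intro r hr
    obtain ⟨hr1, hr2⟩ := Finset.mem_Ico.mp hr
    obtain ⟨i, rfl⟩ : ∃ i, r = j + i := ⟨r - j, by omega⟩
    rcases Nat.lt_or_ge (j + i) N with hlt | hge
    · obtain ⟨d, rfl⟩ : ∃ d, N = j + i + 1 + d := ⟨N - (j + i) - 1, by omega⟩
      rw [hU]
      simp only [if_pos hlt.le, if_pos (show j + i + 1 ≤ j + i + 1 + d by omega)]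
      rw [show j + i + 1 + d - (j + i) = d + 1 by omega, show j + i - j = i by omega,
        show j + i + 1 - j = i + 1 by omega, show j + i + 1 + d - (j + i + 1) = d by omega,
        ← one_sub_mul_qFactInv_succ hp d, ← one_sub_mul_qFactInv_succ hp (j + i + 1 + d + (j + i)),
        show j + i + 1 + d + (j + i + 1) = j + i + 1 + d + (j + i) + 1 by ring]
      ring
    · obtain rfl : N = j + i := by omega
      rw [hU]
      simp only [le_refl, if_true, if_neg (show ¬ (j + i + 1 ≤ j + i) by omega)]
      rw [show j + i - j = i by omega, ← one_sub_mul_qFactInv_succ hp (j + i + (j + i)), Nat.sub_self]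
      ring
  rw [Finset.sum_congr rfl h1, sum_Ico_sub_succ U (by omega)]
  simp only [hU, if_pos hj, if_neg (show ¬ (N + 1 ≤ N) by omega), Nat.sub_self, zero_mul, mul_zero,
    zero_add, sub_zero]

/-- The Bailey pair of Hecke type with `β_b = ∑_{a ≤ b} (-p)^a / (p²; p²)_a`. -/
lemma qExpPartial_eq_hecke {p : ℂ} (hp : ‖p‖ < 1) (n : ℕ) :
    qExpPartial (p ^ 2) (-p) n = ∑ r ∈ range (n + 1), (1 - p ^ (2 * r + 1)) * heckeCoeff p r *
      (qFactInv p (n - r) * qFactInv p (n + r + 1)) := by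
  induction n with
  | zero =>
    have := one_sub_mul_qFactInv_succ hp 0
    simp only [zero_add, pow_one, qFactInv_zero] at this
    simp [qExpPartial, qFactInv_zero, heckeCoeff, alternatingWeight, this]
  | succ n ih =>
    rw [qExpPartial, Finset.sum_range_succ, ← qExpPartial, ih]
    -- Rewriting the sum for n with the denominators of n + 1 creates the factors 1 - p^(n+1-r) and
    -- 1 - p^(n+r+2); the new term r = n + 1 vanishes. The increment then carries the factor 1 -
    -- (product), which telescopes after the sums over r and j are exchanged.
    have h1 : ∑ r ∈ range (n + 1), (1 - p ^ (2 * r + 1)) * heckeCoeff p r *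
        (qFactInv p (n - r) * qFactInv p (n + r + 1))
        = ∑ r ∈ range (n + 1 + 1), (1 - p ^ (2 * r + 1)) * heckeCoeff p r *
        (qFactInv p (n + 1 - r) * qFactInv p (n + 1 + r + 1) *
          ((1 - p ^ (n + 1 - r)) * (1 - p ^ (n + 1 + r + 1)))) := by
      rw [Finset.sum_range_succ _ (n + 1)]
      simp only [Nat.sub_self, pow_zero, sub_self, zero_mul, mul_zero, add_zero]
      refine Finset.sum_congr rfl fun r hr => ?_
      obtain ⟨d, rfl⟩ : ∃ d, n = r + d := ⟨n - r, by have := Finset.mem_range.mp hr; omega⟩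
      rw [show r + d - r = d by omega, show r + d + 1 - r = d + 1 by omega,
        ← one_sub_mul_qFactInv_succ hp d, ← one_sub_mul_qFactInv_succ hp (r + d + r + 1),
        show r + d + 1 + r + 1 = r + d + r + 1 + 1 by ring]
      ring
    have h2 : ∑ r ∈ range (n + 1 + 1), (1 - p ^ (2 * r + 1)) * heckeCoeff p r *
        (qFactInv p (n + 1 - r) * qFactInv p (n + 1 + r + 1) *
          (1 - (1 - p ^ (n + 1 - r)) * (1 - p ^ (n + 1 + r + 1))))
        = (-p) ^ (n + 1) * qFactInv (p ^ 2) (n + 1) := by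
      simp only [heckeCoeff, Finset.mul_sum, Finset.sum_mul]
      rw [sum_range_triangle, neg_pow, mul_right_comm, ← sum_alternatingWeight hp, Finset.sum_mul]
      refine Finset.sum_congr rfl fun j hj => ?_
      have h3 := sum_hecke_telescope hp (show j ≤ n + 1 by have := Finset.mem_range.mp hj; omega)
      rw [mul_assoc, mul_comm _ (p ^ (n + 1)), ← h3, Finset.mul_sum]
      exact Finset.sum_congr rfl fun r _ => by ring
    rw [h1, ← h2, ← Finset.sum_add_distrib]
    exact Finset.sum_congr rfl fun r _ => by ring

lemma qFactInv_add (p : ℂ) (m n : ℕ) :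
    qFactInv p (m + n) = qFactInv p m * (qPochhammer (p ^ (m + 1)) p n)⁻¹ := by
  rw [qFactInv, qPochhammer_add, mul_inv, ← pow_succ', qFactInv]

lemma choose_two_add (r i : ℕ) :
    (r + i + 1).choose 2 = (r + 1).choose 2 + i.choose 2 + (r + 1) * i := by
  induction i with
  | zero => simp
  | succ i ih =>
    rw [show r + (i + 1) + 1 = r + i + 1 + 1 by ring, Nat.choose_succ_succ' _ 1, ih,
      Nat.choose_succ_succ' i 1, Nat.choose_one_right, Nat.choose_one_right]
    ring

/-- The Bailey lemma applied to `qExpPartial_eq_hecke`. -/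
lemma sum_range_mul_qExpPartial_eq_hecke {p : ℂ} (hp : ‖p‖ < 1) (n : ℕ) :
    ∑ b ∈ range (n + 1), qPochhammer (-p) p b * p ^ (b + 1).choose 2 * qFactInv p (n - b) *
        qExpPartial (p ^ 2) (-p) b
      = qPochhammer (-p) p n * ∑ r ∈ range (n + 1), (1 - p ^ (2 * r + 1)) * heckeCoeff p r *
        p ^ (r + 1).choose 2 * (qFactInv p (n - r) * qFactInv p (n + r + 1)) := by
  simp only [qExpPartial_eq_hecke hp, Finset.mul_sum]
  rw [sum_range_triangle]
  refine Finset.sum_congr rfl fun r hr => ?_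
  obtain ⟨M, rfl⟩ : ∃ M, n = r + M := ⟨n - r, by have := Finset.mem_range.mp hr; omega⟩
  have hnorm : ‖-p ^ (r + 1) * -p ^ (r + 1)‖ < 1 := by
    rw [neg_mul_neg, ← pow_add, show r + 1 + (r + 1) = 2 * r + 1 + 1 by ring]
    exact norm_pow_succ_lt_one hp _
  -- With b = r + i, the sum over i is q-Chu–Vandermonde with both parameters equal to -p^(r+1);
  -- their product p^(2r+2) is the shift in (p; p)_{2r+1+i}.
  have h := sum_antidiagonal_qVandermonde hp (-p ^ (r + 1)) M (-p ^ (r + 1)) hnorm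
  rw [show -p ^ (r + 1) * -p ^ (r + 1) = p ^ (2 * r + 1 + 1) by ring,
    Finset.Nat.sum_antidiagonal_eq_sum_range_succ (f := fun i j => qFactInv p i * qFactInv p j *
      ((-1) ^ i * p ^ i.choose 2 * qPochhammer (-p ^ (r + 1)) p i *
        (qPochhammer (p ^ (2 * r + 1 + 1)) p i)⁻¹ * (-p ^ (r + 1)) ^ i))] at h
  rw [Finset.sum_Ico_eq_sum_range, show r + M + 1 - r = M + 1 by omega,
    show r + M - r = M by omega, show r + M + r + 1 = (2 * r + 1) + M by ring, qFactInv_add p,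
    qPochhammer_add, show -p * p ^ r = -p ^ (r + 1) by ring]
  calc _ = (1 - p ^ (2 * r + 1)) * heckeCoeff p r * p ^ (r + 1).choose 2 * qPochhammer (-p) p r *
        qFactInv p (2 * r + 1) * ∑ k ∈ range M.succ, qFactInv p k * qFactInv p (M - k) *
        ((-1) ^ k * p ^ k.choose 2 * qPochhammer (-p ^ (r + 1)) p k *
        (qPochhammer (p ^ (2 * r + 1 + 1)) p k)⁻¹ * (-p ^ (r + 1)) ^ k) := by
        rw [Finset.mul_sum]
        refine Finset.sum_congr rfl fun i hi => ?_
        obtain ⟨d, rfl⟩ : ∃ d, M = i + d := ⟨M - i, by have := Finset.mem_range.mp hi; omega⟩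
        have hsq : ∀ m : ℕ, (-1 : ℂ) ^ m * (-1) ^ m = 1 := fun m => by rw [← mul_pow]; simp
        rw [show r + (i + d) - (r + i) = d by omega, show r + i - r = i by omega,
          show i + d - i = d by omega, show r + i + r + 1 = (2 * r + 1) + i by ring,
          qFactInv_add p (2 * r + 1) i, qPochhammer_add, show -p * p ^ r = -p ^ (r + 1) by ring,
          choose_two_add, pow_add p ((r + 1).choose 2 + i.choose 2), pow_add p ((r + 1).choose 2),
          pow_mul, neg_pow (p ^ (r + 1)) i]
        linear_combination (-(1 - p ^ (2 * r + 1)) * heckeCoeff p r * p ^ (r + 1).choose 2 *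
          qPochhammer (-p) p r * qFactInv p (2 * r + 1) * (qFactInv p i * qFactInv p d *
          (p ^ i.choose 2 * qPochhammer (-p ^ (r + 1)) p i *
          (qPochhammer (p ^ (2 * r + 1 + 1)) p i)⁻¹ * (p ^ (r + 1)) ^ i))) * hsq i
    _ = _ := by
        rw [h]
        ring

/-! ### Infinite products and the ₁φ₁ summation -/

/-- The infinite `q`-Pochhammer symbol `(z; p)_∞`, through the expansion of its logarithm. -/
noncomputable def qPochhammerInf (z p : ℂ) : ℂ :=
  Complex.exp (-∑' m : ℕ, z ^ (m + 1) / ((m + 1) * (1 - p ^ (m + 1))))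

lemma one_sub_norm_le_norm_one_sub_pow {p : ℂ} (hp : ‖p‖ < 1) (m : ℕ) :
    1 - ‖p‖ ≤ ‖1 - p ^ (m + 1)‖ := by
  have h1 : ‖(1 : ℂ)‖ - ‖p ^ (m + 1)‖ ≤ ‖1 - p ^ (m + 1)‖ := norm_sub_norm_le _ _
  rw [norm_one, norm_pow] at h1
  have h2 : ‖p‖ ^ (m + 1) ≤ ‖p‖ := by
    have := pow_le_pow_of_le_one (norm_nonneg p) hp.le (show 1 ≤ m + 1 by omega)
    simpa using this
  linarith

lemma norm_natCast_add_one (m : ℕ) : ‖((m : ℂ) + 1)‖ = m + 1 := by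
  rw [← Nat.cast_succ, Complex.norm_natCast]; push_cast; ring

lemma norm_logTerm_le {z p : ℂ} (hp : ‖p‖ < 1) (m : ℕ) :
    ‖z ^ (m + 1) / ((m + 1) * (1 - p ^ (m + 1)))‖ ≤ ‖z‖ ^ (m + 1) * (1 - ‖p‖)⁻¹ := by
  have h1 := one_sub_norm_le_norm_one_sub_pow hp m
  have h0 : 0 < 1 - ‖p‖ := by linarith
  rw [norm_div, norm_mul, norm_pow, norm_natCast_add_one, div_eq_mul_inv]
  gcongr
  have : (0 : ℝ) ≤ m := m.cast_nonneg
  nlinarith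

lemma summable_logTerm {z p : ℂ} (hz : ‖z‖ < 1) (hp : ‖p‖ < 1) :
    Summable fun m : ℕ => z ^ (m + 1) / ((m + 1) * (1 - p ^ (m + 1))) := by
  refine Summable.of_norm_bounded ?_ (norm_logTerm_le hp)
  exact ((summable_nat_add_iff 1).mpr (summable_geometric_of_lt_one (norm_nonneg z) hz)).mul_right _

lemma norm_tsum_logTerm_le {z p : ℂ} (hz : ‖z‖ < 1) (hp : ‖p‖ < 1) :
    ‖∑' m : ℕ, z ^ (m + 1) / ((m + 1) * (1 - p ^ (m + 1)))‖
      ≤ ‖z‖ * ((1 - ‖z‖)⁻¹ * (1 - ‖p‖)⁻¹) := by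
  refine tsum_of_norm_bounded ?_ (norm_logTerm_le hp)
  have := ((hasSum_geometric_of_lt_one (norm_nonneg z) hz).mul_left ‖z‖).mul_right (1 - ‖p‖)⁻¹
  simpa only [pow_succ', mul_assoc] using this

lemma exp_neg_tsum_pow_div {z : ℂ} (hz : ‖z‖ < 1) :
    Complex.exp (-∑' m : ℕ, z ^ (m + 1) / (m + 1)) = 1 - z := by
  have h := Complex.hasSum_taylorSeries_neg_log hz
  rw [hasSum_nat_add_iff' 1 |>.symm] at h
  simp only [Finset.range_one, Finset.sum_singleton, Nat.cast_zero, div_zero, sub_zero] at h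
  push_cast at h
  rw [h.tsum_eq, neg_neg, Complex.exp_log (one_sub_ne_zero_of_norm_lt_one hz)]

lemma norm_mul_lt_one {z p : ℂ} (hz : ‖z‖ < 1) (hp : ‖p‖ < 1) : ‖z * p‖ < 1 := by
  simpa using norm_mul_pow_lt_one hz hp 1

/-- In the logarithm, (z^m - (zp)^m)/(1 - p^m) = z^m, and ∑ z^m/m is -log(1 - z). -/
lemma qPochhammerInf_eq_mul {z p : ℂ} (hz : ‖z‖ < 1) (hp : ‖p‖ < 1) :
    qPochhammerInf z p = (1 - z) * qPochhammerInf (z * p) p := by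
  rw [← exp_neg_tsum_pow_div hz, qPochhammerInf, qPochhammerInf, ← Complex.exp_add, ← neg_add]
  congr 2
  rw [← Summable.tsum_add _ (summable_logTerm (norm_mul_lt_one hz hp) hp)]
  · refine tsum_congr fun m => ?_
    have h1 := one_sub_pow_succ_ne_zero hp m
    have h2 : ((m : ℂ) + 1) ≠ 0 := Nat.cast_add_one_ne_zero m
    field_simp
    ring
  · refine Summable.of_norm_bounded
      ((summable_nat_add_iff 1).mpr (summable_geometric_of_lt_one (norm_nonneg z) hz)) fun m => ?_
    rw [norm_div, norm_pow, norm_natCast_add_one]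
    exact div_le_self (by positivity) (by linarith [(m.cast_nonneg : (0 : ℝ) ≤ m)])

lemma qPochhammer_mul_inf {z p : ℂ} (hz : ‖z‖ < 1) (hp : ‖p‖ < 1) (n : ℕ) :
    qPochhammer z p n * qPochhammerInf (z * p ^ n) p = qPochhammerInf z p := by
  induction n with
  | zero => simp [qPochhammer_zero]
  | succ n ih =>
    rw [← ih, qPochhammer_succ, qPochhammerInf_eq_mul (norm_mul_pow_lt_one hz hp n) hp, mul_assoc,
      mul_assoc z, ← pow_succ]

lemma qPochhammerInf_ne_zero (z p : ℂ) : qPochhammerInf z p ≠ 0 := Complex.exp_ne_zero _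

lemma tendsto_qPochhammerInf_one {z p : ℂ} (hz : ‖z‖ < 1) (hp : ‖p‖ < 1) :
    Tendsto (fun n : ℕ => qPochhammerInf (z * p ^ n) p) atTop (𝓝 1) := by
  have h1 : Tendsto (fun n : ℕ => ‖z * p ^ n‖) atTop (𝓝 0) := by
    have := (tendsto_pow_atTop_nhds_zero_of_lt_one (norm_nonneg p) hp).const_mul ‖z‖
    simpa using this
  have h2 : Tendsto (fun n : ℕ => ∑' m : ℕ, (z * p ^ n) ^ (m + 1) / ((m + 1) * (1 - p ^ (m + 1))))
      atTop (𝓝 0) := by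
    refine squeeze_zero_norm (fun n => norm_tsum_logTerm_le (norm_mul_pow_lt_one hz hp n) hp) ?_
    have h3 : Tendsto (fun n : ℕ => (1 - ‖z * p ^ n‖)⁻¹) atTop (𝓝 (1 - 0)⁻¹) :=
      (tendsto_const_nhds.sub h1).inv₀ (by norm_num)
    simpa using h1.mul (h3.mul_const (1 - ‖p‖)⁻¹)
  have h3 := (Complex.continuous_exp.tendsto (-0)).comp h2.neg
  simpa [qPochhammerInf, Function.comp_def] using h3

lemma tendsto_qPochhammer {z p : ℂ} (hz : ‖z‖ < 1) (hp : ‖p‖ < 1) :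
    Tendsto (fun n => qPochhammer z p n) atTop (𝓝 (qPochhammerInf z p)) := by
  have h := (tendsto_qPochhammerInf_one hz hp).inv₀ one_ne_zero |>.const_mul (qPochhammerInf z p)
  simp only [inv_one, mul_one] at h
  refine h.congr fun n => ?_
  rw [← qPochhammer_mul_inf hz hp n, mul_inv_cancel_right₀ (qPochhammerInf_ne_zero _ _)]

/-- `‖(z; p)_n‖` is bounded above, uniformly in `n`. -/
lemma exists_norm_qPochhammer_le {z p : ℂ} (hz : ‖z‖ < 1) (hp : ‖p‖ < 1) :
    ∃ C : ℝ, 0 < C ∧ ∀ n, ‖qPochhammer z p n‖ ≤ C := by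
  obtain ⟨C, hC⟩ := (tendsto_qPochhammer hz hp).norm.bddAbove_range
  refine ⟨max C 1, by positivity, fun n => le_max_of_le_left (hC ⟨n, rfl⟩)⟩

lemma exists_norm_inv_qPochhammer_le {z p : ℂ} (hz : ‖z‖ < 1) (hp : ‖p‖ < 1) :
    ∃ C : ℝ, 0 < C ∧ ∀ n, ‖(qPochhammer z p n)⁻¹‖ ≤ C := by
  obtain ⟨C, hC⟩ :=
    ((tendsto_qPochhammer hz hp).inv₀ (qPochhammerInf_ne_zero z p)).norm.bddAbove_range
  refine ⟨max C 1, by positivity, fun n => le_max_of_le_left (hC ⟨n, rfl⟩)⟩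

lemma qPochhammer_general_bound {p : ℂ} (hp : ‖p‖ < 1) (a : ℂ) :
    ∃ C : ℝ, 0 < C ∧ ∀ n, ‖qPochhammer a p n‖ ≤ C := by
  obtain ⟨N, hN⟩ : ∃ N : ℕ, ‖a * p ^ N‖ < 1 := by
    have : Tendsto (fun n : ℕ => ‖a * p ^ n‖) atTop (𝓝 0) := by
      have := (tendsto_pow_atTop_nhds_zero_of_lt_one (norm_nonneg p) hp).const_mul ‖a‖
      simpa using this
    exact (this.eventually (gt_mem_nhds one_pos)).exists
  have h : Tendsto (fun n => qPochhammer a p n) atTop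
      (𝓝 (qPochhammer a p N * qPochhammerInf (a * p ^ N) p)) := by
    rw [← tendsto_add_atTop_iff_nat N]
    refine ((tendsto_qPochhammer hN hp).const_mul (qPochhammer a p N)).congr fun n => ?_
    rw [add_comm, qPochhammer_add]
  obtain ⟨C, hC⟩ := h.norm.bddAbove_range
  refine ⟨max C 1, by positivity, fun n => le_max_of_le_left (hC ⟨n, rfl⟩)⟩

lemma exists_norm_one_phi_one_le {a y p : ℂ} (hp : ‖p‖ < 1) (hay : ‖a * y‖ < 1) :
    ∃ C : ℝ, 0 < C ∧ ∀ i, ‖qFactInv p i * ((-1) ^ i * p ^ i.choose 2 * qPochhammer a p i *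
      (qPochhammer (a * y) p i)⁻¹ * y ^ i)‖ ≤ C * ‖y‖ ^ i := by
  obtain ⟨C1, h1, hC1⟩ := qPochhammer_general_bound hp a
  obtain ⟨C2, h2, hC2⟩ := exists_norm_inv_qPochhammer_le hay hp
  obtain ⟨C3, h3, hC3⟩ := exists_norm_inv_qPochhammer_le hp hp
  refine ⟨C3 * (C1 * C2), by positivity, fun i => ?_⟩
  simp only [norm_mul, norm_pow, norm_neg, norm_one, one_pow, one_mul]
  have e1 : ‖p‖ ^ i.choose 2 ≤ 1 := pow_le_one₀ (norm_nonneg p) hp.le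
  calc _ ≤ C3 * (1 * C1 * C2 * ‖y‖ ^ i) := by
        gcongr
        · exact hC3 i
        · exact hC1 i
        · exact hC2 i
    _ = _ := by ring

/-- The `₁φ₁` summation formula. -/
lemma hasSum_one_phi_one {a y p : ℂ} (hp : ‖p‖ < 1) (hy : ‖y‖ < 1) (hay : ‖a * y‖ < 1) :
    HasSum (fun i : ℕ => qFactInv p i * ((-1) ^ i * p ^ i.choose 2 * qPochhammer a p i *
      (qPochhammer (a * y) p i)⁻¹ * y ^ i))
      (qPochhammerInf y p * (qPochhammerInf (a * y) p)⁻¹) := by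
  obtain ⟨C, hC0, hC⟩ := exists_norm_one_phi_one_le hp hay
  obtain ⟨C1, hC10, hC1⟩ := exists_norm_inv_qPochhammer_le hp hp
  obtain ⟨C2, hC20, hC2⟩ := exists_norm_qPochhammer_le hp hp
  set f : ℕ → ℂ := fun i => qFactInv p i * ((-1) ^ i * p ^ i.choose 2 * qPochhammer a p i *
      (qPochhammer (a * y) p i)⁻¹ * y ^ i) with hf
  have hgeo := summable_geometric_of_lt_one (norm_nonneg y) hy
  have hsum : Summable f := Summable.of_norm_bounded (hgeo.mul_left C) hC
  -- Multiplying the terminating sum by (p; p)_M makes each term tend to f i, since (p; p)_M/(p;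
  -- p)_{M-i} → 1. A geometric majorant then permits the limit M → ∞ under the sum.
  set F : ℕ → ℕ → ℂ := fun M i => if i ≤ M then qPochhammer p p M * qFactInv p (M - i) * f i else 0
    with hF
  have h1 : ∀ M, ∑' i, F M i = qPochhammer y p M * (qPochhammer (a * y) p M)⁻¹ := by
    intro M
    rw [tsum_eq_sum (s := range (M + 1)) (fun i hi => by
      simp only [Finset.mem_range] at hi; simp [hF, show ¬ i ≤ M by omega])]
    have h := sum_antidiagonal_qVandermonde hp y M a hay
    rw [Finset.Nat.sum_antidiagonal_eq_sum_range_succ (f := fun i j => qFactInv p i * qFactInv p j *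
      ((-1) ^ i * p ^ i.choose 2 * qPochhammer a p i * (qPochhammer (a * y) p i)⁻¹ * y ^ i))] at h
    apply mul_left_cancel₀ (qFactInv_ne_zero hp M)
    rw [← mul_assoc, ← h, Finset.mul_sum]
    refine Finset.sum_congr rfl fun i hi => ?_
    have hi' : i ≤ M := by have := Finset.mem_range.mp hi; omega
    have hM : qFactInv p M * qPochhammer p p M = 1 :=
      inv_mul_cancel₀ (qPochhammer_ne_zero hp hp M)
    simp only [hF, hf, if_pos hi']
    linear_combination (qFactInv p (M - i) * (qFactInv p i * ((-1) ^ i * p ^ i.choose 2 *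
      qPochhammer a p i * (qPochhammer (a * y) p i)⁻¹ * y ^ i))) * hM
  have h2 : Tendsto (fun M => ∑' i, F M i) atTop (𝓝 (∑' i, f i)) := by
    refine tendsto_tsum_of_dominated_convergence (bound := fun i => C2 * C1 * (C * ‖y‖ ^ i))
      ((hgeo.mul_left C).mul_left _) (fun i => ?_) (Eventually.of_forall fun M i => ?_)
    · have e1 : Tendsto (fun M => qPochhammer p p M * qFactInv p (M - i) * f i) atTop
          (𝓝 (qPochhammerInf p p * (qPochhammerInf p p)⁻¹ * f i)) := by
        refine ((tendsto_qPochhammer hp hp).mul ?_).mul_const _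
        exact ((tendsto_qPochhammer hp hp).inv₀ (qPochhammerInf_ne_zero p p)).comp
          (tendsto_sub_atTop_nat i)
      rw [mul_inv_cancel₀ (qPochhammerInf_ne_zero p p), one_mul] at e1
      refine e1.congr' ?_
      filter_upwards [eventually_ge_atTop i] with M hM
      simp [hF, hM]
    · by_cases hi : i ≤ M
      · simp only [hF, if_pos hi]
        rw [norm_mul, norm_mul]
        gcongr
        · exact hC2 M
        · exact hC1 _
        · exact hC i
      · simp only [hF, if_neg hi, norm_zero]
        positivity
  have h3 : Tendsto (fun M => ∑' i, F M i) atTop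
      (𝓝 (qPochhammerInf y p * (qPochhammerInf (a * y) p)⁻¹)) := by
    simp only [h1]
    exact (tendsto_qPochhammer hy hp).mul
      ((tendsto_qPochhammer hay hp).inv₀ (qPochhammerInf_ne_zero _ _))
  rw [← tendsto_nhds_unique h2 h3]
  exact hsum.hasSum

/-- Euler's expansion of `(y; p)_∞`. -/
lemma hasSum_qPochhammerInf {y p : ℂ} (hp : ‖p‖ < 1) (hy : ‖y‖ < 1) :
    HasSum (fun i : ℕ => qFactInv p i * ((-1) ^ i * p ^ i.choose 2 * y ^ i))
      (qPochhammerInf y p) := by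
  have h := hasSum_one_phi_one (a := 0) hp hy (by simp)
  simpa [qPochhammer_zero_left, qPochhammerInf] using h

/-! ### Reduction of the triple sum and absolute convergence -/

/-- The summand of `R₃⁽³⁾` in terms of the chain `a ≤ b ≤ n`. -/
noncomputable def tripleTerm (q : ℂ) (n b a : ℕ) : ℂ :=
  (-1) ^ n * q ^ (n ^ 2 + 2 * n) * qPochhammer q (q ^ 2) n * (qPochhammer (-q ^ 2) (q ^ 2) n)⁻¹ *
    (qPochhammer (-q ^ 2) (q ^ 2) b * (q ^ 2) ^ (b + 1).choose 2 * qFactInv (q ^ 2) (n - b) *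
      ((-1) ^ a * (q ^ 2) ^ a * qPochhammer (-q ^ 2) (q ^ 2) (2 * a) *
        (qFactInv ((q ^ 2) ^ 2) (b - a) * qFactInv ((q ^ 2) ^ 4) a)))

lemma baileyR3Term_three (q : ℂ) (m : Fin 3 → ℕ) :
    baileyR3Term 3 q m = tripleTerm q (m 2) (m 1) (m 0) := by
  have h3 : chainEntry m 3 = m 2 := rfl
  have h2 : chainEntry m 2 = m 1 := rfl
  have h1 : chainEntry m 1 = m 0 := rfl
  have h0 : chainEntry m 0 = 0 := rfl
  have i1 : Finset.Icc 1 3 = {1, 2, 3} := rfl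
  rw [baileyR3Term, baileyB, tripleTerm, show (3 : ℕ) - 1 = 2 from rfl, Finset.Icc_self,
    Finset.prod_singleton, i1, Finset.prod_insert (by simp), Finset.prod_insert (by simp),
    Finset.prod_singleton]
  simp only [h1, h2, h3, h0, show (3 : ℕ) - 2 = 1 from rfl, show (2 : ℕ) - 2 = 0 from rfl,
    show (3 : ℕ) - 1 = 2 from rfl, pow_zero, pow_one, one_mul, Nat.sub_zero, zero_add,
    show (2 : ℕ) + 1 = 3 from rfl, show (1 : ℕ) + 1 = 2 from rfl, show (2 : ℕ) ^ 2 = 4 from rfl,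
    div_eq_mul_inv, mul_inv, qFactInv]
  ring

lemma qPochhammer_two_mul (x p : ℂ) (a : ℕ) :
    qPochhammer x p (2 * a) = qPochhammer x (p ^ 2) a * qPochhammer (x * p) (p ^ 2) a := by
  induction a with
  | zero => simp [qPochhammer_zero]
  | succ a ih =>
    rw [show 2 * (a + 1) = 2 * a + 1 + 1 by ring, qPochhammer_succ, qPochhammer_succ, ih,
      qPochhammer_succ, qPochhammer_succ]
    ring

lemma qPochhammer_sq_sq (x p : ℂ) (a : ℕ) :
    qPochhammer (x ^ 2) (p ^ 2) a = qPochhammer x p a * qPochhammer (-x) p a := by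
  induction a with
  | zero => simp [qPochhammer_zero]
  | succ a ih =>
    rw [qPochhammer_succ, qPochhammer_succ, ih, qPochhammer_succ]
    ring

/-- Both (-p; p)_{2a} and (p⁴; p⁴)_a contain (-p²; p²)_a. Cancelling it leaves the convolution of
`sum_antidiagonal_eq_qExpPartial` with x = -p. -/
lemma sum_range_eq_qExpPartial {p : ℂ} (hp : ‖p‖ < 1) (b : ℕ) :
    ∑ a ∈ range (b + 1), (-1) ^ a * p ^ a * qPochhammer (-p) p (2 * a) *
        (qFactInv (p ^ 2) (b - a) * qFactInv (p ^ 4) a)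
      = qExpPartial (p ^ 2) (-p) b := by
  have hp2 : ‖p ^ 2‖ < 1 := norm_pow_succ_lt_one hp 1
  have h := sum_antidiagonal_eq_qExpPartial (x := -p) (by simpa using hp2) b
  simp only [neg_sq] at h
  rw [← h, Finset.Nat.sum_antidiagonal_eq_sum_range_succ (f := fun i j => (-p) ^ i *
    qPochhammer (-p) (p ^ 2) i * (qFactInv (p ^ 2) i * qFactInv (p ^ 2) j))]
  refine Finset.sum_congr rfl fun a _ => ?_
  have h1 : qPochhammer (-p ^ 2) (p ^ 2) a ≠ 0 := qPochhammer_ne_zero (by rwa [norm_neg]) hp2 a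
  have h2 : qPochhammer (-p ^ 2) (p ^ 2) a * qFactInv (p ^ 4) a = qFactInv (p ^ 2) a := by
    rw [qFactInv, show p ^ 4 = (p ^ 2) ^ 2 by ring, qPochhammer_sq_sq, mul_inv,
      mul_left_comm, mul_inv_cancel₀ h1, mul_one, qFactInv]
  rw [qPochhammer_two_mul, show -p * p = -p ^ 2 by ring, ← h2, neg_pow p a]
  ring

/-- The `n`-th term of `R₃⁽³⁾` after summation over the two inner variables. -/
noncomputable def outerTerm (q : ℂ) (n : ℕ) : ℂ :=
  (-1) ^ n * q ^ (n ^ 2 + 2 * n) * qPochhammer q (q ^ 2) n * (qPochhammer (-q ^ 2) (q ^ 2) n)⁻¹ *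
    ∑ b ∈ range (n + 1), qPochhammer (-q ^ 2) (q ^ 2) b * (q ^ 2) ^ (b + 1).choose 2 *
      qFactInv (q ^ 2) (n - b) * qExpPartial ((q ^ 2) ^ 2) (-q ^ 2) b

lemma sum_tripleTerm {q : ℂ} (hq : ‖q‖ < 1) (n : ℕ) :
    ∑ b ∈ range (n + 1), ∑ a ∈ range (b + 1), tripleTerm q n b a = outerTerm q n := by
  have hp : ‖q ^ 2‖ < 1 := norm_pow_succ_lt_one hq 1
  simp only [outerTerm, tripleTerm, ← Finset.mul_sum, sum_range_eq_qExpPartial hp]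

lemma exists_norm_tripleTerm_le {q : ℂ} (hq : ‖q‖ < 1) :
    ∃ C : ℝ, ∀ n b a, a ≤ b → b ≤ n →
      ‖tripleTerm q n b a‖ ≤ C * (‖q‖ ^ n * (‖q‖ ^ b * ‖q‖ ^ a)) := by
  have hp : ‖q ^ 2‖ < 1 := norm_pow_succ_lt_one hq 1
  have hP : ‖(q ^ 2) ^ 2‖ < 1 := norm_pow_succ_lt_one hp 1
  have hP2 : ‖(q ^ 2) ^ 4‖ < 1 := norm_pow_succ_lt_one hp 3
  have hn : ‖-q ^ 2‖ < 1 := by rwa [norm_neg]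
  obtain ⟨C1, h1, hC1⟩ := exists_norm_qPochhammer_le hq hp
  obtain ⟨C2, h2, hC2⟩ := exists_norm_inv_qPochhammer_le hn hp
  obtain ⟨C3, h3, hC3⟩ := exists_norm_qPochhammer_le hn hp
  obtain ⟨C4, h4, hC4⟩ := exists_norm_inv_qPochhammer_le hp hp
  obtain ⟨C5, h5, hC5⟩ := exists_norm_inv_qPochhammer_le hP hP
  obtain ⟨C6, h6, hC6⟩ := exists_norm_inv_qPochhammer_le hP2 hP2
  refine ⟨C1 * C2 * (C3 * C4 * (C3 * (C5 * C6))), fun n b a hab hbn => ?_⟩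
  have hr0 := norm_nonneg q
  -- From a ≤ b ≤ n, n² + 2n ≥ 3n ≥ n + b + a: the outer Gaussian weight alone gives geometric decay
  -- in all three variables.
  have e1 : ‖q‖ ^ (n ^ 2 + 2 * n) ≤ ‖q‖ ^ n * (‖q‖ ^ b * ‖q‖ ^ a) := by
    rw [← pow_add, ← pow_add]
    refine pow_le_pow_of_le_one hr0 hq.le ?_
    have : n ≤ n ^ 2 := Nat.le_self_pow (by norm_num) n
    omega
  have e2 : ∀ k : ℕ, ‖q ^ 2‖ ^ k ≤ 1 := fun k => pow_le_one₀ (norm_nonneg _) hp.le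
  rw [tripleTerm]
  simp only [norm_mul, norm_pow (-1 : ℂ), norm_pow q (n ^ 2 + 2 * n), norm_pow (q ^ 2) a,
    norm_pow (q ^ 2) ((b + 1).choose 2), norm_neg (1 : ℂ), norm_one, one_pow, one_mul]
  calc _ ≤ ‖q‖ ^ n * (‖q‖ ^ b * ‖q‖ ^ a) * C1 * C2 * (C3 * 1 * C4 * (1 * C3 * (C5 * C6))) := by
        gcongr
        · exact hC1 n
        · exact hC2 n
        · exact hC3 b
        · exact e2 _
        · exact hC4 _
        · exact e2 _
        · exact hC3 _
        · exact hC5 _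
        · exact hC6 _
    _ = _ := by ring

/-- The sum over chains converges absolutely, and may be summed over the largest entry last. -/
lemma hasSum_outerTerm {q : ℂ} (hq : ‖q‖ < 1) :
    Summable (fun m : {m : Fin 3 → ℕ // Monotone m} => baileyR3Term 3 q m.1) ∧
      HasSum (outerTerm q) (baileyR3 3 q) := by
  obtain ⟨C, hC⟩ := exists_norm_tripleTerm_le hq
  -- Extension by zero to ℕ³, where summation by fibres over the largest entry is available.
  set G : ℕ × ℕ × ℕ → ℂ := fun x => if x.2.2 ≤ x.2.1 ∧ x.2.1 ≤ x.1 then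
    tripleTerm q x.1 x.2.1 x.2.2 else 0 with hG
  have hgeo := summable_geometric_of_lt_one (norm_nonneg q) hq
  have hGs : Summable G := by
    have hC0 : 0 ≤ C := by
      have := (norm_nonneg _).trans (hC 0 0 0 le_rfl le_rfl)
      simpa using this
    refine Summable.of_norm_bounded (g := fun x : ℕ × ℕ × ℕ =>
      C * (‖q‖ ^ x.1 * (‖q‖ ^ x.2.1 * ‖q‖ ^ x.2.2))) ?_ fun x => ?_
    · refine Summable.mul_left _ ?_
      refine Summable.mul_of_nonneg (f := fun i : ℕ => ‖q‖ ^ i)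
        (g := fun x : ℕ × ℕ => ‖q‖ ^ x.1 * ‖q‖ ^ x.2) hgeo ?_ (fun i => by positivity)
        (fun x => by positivity)
      exact hgeo.mul_of_nonneg hgeo (fun i => by positivity) (fun i => by positivity)
    · by_cases h : x.2.2 ≤ x.2.1 ∧ x.2.1 ≤ x.1
      · simp only [hG, if_pos h]
        exact hC _ _ _ h.1 h.2
      · simp only [hG, if_neg h, norm_zero]
        positivity
  set g : {m : Fin 3 → ℕ // Monotone m} → ℕ × ℕ × ℕ := fun m => (m.1 2, m.1 1, m.1 0) with hg
  have hinj : Function.Injective g := by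
    rintro ⟨m, hm⟩ ⟨m', hm'⟩ h
    simp only [hg, Prod.mk.injEq] at h
    refine Subtype.ext (funext fun i => ?_)
    fin_cases i
    · exact h.2.2
    · exact h.2.1
    · exact h.1
  have hcomp : ∀ m : {m : Fin 3 → ℕ // Monotone m}, G (g m) = baileyR3Term 3 q m.1 := by
    rintro ⟨m, hm⟩
    have h1 : m 0 ≤ m 1 := hm (by decide)
    have h2 : m 1 ≤ m 2 := hm (by decide)
    simp only [hG, hg, h1, h2, and_self, if_true, baileyR3Term_three]
  have hsupp : Function.support G ⊆ Set.range g := by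
    rintro ⟨n, b, a⟩ hx
    have h : a ≤ b ∧ b ≤ n := by
      by_contra h
      exact hx (by simp only [hG, if_neg h])
    refine ⟨⟨![a, b, n], ?_⟩, rfl⟩
    intro i j hij
    fin_cases i <;> fin_cases j <;> simp at hij ⊢ <;> omega
  have hts : ∑' x, G x = baileyR3 3 q := by
    rw [baileyR3, ← hinj.tsum_eq hsupp]
    exact tsum_congr hcomp
  refine ⟨?_, ?_⟩
  · exact (hGs.comp_injective hinj).congr fun m => hcomp m
  · have h1 := hGs.hasSum
    rw [hts] at h1
    refine h1.prod_fiberwise fun n => ?_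
    rw [← sum_tripleTerm hq n]
    have h2 : ∑ b ∈ range (n + 1), ∑ a ∈ range (b + 1), tripleTerm q n b a
        = ∑ x ∈ range (n + 1) ×ˢ range (n + 1), G (n, x) := by
      rw [Finset.sum_product]
      refine Finset.sum_congr rfl fun b hb => ?_
      have hb' : b ≤ n := by have := Finset.mem_range.mp hb; omega
      rw [← Finset.sum_subset (Finset.range_mono (show b + 1 ≤ n + 1 by omega))]
      · refine Finset.sum_congr rfl fun a ha => ?_
        have ha' : a ≤ b := by have := Finset.mem_range.mp ha; omega
        simp only [hG, ha', hb', and_self, if_true]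
      · intro a _ ha
        have : ¬ a ≤ b := by have := Finset.mem_range.not.mp ha; omega
        simp only [hG, this, false_and, if_false]
    rw [h2]
    refine hasSum_sum_of_ne_finset_zero fun x hx => ?_
    simp only [Finset.mem_product, Finset.mem_range] at hx
    have : ¬ (x.2 ≤ x.1 ∧ x.1 ≤ n) := by omega
    simp only [hG, this, if_false]

/-! ### The Hecke-type double sum and the product bound -/

lemma norm_heckeCoeff_le {p : ℂ} (hp : ‖p‖ < 1) (r : ℕ) : ‖heckeCoeff p r‖ ≤ 2 * (r + 1) := by
  have h : ∀ j ∈ range (r + 1),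
      ‖alternatingWeight j * p ^ (2 * ((r - j) * (r + j)) + r)‖ ≤ 2 := by
    intro j _
    have h1 : ‖alternatingWeight j‖ ≤ 2 := by
      rw [alternatingWeight]
      split_ifs <;> simp
    have h2 : ‖p ^ (2 * ((r - j) * (r + j)) + r)‖ ≤ 1 := by
      rw [norm_pow]
      exact pow_le_one₀ (norm_nonneg p) hp.le
    rw [norm_mul]
    nlinarith [norm_nonneg (alternatingWeight j), norm_nonneg (p ^ (2 * ((r - j) * (r + j)) + r))]
  refine (norm_sum_le_of_le _ h).trans ?_
  simp
  linarith

/-- The coefficients `α_r` of the Bailey pair, up to normalisation. -/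
noncomputable def baileyAlpha (p : ℂ) (r : ℕ) : ℂ :=
  (1 - p ^ (2 * r + 1)) * heckeCoeff p r * p ^ (r + 1).choose 2

lemma norm_baileyAlpha_le {p : ℂ} (hp : ‖p‖ < 1) (r : ℕ) :
    ‖baileyAlpha p r‖ ≤ 4 * (r + 1) := by
  have h1 : ‖1 - p ^ (2 * r + 1)‖ ≤ 2 := by
    refine (norm_sub_le _ _).trans ?_
    have := norm_pow_succ_lt_one hp (2 * r)
    rw [norm_one]
    linarith
  have h2 : ‖p ^ (r + 1).choose 2‖ ≤ 1 := by
    rw [norm_pow]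
    exact pow_le_one₀ (norm_nonneg p) hp.le
  rw [baileyAlpha, norm_mul, norm_mul]
  calc _ ≤ 2 * (2 * ((r : ℝ) + 1)) * 1 := by
        gcongr
        exact norm_heckeCoeff_le hp r
    _ = _ := by ring

lemma outerTerm_eq_hecke {q : ℂ} (hq : ‖q‖ < 1) (n : ℕ) :
    outerTerm q n = ∑ x ∈ antidiagonal n, (-1) ^ (x.1 + x.2) *
      q ^ ((x.1 + x.2) ^ 2 + 2 * (x.1 + x.2)) * qPochhammer q (q ^ 2) (x.1 + x.2) *
      (baileyAlpha (q ^ 2) x.1 * (qFactInv (q ^ 2) x.2 *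
        qFactInv (q ^ 2) (x.1 + x.2 + x.1 + 1))) := by
  have hp : ‖q ^ 2‖ < 1 := norm_pow_succ_lt_one hq 1
  have hn : qPochhammer (-q ^ 2) (q ^ 2) n ≠ 0 := qPochhammer_ne_zero (by rwa [norm_neg]) hp n
  rw [outerTerm, sum_range_mul_qExpPartial_eq_hecke hp, mul_assoc _ (_⁻¹), inv_mul_cancel_left₀ hn,
    Finset.Nat.sum_antidiagonal_eq_sum_range_succ_mk, Finset.mul_sum]
  refine Finset.sum_congr rfl fun r hr => ?_
  have : r + (n - r) = n := by have := Finset.mem_range.mp hr; omega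
  simp only [this, baileyAlpha]

/-- The Hecke-type double sum for `R₃⁽³⁾`. -/
lemma hasSum_hecke {q : ℂ} (hq : ‖q‖ < 1) :
    HasSum (fun r : ℕ => qPochhammerInf q (q ^ 2) * (qPochhammerInf (q ^ 2) (q ^ 2))⁻¹ *
      ((-1) ^ r * q ^ (r ^ 2 + 2 * r) * baileyAlpha (q ^ 2) r * (1 - q ^ (2 * r + 1))⁻¹))
      (baileyR3 3 q) := by
  set p := q ^ 2 with hpdef
  have hp : ‖p‖ < 1 := norm_pow_succ_lt_one hq 1
  set h : ℕ × ℕ → ℂ := fun x => (-1) ^ (x.1 + x.2) *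
      q ^ ((x.1 + x.2) ^ 2 + 2 * (x.1 + x.2)) * qPochhammer q p (x.1 + x.2) *
      (baileyAlpha p x.1 * (qFactInv p x.2 * qFactInv p (x.1 + x.2 + x.1 + 1))) with hh
  have hgeo := summable_geometric_of_lt_one (norm_nonneg q) hq
  have hsum : Summable h := by
    obtain ⟨C1, h1, hC1⟩ := exists_norm_qPochhammer_le hq hp
    obtain ⟨C2, h2, hC2⟩ := exists_norm_inv_qPochhammer_le hp hp
    refine Summable.of_norm_bounded (g := fun x : ℕ × ℕ =>
      (C1 * 4 * C2 * C2) * (((x.1 + 1 : ℕ).choose 1 * ‖q‖ ^ x.1) * ‖q‖ ^ x.2)) ?_ fun x => ?_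
    · refine Summable.mul_left _ ?_
      refine Summable.mul_of_nonneg (f := fun i : ℕ => ((i + 1 : ℕ).choose 1 * ‖q‖ ^ i : ℝ))
        (g := fun i : ℕ => ‖q‖ ^ i) ?_ hgeo (fun i => by positivity) (fun i => by positivity)
      exact (hasSum_choose_mul_geometric_of_norm_lt_one 1 (by simpa using hq)).summable
    · rw [hh]
      simp only [norm_mul, norm_pow, norm_neg, norm_one, one_pow, one_mul, Nat.choose_one_right]
      have e1 : ‖q‖ ^ ((x.1 + x.2) ^ 2 + 2 * (x.1 + x.2)) ≤ ‖q‖ ^ x.1 * ‖q‖ ^ x.2 := by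
        rw [← pow_add]
        exact pow_le_pow_of_le_one (norm_nonneg q) hq.le (by nlinarith)
      calc _ ≤ (‖q‖ ^ x.1 * ‖q‖ ^ x.2) * C1 * ((4 * (x.1 + 1)) * (C2 * C2)) := by
            gcongr
            · exact hC1 _
            · exact norm_baileyAlpha_le hp _
            · exact hC2 _
            · exact hC2 _
        _ = _ := by push_cast; ring
  have hR : ∑' x, h x = baileyR3 3 q := by
    have e1 := (Finset.HasAntidiagonal.sigmaAntidiagonalEquivProd.hasSum_iff (f := h)).mpr
      hsum.hasSum
    have e2 : HasSum (outerTerm q) (∑' x, h x) := by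
      refine e1.sigma fun n => ?_
      rw [outerTerm_eq_hecke hq n]
      exact Finset.hasSum (antidiagonal n) h
    exact e2.unique (hasSum_outerTerm hq).2
  have h1 := hsum.hasSum
  rw [hR] at h1
  refine h1.prod_fiberwise fun r => ?_
  -- For fixed r and n = r + m, the sum over m is a ₁φ₁ with a = q^(2r+1) and y = q^(2r+3), so that
  -- ay = p^(2r+2).
  have hy : ‖q ^ 3 * p ^ r‖ < 1 := norm_mul_pow_lt_one (norm_pow_succ_lt_one hq 2) hp r
  have hay' : q * p ^ r * (q ^ 3 * p ^ r) = p ^ (2 * r + 1 + 1) := by rw [hpdef]; ring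
  have hay : ‖q * p ^ r * (q ^ 3 * p ^ r)‖ < 1 := by
    rw [hay']; exact norm_pow_succ_lt_one hp _
  have hs := (hasSum_one_phi_one hp hy hay).mul_left ((-1) ^ r * q ^ (r ^ 2 + 2 * r) *
    qPochhammer q p r * baileyAlpha p r * qFactInv p (2 * r + 1))
  rw [hay'] at hs
  have hfun : ∀ m : ℕ, h (r, m) = (-1) ^ r * q ^ (r ^ 2 + 2 * r) *
      qPochhammer q p r * baileyAlpha p r * qFactInv p (2 * r + 1) * (qFactInv p m *
        ((-1) ^ m * p ^ m.choose 2 * qPochhammer (q * p ^ r) p m *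
        (qPochhammer (p ^ (2 * r + 1 + 1)) p m)⁻¹ * (q ^ 3 * p ^ r) ^ m)) := by
    intro m
    have e1 : q ^ ((r + m) ^ 2 + 2 * (r + m))
        = q ^ (r ^ 2 + 2 * r) * (p ^ m.choose 2 * (q ^ 3 * p ^ r) ^ m) := by
      have e2 : 2 * m.choose 2 + m = m ^ 2 := by
        clear hs
        induction m with
        | zero => simp
        | succ m ih =>
          rw [Nat.choose_succ_succ' m 1, Nat.choose_one_right]
          linarith
      rw [hpdef, mul_pow, ← pow_mul, ← pow_mul, ← pow_mul, ← pow_mul, ← pow_add, ← pow_add,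
        ← pow_add]
      congr 1
      linarith
    rw [hh]
    simp only
    rw [e1, qPochhammer_add, show r + m + r + 1 = 2 * r + 1 + m by ring, qFactInv_add]
    ring
  have h2 := hs
  simp only [← hfun] at h2
  -- The finite symbol (q; q²)_r and the infinite product starting at q^(2r+3) miss only the factor
  -- 1 - q^(2r+1) of (q; q²)_∞; this is the denominator in the Hecke sum.
  have f1 : qPochhammer q p r * ((1 - q ^ (2 * r + 1)) * qPochhammerInf (q ^ 3 * p ^ r) p)
      = qPochhammerInf q p := by
    rw [← qPochhammer_mul_inf hq hp r, qPochhammerInf_eq_mul (norm_mul_pow_lt_one hq hp r) hp, hpdef]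
    ring_nf
  have f2 : qPochhammer p p (2 * r + 1) * qPochhammerInf (p ^ (2 * r + 1 + 1)) p
      = qPochhammerInf p p := by
    rw [← qPochhammer_mul_inf hp hp (2 * r + 1), pow_succ' p (2 * r + 1)]
  have g1 : 1 - q ^ (2 * r + 1) ≠ 0 := one_sub_pow_succ_ne_zero hq _
  refine (congrArg (HasSum fun m => h (r, m)) ?_).mp h2
  rw [← f1, ← f2, mul_inv, qFactInv]
  field_simp

/-- The contribution of the product to `R₃⁽³⁾` dominates up to powers of `1 - |q|`. -/
lemma norm_baileyR3_le_product {q : ℂ} (hq : ‖q‖ < 1) :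
    ‖baileyR3 3 q‖ ≤ ‖qPochhammerInf q (q ^ 2) * (qPochhammerInf (q ^ 2) (q ^ 2))⁻¹‖ *
      (4 * (1 - ‖q‖)⁻¹ ^ 3) := by
  have hp : ‖q ^ 2‖ < 1 := norm_pow_succ_lt_one hq 1
  have h0 : 0 < 1 - ‖q‖ := by linarith
  have hs := ((hasSum_choose_mul_geometric_of_norm_lt_one 1 (r := ‖q‖) (by simpa using hq)).mul_left
    (4 * (1 - ‖q‖)⁻¹)).mul_left
    ‖qPochhammerInf q (q ^ 2) * (qPochhammerInf (q ^ 2) (q ^ 2))⁻¹‖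
  have h := (hasSum_hecke hq).norm_le_of_bounded hs fun r => ?_
  · refine h.trans (le_of_eq ?_)
    field_simp
  · rw [norm_mul]
    gcongr
    simp only [norm_mul, norm_pow (-1 : ℂ), norm_pow q (r ^ 2 + 2 * r), norm_neg, norm_one, one_pow,
      one_mul, norm_inv, Nat.choose_one_right]
    have e1 : ‖q‖ ^ (r ^ 2 + 2 * r) ≤ ‖q‖ ^ r :=
      pow_le_pow_of_le_one (norm_nonneg q) hq.le (by nlinarith)
    calc _ ≤ ‖q‖ ^ r * (4 * (r + 1)) * (1 - ‖q‖)⁻¹ := by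
          gcongr
          · exact norm_baileyAlpha_le hp r
          · exact one_sub_norm_le_norm_one_sub_pow hq _
      _ = _ := by push_cast; ring

/-! ### Gaussian binomials and the expansion used near q = -1 -/

/-- The real number `1 / (ρ; ρ)_m`. -/
noncomputable def realFactInv (ρ : ℝ) (m : ℕ) : ℝ := ∏ i ∈ range m, (1 - ρ ^ (i + 1))⁻¹

lemma one_sub_pow_succ_pos {ρ : ℝ} (h0 : 0 ≤ ρ) (h1 : ρ < 1) (n : ℕ) : 0 < 1 - ρ ^ (n + 1) := by
  have := pow_lt_one₀ h0 h1 (show n + 1 ≠ 0 by omega)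
  linarith

lemma realFactInv_pos {ρ : ℝ} (h0 : 0 ≤ ρ) (h1 : ρ < 1) (m : ℕ) : 0 < realFactInv ρ m :=
  Finset.prod_pos fun i _ => inv_pos.mpr (one_sub_pow_succ_pos h0 h1 i)

lemma one_sub_mul_realFactInv_succ {ρ : ℝ} (h0 : 0 ≤ ρ) (h1 : ρ < 1) (m : ℕ) :
    (1 - ρ ^ (m + 1)) * realFactInv ρ (m + 1) = realFactInv ρ m := by
  rw [realFactInv, Finset.prod_range_succ, mul_left_comm,
    mul_inv_cancel₀ (one_sub_pow_succ_pos h0 h1 m).ne', mul_one, realFactInv]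

lemma one_le_realFactInv {ρ : ℝ} (h0 : 0 ≤ ρ) (h1 : ρ < 1) (m : ℕ) : 1 ≤ realFactInv ρ m := by
  induction m with
  | zero => simp [realFactInv]
  | succ m ih =>
    rw [← one_sub_mul_realFactInv_succ h0 h1] at ih
    have h2 := realFactInv_pos h0 h1 (m + 1)
    have h3 : 0 ≤ ρ ^ (m + 1) := by positivity
    nlinarith

lemma qFactInv_ofReal (ρ : ℝ) (m : ℕ) : qFactInv (ρ : ℂ) m = (realFactInv ρ m : ℂ) := by
  rw [qFactInv, qPochhammer, realFactInv, ← Finset.prod_inv_distrib]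
  push_cast
  exact Finset.prod_congr rfl fun i _ => by rw [pow_succ']

lemma norm_qFactInv_le {p : ℂ} (hp : ‖p‖ < 1) (m : ℕ) : ‖qFactInv p m‖ ≤ realFactInv ‖p‖ m := by
  rw [qFactInv, qPochhammer, realFactInv, ← Finset.prod_inv_distrib, norm_prod]
  refine Finset.prod_le_prod (fun i _ => norm_nonneg _) fun i _ => ?_
  rw [norm_inv, ← pow_succ']
  refine inv_anti₀ (one_sub_pow_succ_pos (norm_nonneg p) hp i) ?_
  have := norm_sub_norm_le (1 : ℂ) (p ^ (i + 1))
  rwa [norm_one, norm_pow] at this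

/-- The Gaussian binomial coefficient `[n + N, n]`. -/
noncomputable def gaussBinom (p : ℂ) (n N : ℕ) : ℂ :=
  qPochhammer p p (n + N) * (qFactInv p n * qFactInv p N)

lemma gaussBinom_eq {p : ℂ} (hp : ‖p‖ < 1) (n N : ℕ) :
    gaussBinom p n N = qFactInv p n * qPochhammer (p ^ (N + 1)) p n := by
  have h : qPochhammer p p N * qFactInv p N = 1 := mul_inv_cancel₀ (qPochhammer_ne_zero hp hp N)
  rw [gaussBinom, add_comm n N, qPochhammer_add, ← pow_succ']
  linear_combination (qFactInv p n * qPochhammer (p ^ (N + 1)) p n) * h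

lemma gaussBinom_comm (p : ℂ) (n N : ℕ) : gaussBinom p n N = gaussBinom p N n := by
  rw [gaussBinom, gaussBinom, add_comm n N, mul_comm (qFactInv p n)]

lemma gaussBinom_succ_succ {p : ℂ} (hp : ‖p‖ < 1) (n N : ℕ) :
    gaussBinom p (n + 1) (N + 1)
      = gaussBinom p n (N + 1) + p ^ (n + 1) * gaussBinom p (n + 1) N := by
  rw [gaussBinom, gaussBinom, gaussBinom, show n + 1 + (N + 1) = n + N + 1 + 1 by ring,
    show n + (N + 1) = n + N + 1 by ring, show n + 1 + N = n + N + 1 by ring,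
    qPochhammer_succ p p (n + N + 1), ← one_sub_mul_qFactInv_succ hp n,
    ← one_sub_mul_qFactInv_succ hp N]
  ring

/-- Double induction through q-Pascal, since R_n + |p|^(n+1) R_{n+1} = R_{n+1} for R_n = 1/(|p|;
|p|)_n. Bounding the numerator (p^(N+1); p)_n factor by factor could cost an exponentially large
amount. -/
lemma norm_gaussBinom_le {p : ℂ} (hp : ‖p‖ < 1) (n N : ℕ) :
    ‖gaussBinom p n N‖ ≤ realFactInv ‖p‖ n := by
  have h0 := norm_nonneg p
  induction n generalizing N with
  | zero =>
    rw [gaussBinom_eq hp]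
    simp [qPochhammer_zero, qFactInv_zero, realFactInv]
  | succ n ihn =>
    induction N with
    | zero =>
      have : gaussBinom p (n + 1) 0 = 1 := by
        rw [gaussBinom_comm, gaussBinom_eq hp]
        simp [qPochhammer_zero, qFactInv_zero]
      rw [this, norm_one]
      exact one_le_realFactInv h0 hp _
    | succ N ihN =>
      rw [gaussBinom_succ_succ hp]
      calc _ ≤ ‖gaussBinom p n (N + 1)‖ + ‖p‖ ^ (n + 1) * ‖gaussBinom p (n + 1) N‖ := by
            refine (norm_add_le _ _).trans ?_
            rw [norm_mul, norm_pow]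
        _ ≤ realFactInv ‖p‖ n + ‖p‖ ^ (n + 1) * realFactInv ‖p‖ (n + 1) := by
            gcongr
            exact ihn _
        _ = realFactInv ‖p‖ (n + 1) := by
            rw [← one_sub_mul_realFactInv_succ h0 hp n]
            ring

/-- The product `(-r; r²)_∞`. -/
noncomputable def evenProduct (r : ℝ) : ℝ := ‖qPochhammerInf (-(r : ℂ)) ((r : ℂ) ^ 2)‖

/-- Each factor satisfies |1 + p^(i+1)| ≤ 1 + r^(2i+2) ≤ 1 + r^(2i+1). The shift by one power of r
is given away so that the factors fit into (-r; r²)_∞. -/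
lemma norm_qPochhammer_neg_le {p : ℂ} {r : ℝ} (h0 : 0 ≤ r) (h1 : r < 1) (hp : ‖p‖ = r ^ 2) (b : ℕ) :
    ‖qPochhammer (-p) p b‖ ≤ ‖qPochhammer (-(r : ℂ)) ((r : ℂ) ^ 2) b‖ := by
  rw [qPochhammer, qPochhammer, norm_prod, norm_prod]
  refine Finset.prod_le_prod (fun i _ => norm_nonneg _) fun i _ => ?_
  have e1 : ‖1 - -(r : ℂ) * ((r : ℂ) ^ 2) ^ i‖ = 1 + r * (r ^ 2) ^ i := by
    have : 1 - -(r : ℂ) * ((r : ℂ) ^ 2) ^ i = ((1 + r * (r ^ 2) ^ i : ℝ) : ℂ) := by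
      push_cast; ring
    rw [this, Complex.norm_real, Real.norm_of_nonneg (by positivity)]
  rw [e1]
  refine (norm_sub_le _ _).trans ?_
  rw [norm_one, norm_mul, norm_neg, norm_pow, hp]
  gcongr
  nlinarith

/-- Each term of Euler's series is at most the product. -/
lemma pow_mul_realFactInv_le {r : ℝ} (h0 : 0 ≤ r) (h1 : r < 1) (b m : ℕ) :
    r ^ (m ^ 2 + 2 * b * m) * realFactInv (r ^ 2) m * ‖qPochhammer (-(r : ℂ)) ((r : ℂ) ^ 2) b‖
      ≤ evenProduct r := by
  have hr : ‖(r : ℂ)‖ < 1 := by rwa [Complex.norm_real, Real.norm_of_nonneg h0]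
  have hr2 : ‖(r : ℂ) ^ 2‖ < 1 := norm_pow_succ_lt_one hr 1
  have hy : ‖-(r : ℂ) * ((r : ℂ) ^ 2) ^ b‖ < 1 := norm_mul_pow_lt_one (by rwa [norm_neg]) hr2 b
  -- Euler's series at -r^(2b+1) has nonnegative terms, so each is at most the sum (-r^(2b+1);
  -- r²)_∞; the factor (-r; r²)_b completes this to the full product.
  have hs := hasSum_qPochhammerInf hr2 hy
  have hρ : r ^ 2 < 1 := by nlinarith
  have hterm : ∀ i : ℕ, qFactInv ((r : ℂ) ^ 2) i * ((-1) ^ i * ((r : ℂ) ^ 2) ^ i.choose 2 *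
      (-(r : ℂ) * ((r : ℂ) ^ 2) ^ b) ^ i)
      = ((r ^ (i ^ 2 + 2 * b * i) * realFactInv (r ^ 2) i : ℝ) : ℂ) := by
    intro i
    have e2 : 2 * i.choose 2 + i = i ^ 2 := by
      clear hs
      induction i with
      | zero => simp
      | succ i ih =>
        rw [Nat.choose_succ_succ' i 1, Nat.choose_one_right]
        linarith
    have e3 : ((-1 : ℂ)) ^ i * (-1) ^ i = 1 := by rw [← mul_pow]; simp
    rw [← Complex.ofReal_pow, qFactInv_ofReal, ← e2]
    push_cast
    rw [neg_mul, neg_pow (_ * _) i, mul_pow, ← pow_mul, ← pow_mul, ← pow_mul, pow_add, pow_add]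
    linear_combination ((realFactInv (r ^ 2) i : ℂ) * (r : ℂ) ^ (2 * i.choose 2) * (r : ℂ) ^ i *
      (r : ℂ) ^ (2 * b * i)) * e3
  simp only [hterm] at hs
  have hsr : HasSum (fun i : ℕ => r ^ (i ^ 2 + 2 * b * i) * realFactInv (r ^ 2) i)
      (qPochhammerInf (-(r : ℂ) * ((r : ℂ) ^ 2) ^ b) ((r : ℂ) ^ 2)).re := by
    have := Complex.hasSum_re hs
    simpa only [Complex.ofReal_re] using this
  have hle : r ^ (m ^ 2 + 2 * b * m) * realFactInv (r ^ 2) m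
      ≤ ‖qPochhammerInf (-(r : ℂ) * ((r : ℂ) ^ 2) ^ b) ((r : ℂ) ^ 2)‖ := by
    refine le_trans ?_ (Complex.re_le_norm _)
    exact le_hasSum hsr m fun j _ => mul_nonneg (by positivity)
      (realFactInv_pos (by positivity) hρ j).le
  calc _ ≤ ‖qPochhammerInf (-(r : ℂ) * ((r : ℂ) ^ 2) ^ b) ((r : ℂ) ^ 2)‖ *
        ‖qPochhammer (-(r : ℂ)) ((r : ℂ) ^ 2) b‖ := by gcongr
    _ = evenProduct r := by
      rw [evenProduct, ← qPochhammer_mul_inf (z := -(r : ℂ)) (by rwa [norm_neg]) hr2 b, norm_mul, mul_comm]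

/-- Since 1/(|P|; |P|)_a ≤ (1 - |P|)^(-a), the terms are dominated by (1/2)^a. This controls the
remainder of `qExpPartial_expansion` after enough steps. -/
lemma norm_qExpPartial_le {P x : ℂ} (hP : ‖P‖ < 1) (hx : ‖x‖ ≤ (1 - ‖P‖) / 2) (b : ℕ) :
    ‖qExpPartial P x b‖ ≤ 2 := by
  have h0 : 0 < 1 - ‖P‖ := by linarith
  have hU : ∀ a, realFactInv ‖P‖ a ≤ ((1 - ‖P‖)⁻¹) ^ a := by
    intro a
    rw [realFactInv]
    refine (Finset.prod_le_prod (g := fun _ => (1 - ‖P‖)⁻¹) (fun i _ =>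
      (inv_pos.mpr (one_sub_pow_succ_pos (norm_nonneg P) hP i)).le) fun i _ => ?_).trans (by simp)
    refine inv_anti₀ h0 ?_
    have := pow_le_pow_of_le_one (norm_nonneg P) hP.le (show 1 ≤ i + 1 by omega)
    rw [pow_one] at this
    linarith
  have h1 : ∀ a ∈ range (b + 1), ‖x ^ a * qFactInv P a‖ ≤ (1 / 2 : ℝ) ^ a := by
    intro a _
    rw [norm_mul, norm_pow]
    calc _ ≤ ((1 - ‖P‖) / 2) ^ a * ((1 - ‖P‖)⁻¹) ^ a := by
          gcongr
          exact (norm_qFactInv_le hP a).trans (hU a)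
      _ = _ := by rw [← mul_pow]; congr 1; field_simp
  exact (norm_sum_le_of_le _ h1).trans (sum_geometric_two_le _)

/-- The outer term, with the inner sum expanded near `q = -1`. -/
lemma outerTerm_eq_expansion {q : ℂ} (hq : ‖q‖ < 1) (n N : ℕ) :
    outerTerm q n = (-1) ^ n * q ^ (n ^ 2 + 2 * n) *
      (qPochhammer q (q ^ 2) n * (qPochhammer (-q ^ 2) (q ^ 2) n)⁻¹) *
      (∑ k ∈ range N, (q ^ 2) ^ (2 * k + 1) * (qPochhammer (-q ^ 2) ((q ^ 2) ^ 2) (k + 1))⁻¹ *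
          gaussBinom (q ^ 2) n (2 * k + 1) +
        (qPochhammer (-q ^ 2) ((q ^ 2) ^ 2) N)⁻¹ * ∑ b ∈ range (n + 1),
          qPochhammer (-q ^ 2) (q ^ 2) b * (q ^ 2) ^ (b + 1).choose 2 * qFactInv (q ^ 2) (n - b) *
          qExpPartial ((q ^ 2) ^ 2) (-(q ^ 2) ^ (2 * N + 1)) b) := by
  rw [outerTerm]
  set p := q ^ 2
  have hp : ‖p‖ < 1 := norm_pow_succ_lt_one hq 1
  rw [mul_assoc _ (qPochhammer q p n)]
  congr 1
  have hb : ∀ b, qPochhammer (-p) p b * qFactInv (p ^ 2) b = qFactInv p b := by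
    intro b
    have h1 : qPochhammer (-p) p b ≠ 0 := qPochhammer_ne_zero (by rwa [norm_neg]) hp b
    rw [qFactInv, qPochhammer_sq_sq, mul_inv, mul_left_comm, mul_inv_cancel₀ h1, mul_one, qFactInv]
  -- The q-binomial theorem at y = p^(2k+2), after cancelling (-p; p)_b against (p²; p²)_b; the
  -- signs (-p)^b come from the expansion.
  have hk : ∀ k, gaussBinom p n (2 * k + 1) = ∑ b ∈ range (n + 1), qPochhammer (-p) p b *
      p ^ (b + 1).choose 2 * qFactInv p (n - b) * ((-p) ^ b * qFactInv (p ^ 2) b *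
        p ^ (2 * k * b)) := by
    intro k
    rw [gaussBinom_eq hp, ← sum_antidiagonal_qBinomial hp,
      Finset.Nat.sum_antidiagonal_eq_sum_range_succ (f := fun i j => qFactInv p i * qFactInv p j *
        ((-1) ^ i * p ^ i.choose 2 * (p ^ (2 * k + 1 + 1)) ^ i))]
    refine Finset.sum_congr rfl fun b _ => ?_
    rw [Nat.choose_succ_succ' b 1, Nat.choose_one_right, neg_pow p b, ← hb b]
    ring
  simp only [hk, qExpPartial_expansion hp _ N, Finset.mul_sum, mul_add, Finset.sum_add_distrib]
  congr 1
  · rw [Finset.sum_comm]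
    exact Finset.sum_congr rfl fun k _ => Finset.sum_congr rfl fun b _ => by ring
  · exact Finset.sum_congr rfl fun b _ => by ring

/-- Bound for `R₃⁽³⁾` from bounds on the products of the expansion near `q = -1`. -/
lemma norm_baileyR3_le_expansion {q : ℂ} (hq : ‖q‖ < 1) {A B : ℝ}
    (hA : ∀ n, ‖qPochhammer q (q ^ 2) n * (qPochhammer (-q ^ 2) (q ^ 2) n)⁻¹‖ ≤ A)
    (hB : ∀ k, ‖(qPochhammer (-q ^ 2) ((q ^ 2) ^ 2) (k + 1))⁻¹‖ *
      min (evenProduct ‖q‖) (realFactInv (‖q‖ ^ 2) (2 * k + 1)) ≤ B)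
    (hB' : ∃ K, ∀ k ≥ K, ‖(qPochhammer (-q ^ 2) ((q ^ 2) ^ 2) k)⁻¹‖ * evenProduct ‖q‖ ≤ B) :
    ‖baileyR3 3 q‖ ≤ A * B * (3 * (1 - ‖q‖)⁻¹ ^ 3) := by
  have hr0 := norm_nonneg q
  have h0 : 0 < 1 - ‖q‖ := by linarith
  have hp : ‖q ^ 2‖ < 1 := norm_pow_succ_lt_one hq 1
  have hρ : ‖q‖ ^ 2 < 1 := by rwa [← norm_pow]
  have hP : ‖(q ^ 2) ^ 2‖ < 1 := norm_pow_succ_lt_one hp 1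
  have hA0 : 0 ≤ A := (norm_nonneg _).trans (hA 0)
  obtain ⟨K, hK⟩ := hB'
  have hB0 : 0 ≤ B := le_trans (by rw [evenProduct]; positivity) (hK K le_rfl)
  -- N is large enough both for `hB'` and for the remainder's argument p^(2N+1) to meet
  -- `norm_qExpPartial_le`.
  obtain ⟨N, hN1, hN2⟩ : ∃ N, K ≤ N ∧ ‖q ^ 2‖ ^ (2 * N + 1) ≤ (1 - ‖(q ^ 2) ^ 2‖) / 2 := by
    have h1 : Tendsto (fun N : ℕ => ‖q ^ 2‖ ^ (2 * N + 1)) atTop (𝓝 0) :=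
      (tendsto_pow_atTop_nhds_zero_of_lt_one (norm_nonneg _) hp).comp
        (tendsto_atTop_mono (fun n => show n ≤ 2 * n + 1 by omega) tendsto_id)
    have h2 : (0 : ℝ) < (1 - ‖(q ^ 2) ^ 2‖) / 2 := by linarith
    exact ((eventually_ge_atTop K).and (h1.eventually (ge_mem_nhds h2))).exists
  have hbound : ∀ n, ‖outerTerm q n‖
      ≤ A * B * (3 * (1 - ‖q‖)⁻¹) * ((n + 1).choose 1 * ‖q‖ ^ n) := by
    intro n
    have hk : ∀ k ∈ range N, ‖q‖ ^ n ^ 2 * ‖(q ^ 2) ^ (2 * k + 1) *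
        (qPochhammer (-q ^ 2) ((q ^ 2) ^ 2) (k + 1))⁻¹ * gaussBinom (q ^ 2) n (2 * k + 1)‖
        ≤ B * ‖q‖ ^ k := by
      intro k _
      -- Two bounds from the symmetry of the Gaussian binomial: 1/(r²; r²)_n with r = |q|, which
      -- together with r^(n²) is a term of Euler's series, or 1/(r²; r²)_{2k+1}, with no dependence
      -- on n.
      have e1 : ‖q‖ ^ n ^ 2 * ‖gaussBinom (q ^ 2) n (2 * k + 1)‖
          ≤ min (evenProduct ‖q‖) (realFactInv (‖q‖ ^ 2) (2 * k + 1)) := by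
        refine le_min ?_ ?_
        · have e2 := pow_mul_realFactInv_le hr0 hq 0 n
          simp only [qPochhammer_zero, norm_one, mul_one, mul_zero, zero_mul, add_zero] at e2
          refine le_trans ?_ e2
          gcongr
          simpa using norm_gaussBinom_le hp n (2 * k + 1)
        · rw [gaussBinom_comm]
          have e3 := norm_gaussBinom_le hp (2 * k + 1) n
          rw [norm_pow] at e3
          have e4 : ‖q‖ ^ n ^ 2 ≤ 1 := pow_le_one₀ hr0 hq.le
          nlinarith [norm_nonneg (gaussBinom (q ^ 2) (2 * k + 1) n)]
      have e5 : ‖(q ^ 2) ^ (2 * k + 1)‖ ≤ ‖q‖ ^ k := by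
        rw [← pow_mul, norm_pow]
        exact pow_le_pow_of_le_one hr0 hq.le (by omega)
      rw [norm_mul, norm_mul]
      calc _ = ‖(q ^ 2) ^ (2 * k + 1)‖ * (‖(qPochhammer (-q ^ 2) ((q ^ 2) ^ 2) (k + 1))⁻¹‖ *
            (‖q‖ ^ n ^ 2 * ‖gaussBinom (q ^ 2) n (2 * k + 1)‖)) := by ring
        _ ≤ ‖q‖ ^ k * B := by
            gcongr
            exact le_trans (by gcongr) (hB k)
        _ = _ := mul_comm _ _
    have hb : ∀ b ∈ range (n + 1), ‖q‖ ^ n ^ 2 * (‖(qPochhammer (-q ^ 2) ((q ^ 2) ^ 2) N)⁻¹‖ *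
        ‖qPochhammer (-q ^ 2) (q ^ 2) b * (q ^ 2) ^ (b + 1).choose 2 * qFactInv (q ^ 2) (n - b) *
          qExpPartial ((q ^ 2) ^ 2) (-(q ^ 2) ^ (2 * N + 1)) b‖) ≤ 2 * B := by
      intro b hb
      obtain ⟨m, rfl⟩ : ∃ m, n = b + m := ⟨n - b, by have := Finset.mem_range.mp hb; omega⟩
      rw [show b + m - b = m by omega]
      have e1 := norm_qPochhammer_neg_le hr0 hq (norm_pow q 2) b
      have e2 := norm_qFactInv_le hp m
      rw [norm_pow] at e2
      have e3 := norm_qExpPartial_le (x := -(q ^ 2) ^ (2 * N + 1)) hP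
        (by rw [norm_neg, norm_pow]; exact hN2) b
      have e4 := pow_mul_realFactInv_le hr0 hq b m
      have e6 := (realFactInv_pos (by positivity : 0 ≤ ‖q‖ ^ 2) hρ m).le
      have e5 : ‖q‖ ^ (b + m) ^ 2 * ‖(q ^ 2) ^ (b + 1).choose 2‖ ≤ ‖q‖ ^ (m ^ 2 + 2 * b * m) := by
        rw [norm_pow, norm_pow, ← pow_mul, ← pow_add]
        refine pow_le_pow_of_le_one hr0 hq.le ?_
        nlinarith
      rw [norm_mul, norm_mul, norm_mul]
      calc _ = ‖(qPochhammer (-q ^ 2) ((q ^ 2) ^ 2) N)⁻¹‖ *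
            ((‖q‖ ^ (b + m) ^ 2 * ‖(q ^ 2) ^ (b + 1).choose 2‖) * ‖qFactInv (q ^ 2) m‖ *
              ‖qPochhammer (-q ^ 2) (q ^ 2) b‖) *
            ‖qExpPartial ((q ^ 2) ^ 2) (-(q ^ 2) ^ (2 * N + 1)) b‖ := by ring
        _ ≤ ‖(qPochhammer (-q ^ 2) ((q ^ 2) ^ 2) N)⁻¹‖ * (‖q‖ ^ (m ^ 2 + 2 * b * m) *
              realFactInv (‖q‖ ^ 2) m * ‖qPochhammer (-(‖q‖ : ℂ)) ((‖q‖ : ℂ) ^ 2) b‖) * 2 := by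
            gcongr
        _ ≤ ‖(qPochhammer (-q ^ 2) ((q ^ 2) ^ 2) N)⁻¹‖ * evenProduct ‖q‖ * 2 := by gcongr
        _ ≤ B * 2 := by gcongr; exact hK N hN1
        _ = _ := mul_comm _ _
    rw [outerTerm_eq_expansion hq n N, norm_mul, norm_mul, norm_mul, norm_pow (-1 : ℂ), norm_neg,
      norm_one, one_pow, one_mul, norm_pow q, pow_add]
    have hgeo : ∑ k ∈ range N, ‖q‖ ^ k ≤ (1 - ‖q‖)⁻¹ :=
      sum_le_hasSum _ (fun i _ => by positivity) (hasSum_geometric_of_lt_one hr0 hq)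
    have hq2n : ‖q‖ ^ (2 * n) ≤ ‖q‖ ^ n := pow_le_pow_of_le_one hr0 hq.le (by omega)
    have hinv : 1 ≤ (1 - ‖q‖)⁻¹ := (one_le_inv₀ h0).mpr (by linarith)
    calc _ ≤ ‖q‖ ^ n ^ 2 * ‖q‖ ^ n * A * (∑ k ∈ range N, ‖(q ^ 2) ^ (2 * k + 1) *
          (qPochhammer (-q ^ 2) ((q ^ 2) ^ 2) (k + 1))⁻¹ * gaussBinom (q ^ 2) n (2 * k + 1)‖ +
          ‖(qPochhammer (-q ^ 2) ((q ^ 2) ^ 2) N)⁻¹‖ * ∑ b ∈ range (n + 1),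
          ‖qPochhammer (-q ^ 2) (q ^ 2) b * (q ^ 2) ^ (b + 1).choose 2 * qFactInv (q ^ 2) (n - b) *
          qExpPartial ((q ^ 2) ^ 2) (-(q ^ 2) ^ (2 * N + 1)) b‖) := by
          gcongr
          · exact hA n
          · refine (norm_add_le _ _).trans ?_
            rw [norm_mul]
            gcongr
            · exact norm_sum_le _ _
            · exact norm_sum_le _ _
      _ = ‖q‖ ^ n * A * (∑ k ∈ range N, ‖q‖ ^ n ^ 2 * ‖(q ^ 2) ^ (2 * k + 1) *
          (qPochhammer (-q ^ 2) ((q ^ 2) ^ 2) (k + 1))⁻¹ * gaussBinom (q ^ 2) n (2 * k + 1)‖ +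
          ∑ b ∈ range (n + 1), ‖q‖ ^ n ^ 2 * (‖(qPochhammer (-q ^ 2) ((q ^ 2) ^ 2) N)⁻¹‖ *
          ‖qPochhammer (-q ^ 2) (q ^ 2) b * (q ^ 2) ^ (b + 1).choose 2 * qFactInv (q ^ 2) (n - b) *
          qExpPartial ((q ^ 2) ^ 2) (-(q ^ 2) ^ (2 * N + 1)) b‖)) := by
          simp only [← Finset.mul_sum]
          ring
      _ ≤ ‖q‖ ^ n * A * (∑ k ∈ range N, B * ‖q‖ ^ k + ∑ b ∈ range (n + 1), 2 * B) := by
          exact mul_le_mul_of_nonneg_left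
            (add_le_add (Finset.sum_le_sum hk) (Finset.sum_le_sum hb)) (by positivity)
      _ ≤ ‖q‖ ^ n * A * (B * (1 - ‖q‖)⁻¹ + (n + 1) * (2 * B)) := by
          rw [← Finset.mul_sum]
          simp only [Finset.sum_const, Finset.card_range, nsmul_eq_mul]
          push_cast
          gcongr
      _ ≤ ‖q‖ ^ n * A * (B * ((n + 1) * (3 * (1 - ‖q‖)⁻¹))) := by
          have hn : (0 : ℝ) ≤ n := n.cast_nonneg
          have : (1 - ‖q‖)⁻¹ + (n + 1) * 2 ≤ (n + 1) * (3 * (1 - ‖q‖)⁻¹) := by nlinarith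
          calc _ = ‖q‖ ^ n * A * (B * ((1 - ‖q‖)⁻¹ + (n + 1) * 2)) := by ring
            _ ≤ _ := by gcongr
      _ = _ := by rw [Nat.choose_one_right]; push_cast; ring
  have hs := (hasSum_choose_mul_geometric_of_norm_lt_one 1 (r := ‖q‖)
    (by simpa using hq)).mul_left (A * B * (3 * (1 - ‖q‖)⁻¹))
  refine ((hasSum_outerTerm hq).2.norm_le_of_bounded hs hbound).trans (le_of_eq ?_)
  field_simp

/-! ### Elementary bounds for 1/(e^z - 1) and 1/(2 sinh z) -/

lemma norm_inv_exp_sub_one_sub_inv_le {z : ℂ} (hz0 : z ≠ 0) (hz : ‖z‖ ≤ 1 / 2) :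
    ‖(Complex.exp z - 1)⁻¹ - z⁻¹‖ ≤ 2 := by
  have hpos : 0 < ‖z‖ := norm_pos_iff.mpr hz0
  have h1 := Complex.norm_exp_sub_one_sub_id_le (x := z) (by linarith)
  have h2 : ‖z‖ / 2 ≤ ‖Complex.exp z - 1‖ := by
    have h3 := norm_sub_norm_le z (z - (Complex.exp z - 1))
    rw [show z - (z - (Complex.exp z - 1)) = Complex.exp z - 1 by ring,
      show z - (Complex.exp z - 1) = -(Complex.exp z - 1 - z) by ring, norm_neg] at h3
    nlinarith
  have h4 : Complex.exp z - 1 ≠ 0 := by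
    intro h
    rw [h, norm_zero] at h2
    linarith
  have h5 : (Complex.exp z - 1)⁻¹ - z⁻¹ = -(Complex.exp z - 1 - z) / ((Complex.exp z - 1) * z) := by
    field_simp
    ring
  rw [h5, norm_div, norm_neg, norm_mul, div_le_iff₀ (by positivity)]
  nlinarith

/-- The left side is 1/(2 sinh z); writing it with 1/(e^z - 1) reduces its behaviour at the origin
to that of a single simple pole. -/
lemma exp_neg_div_eq {z : ℂ} (h : Complex.exp (2 * z) ≠ 1) :
    Complex.exp (-z) / (1 - Complex.exp (-(2 * z)))
      = (Complex.exp z - 1)⁻¹ - (Complex.exp (2 * z) - 1)⁻¹ := by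
  have e2 : Complex.exp (2 * z) = Complex.exp z ^ 2 := by rw [← Complex.exp_nat_mul]; norm_num
  rw [Complex.exp_neg, Complex.exp_neg, e2]
  rw [e2] at h
  have h0 := Complex.exp_ne_zero z
  set w := Complex.exp z
  have h1 : w ^ 2 - 1 ≠ 0 := sub_ne_zero.mpr h
  have h2 : w - 1 ≠ 0 := by
    intro h3
    apply h1
    linear_combination (w + 1) * h3
  have h3 : 1 - (w ^ 2)⁻¹ ≠ 0 := by
    intro h4
    apply h1
    field_simp at h4
    linear_combination h4
  rw [div_eq_iff h3]
  field_simp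
  ring

lemma exp_ne_one_of_re_pos {z : ℂ} (h : 0 < z.re) : Complex.exp z ≠ 1 := by
  intro h1
  have h2 : ‖Complex.exp z‖ = 1 := by rw [h1, norm_one]
  rw [Complex.norm_exp] at h2
  have := Real.one_lt_exp_iff.mpr h
  linarith

/-- The function `1 / (2 sinh z)` is close to `1 / (2z)` near the origin. -/
lemma norm_exp_neg_div_sub_le {z : ℂ} (h : 0 < z.re) (hz : ‖z‖ ≤ 1 / 4) :
    ‖Complex.exp (-z) / (1 - Complex.exp (-(2 * z))) - (2 * z)⁻¹‖ ≤ 4 := by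
  have hz0 : z ≠ 0 := by rintro rfl; simp at h
  have h2 : ‖2 * z‖ ≤ 1 / 2 := by rw [norm_mul]; norm_num; linarith
  have e1 := norm_inv_exp_sub_one_sub_inv_le hz0 (by linarith)
  have e2 := norm_inv_exp_sub_one_sub_inv_le (z := 2 * z) (by simpa using hz0) h2
  rw [exp_neg_div_eq (exp_ne_one_of_re_pos (by simpa using h))]
  have e3 : (Complex.exp z - 1)⁻¹ - (Complex.exp (2 * z) - 1)⁻¹ - (2 * z)⁻¹
      = ((Complex.exp z - 1)⁻¹ - z⁻¹) - ((Complex.exp (2 * z) - 1)⁻¹ - (2 * z)⁻¹) := by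
    field_simp
    ring
  rw [e3]
  refine (norm_sub_le _ _).trans ?_
  linarith

lemma exp_neg_div_one_sub_le {a : ℝ} (ha : 0 < a) :
    Real.exp (-a) / (1 - Real.exp (-(2 * a))) ≤ (2 * a)⁻¹ := by
  have h1 : a ≤ Real.sinh a := Real.self_le_sinh_iff.mpr ha.le
  rw [Real.sinh_eq] at h1
  have h2 : Real.exp (-(2 * a)) < 1 := Real.exp_lt_one_iff.mpr (by linarith)
  have h3 := Real.exp_pos (-a)
  have h4 : Real.exp (-(2 * a)) = Real.exp (-a) * Real.exp (-a) := by rw [← Real.exp_add]; ring_nf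
  have h5 : Real.exp (-a) * Real.exp a = 1 := by rw [← Real.exp_add]; simp
  rw [div_le_iff₀ (by linarith), inv_mul_eq_div, le_div_iff₀ (by linarith), h4]
  nlinarith

lemma norm_exp_neg_div_le {z : ℂ} (h : 0 < z.re) :
    ‖Complex.exp (-z) / (1 - Complex.exp (-(2 * z)))‖ ≤ (2 * z.re)⁻¹ := by
  refine le_trans ?_ (exp_neg_div_one_sub_le h)
  rw [norm_div, Complex.norm_exp, Complex.neg_re]
  have h1 := norm_sub_norm_le (1 : ℂ) (Complex.exp (-(2 * z)))
  have h2 : (-(2 * z)).re = -(2 * z.re) := by simp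
  rw [norm_one, Complex.norm_exp, h2] at h1
  have h3 : Real.exp (-(2 * z.re)) < 1 := Real.exp_lt_one_iff.mpr (by linarith)
  exact div_le_div_of_nonneg_left (Real.exp_pos _).le (by linarith) h1

lemma exp_neg_div_one_sub_exp_neg_le {a : ℝ} (ha : 0 < a) :
    Real.exp (-a) / (1 - Real.exp (-a)) ≤ a⁻¹ := by
  have h1 := Real.add_one_le_exp a
  have h2 : Real.exp (-a) < 1 := Real.exp_lt_one_iff.mpr (by linarith)
  have h5 : Real.exp (-a) * Real.exp a = 1 := by rw [← Real.exp_add]; simp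
  rw [div_le_iff₀ (by linarith), inv_mul_eq_div, le_div_iff₀ ha]
  nlinarith [Real.exp_pos (-a)]

lemma half_le_one_sub_exp_neg {a : ℝ} (h0 : 0 ≤ a) (h1 : a ≤ 1) : a / 2 ≤ 1 - Real.exp (-a) := by
  have h := Real.abs_exp_sub_one_sub_id_le (x := -a) (by rw [abs_neg, abs_of_nonneg h0]; exact h1)
  rcases abs_le.mp h with ⟨_, h2⟩
  by_cases h3 : a ≤ 1 / 2
  · nlinarith
  · have h4 : Real.exp (-a) ≤ Real.exp (-(1 / 2)) := Real.exp_le_exp.mpr (by linarith)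
    have h5 : Real.exp (-a) * Real.exp a = 1 := by rw [← Real.exp_add]; simp
    have h6 := Real.quadratic_le_exp_of_nonneg h0
    nlinarith [Real.exp_pos (-a), Real.exp_pos a, mul_nonneg h0 h0,
      mul_nonneg h0 (sub_nonneg.mpr h1)]

/-! ### Sums of inverse squares -/

lemma hasSum_of_eq {f g : ℕ → ℝ} {a b : ℝ} (h : HasSum f a) (hfg : ∀ m, g m = f m) (hab : b = a) :
    HasSum g b := by
  rw [hab, show g = f from funext hfg]
  exact h

lemma hasSum_inv_sq : HasSum (fun m : ℕ => 1 / ((m : ℝ) + 1) ^ 2) (Real.pi ^ 2 / 6) := by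
  have h := (hasSum_nat_add_iff' 1).mpr hasSum_zeta_two
  simpa using h

lemma hasSum_inv_sq_dvd {d : ℕ} (hd : 0 < d) :
    HasSum (fun m : ℕ => if d ∣ m + 1 then 1 / ((m : ℝ) + 1) ^ 2 else 0)
      (Real.pi ^ 2 / (6 * d ^ 2)) := by
  have hinj : Function.Injective fun k : ℕ => d * (k + 1) - 1 := by
    intro a b h
    have h1 : d * (a + 1) ≠ 0 := by positivity
    have h2 : d * (b + 1) ≠ 0 := by positivity
    have h3 : d * (a + 1) = d * (b + 1) := by
      simp only at h
      omega
    have := Nat.eq_of_mul_eq_mul_left hd h3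
    omega
  rw [← hinj.hasSum_iff]
  · have h := hasSum_inv_sq.div_const ((d : ℝ) ^ 2)
    refine hasSum_of_eq h (fun k => ?_) ?_
    · have h1 : d * (k + 1) - 1 + 1 = d * (k + 1) := Nat.sub_add_cancel (by
        have : d * (k + 1) ≠ 0 := by positivity
        omega)
      have h2 : ((d * (k + 1) - 1 : ℕ) : ℝ) + 1 = d * (k + 1) := by exact_mod_cast h1
      simp only [Function.comp_apply, h1, h2, dvd_mul_right, if_true]
      field_simp
    · field_simp
  · intro m hm
    rw [if_neg]
    rintro ⟨k, hk⟩
    apply hm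
    rcases k with _ | k
    · simp at hk
    · exact ⟨k, by simp only; omega⟩

lemma hasSum_inv_sq_odd :
    HasSum (fun m : ℕ => if 2 ∣ m + 1 then 0 else 1 / ((m : ℝ) + 1) ^ 2) (Real.pi ^ 2 / 8) := by
  have h := hasSum_inv_sq.sub (hasSum_inv_sq_dvd (d := 2) (by norm_num))
  refine hasSum_of_eq h (fun m => ?_) ?_
  · split_ifs <;> simp
  · push_cast
    ring

lemma hasSum_inv_sq_two_mod_four :
    HasSum (fun m : ℕ => if (m + 1) % 4 = 2 then 1 / ((m : ℝ) + 1) ^ 2 else 0)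
      (Real.pi ^ 2 / 32) := by
  have h := (hasSum_inv_sq_dvd (d := 2) (by norm_num)).sub
    (hasSum_inv_sq_dvd (d := 4) (by norm_num))
  refine hasSum_of_eq h (fun m => ?_) ?_
  · by_cases h1 : (m + 1) % 4 = 2
    · rw [if_pos h1, if_pos (by omega), if_neg (by omega), sub_zero]
    · by_cases h2 : 4 ∣ m + 1
      · rw [if_neg h1, if_pos (by omega), if_pos h2, sub_self]
      · rw [if_neg h1, if_neg (by omega), if_neg h2, sub_self]
  · push_cast
    ring

lemma hasSum_alternating_inv_sq :
    HasSum (fun m : ℕ => (-1) ^ m / ((m : ℝ) + 1) ^ 2) (Real.pi ^ 2 / 12) := by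
  have h := hasSum_inv_sq.sub ((hasSum_inv_sq_dvd (d := 2) (by norm_num)).mul_left 2)
  refine hasSum_of_eq h (fun m => ?_) ?_
  · by_cases h1 : 2 ∣ m + 1
    · rw [if_pos h1, Odd.neg_one_pow (by rw [Nat.odd_iff]; omega)]
      ring
    · rw [if_neg h1, Even.neg_one_pow (by rw [Nat.even_iff]; omega)]
      ring
  · push_cast
    ring

lemma hasSum_inv_sq_tail (L : ℕ) :
    HasSum (fun m : ℕ => if L ≤ m then 1 / ((m : ℝ) + 1) ^ 2 else 0)
      (Real.pi ^ 2 / 6 - ∑ m ∈ range L, 1 / ((m : ℝ) + 1) ^ 2) := by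
  have h1 : HasSum (fun m : ℕ => if m ∈ range L then 1 / ((m : ℝ) + 1) ^ 2 else 0)
      (∑ m ∈ range L, 1 / ((m : ℝ) + 1) ^ 2) := by
    rw [← Finset.sum_congr rfl fun m (hm : m ∈ range L) => if_pos hm]
    exact hasSum_sum_of_ne_finset_zero fun m hm => if_neg hm
  refine hasSum_of_eq (hasSum_inv_sq.sub h1) (fun m => ?_) rfl
  by_cases h2 : L ≤ m
  · rw [if_pos h2, if_neg (by simpa using h2), sub_zero]
  · rw [if_neg h2, if_pos (by simpa using h2), sub_self]

/-- Supplies the cut-off L used in the logarithm estimates: the first L terms are expanded with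
bounded errors, the later ones are bounded crudely by their inverse squares at a cost of at most
ε/t. -/
lemma exists_inv_sq_tail_le {ε : ℝ} (hε : 0 < ε) :
    ∃ L : ℕ, ∃ s ≤ ε, HasSum (fun m : ℕ => if L ≤ m then 1 / ((m : ℝ) + 1) ^ 2 else 0) s := by
  have h := hasSum_inv_sq.tendsto_sum_nat
  have h2 := (tendsto_const_nhds (x := Real.pi ^ 2 / 6)).sub h
  rw [sub_self] at h2
  obtain ⟨L, hL⟩ := (h2.eventually (ge_mem_nhds hε)).exists
  exact ⟨L, _, hL, hasSum_inv_sq_tail L⟩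

lemma hasSum_initial_segment (L : ℕ) (C : ℝ) :
    HasSum (fun m : ℕ => if m < L then C else 0) (L * C) := by
  have h1 : ∑ m ∈ range L, (if m < L then C else 0) = L * C := by
    rw [Finset.sum_congr rfl fun m hm => if_pos (Finset.mem_range.mp hm)]
    simp
  rw [← h1]
  exact hasSum_sum_of_ne_finset_zero fun m hm => if_neg (by simpa using hm)

/-! ### Bounds for the finite factors -/

/-- While 2ti ≤ 1, the factor 1 - e^(-2ti) is at least ti, so the product is at most t^(-M)/M!.
Writing 1/t = 10 · 1/(10t) gives e^(1/(10t)) from the exponential series and 10^M ≤ e^(3M). -/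
lemma realFactInv_le {t : ℝ} (ht : 0 < t) {M : ℕ} (hM : 2 * t * M ≤ 1) :
    realFactInv (Real.exp (-(2 * t))) M ≤ Real.exp (t⁻¹ / 10 + 3 * M) := by
  have h1 : realFactInv (Real.exp (-(2 * t))) M ≤ t⁻¹ ^ M / M.factorial := by
    induction M with
    | zero => simp [realFactInv]
    | succ M ih =>
      push_cast at hM
      have h2 := ih (by nlinarith)
      have h3 : t * (M + 1) ≤ 1 - Real.exp (-(2 * t)) ^ (M + 1) := by
        rw [← Real.exp_nat_mul]
        have := half_le_one_sub_exp_neg (a := 2 * t * (M + 1)) (by positivity) hM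
        rw [show ((M + 1 : ℕ) : ℝ) * -(2 * t) = -(2 * t * (M + 1)) by push_cast; ring]
        linarith
      rw [realFactInv, Finset.prod_range_succ, ← realFactInv, Nat.factorial_succ]
      calc _ ≤ t⁻¹ ^ M / M.factorial * (t * (M + 1))⁻¹ := by
            have h4 : (1 - Real.exp (-(2 * t)) ^ (M + 1))⁻¹ ≤ (t * (M + 1))⁻¹ :=
              inv_anti₀ (by positivity) h3
            have h5 : 0 ≤ (1 - Real.exp (-(2 * t)) ^ (M + 1))⁻¹ :=
              inv_nonneg.mpr (le_trans (by positivity) h3)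
            exact mul_le_mul h2 h4 h5 (by positivity)
        _ = _ := by push_cast; rw [pow_succ, mul_inv]; field_simp
  refine h1.trans ?_
  have h2 := Real.pow_div_factorial_le_exp (x := t⁻¹ / 10) (by positivity) M
  have h3 : (10 : ℝ) ≤ Real.exp 3 := by
    have := Real.exp_one_gt_d9
    rw [show (3 : ℝ) = 1 + 1 + 1 by norm_num, Real.exp_add, Real.exp_add]
    nlinarith [Real.exp_pos 1]
  calc t⁻¹ ^ M / M.factorial = (t⁻¹ / 10) ^ M / M.factorial * 10 ^ M := by
        rw [div_pow]; field_simp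
    _ ≤ Real.exp (t⁻¹ / 10) * Real.exp 3 ^ M := by gcongr
    _ = _ := by rw [← Real.exp_nat_mul, ← Real.exp_add, mul_comm (M : ℝ)]

/-! ### The quotient (q; q²)_∞/(q²; q²)_∞ away from q = -1 -/

/-- The point `-e^(-t + iφ)` of the unit disc. -/
noncomputable def negNome (t φ : ℝ) : ℂ := -Complex.exp (-(t : ℂ) + φ * Complex.I)

lemma norm_negNome (t φ : ℝ) : ‖negNome t φ‖ = Real.exp (-t) := by
  rw [negNome, norm_neg, Complex.norm_exp]
  simp

lemma norm_negNome_lt_one {t : ℝ} (ht : 0 < t) (φ : ℝ) : ‖negNome t φ‖ < 1 := by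
  rw [norm_negNome, Real.exp_lt_one_iff]
  linarith

lemma negNome_pow (t φ : ℝ) (M : ℕ) :
    negNome t φ ^ M = (-1) ^ M * Complex.exp (-(M * ((t : ℂ) - φ * Complex.I))) := by
  rw [negNome, neg_pow, ← Complex.exp_nat_mul]
  congr 2
  ring

lemma negNome_pow_re (t φ : ℝ) (M : ℕ) :
    (negNome t φ ^ M).re = (-1) ^ M * (Real.exp (-(M * t)) * Real.cos (M * φ)) := by
  have h1 : (-1 : ℂ) ^ M = (((-1 : ℝ) ^ M : ℝ) : ℂ) := by push_cast; rfl
  have h2 : -((M : ℂ) * ((t : ℂ) - φ * Complex.I)) = ((-(M * t) : ℝ) : ℂ) + ((M * φ : ℝ) : ℂ) *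
      Complex.I := by push_cast; ring
  rw [negNome_pow, h1, Complex.re_ofReal_mul, h2, Complex.exp_re]
  simp

/-- The real part of a term in the logarithm of `(q; q²)_∞ / (q²; q²)_∞`. -/
noncomputable def logQuotientTerm (q : ℂ) (m : ℕ) : ℝ :=
  (-(q ^ (m + 1) / ((m + 1) * (1 + q ^ (m + 1))))).re

/-- With x = q^m the two logarithms combine through -x/(1 - x²) + x²/(1 - x²) = -x/(1 + x), which
shows that only q^m near -1 is dangerous. -/
lemma norm_product_eq {q : ℂ} (hq : ‖q‖ < 1) :
    Summable (logQuotientTerm q) ∧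
      ‖qPochhammerInf q (q ^ 2) * (qPochhammerInf (q ^ 2) (q ^ 2))⁻¹‖
        = Real.exp (∑' m, logQuotientTerm q m) := by
  have hp : ‖q ^ 2‖ < 1 := norm_pow_succ_lt_one hq 1
  have h1 := (summable_logTerm hq hp).hasSum
  have h2 := (summable_logTerm hp hp).hasSum
  have h3 : HasSum (fun m : ℕ => -(q ^ (m + 1) / ((m + 1) * (1 + q ^ (m + 1)))))
      (-∑' m : ℕ, q ^ (m + 1) / ((m + 1) * (1 - (q ^ 2) ^ (m + 1))) +
        ∑' m : ℕ, (q ^ 2) ^ (m + 1) / ((m + 1) * (1 - (q ^ 2) ^ (m + 1)))) := by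
    refine (congrArg (fun f => HasSum f _) ?_).mp (h1.neg.add h2)
    funext m
    have e1 : 1 - q ^ (m + 1) ≠ 0 := one_sub_pow_succ_ne_zero hq m
    have e2 : 1 + q ^ (m + 1) ≠ 0 := by
      have := one_sub_ne_zero_of_norm_lt_one (z := -q ^ (m + 1))
        (by rw [norm_neg]; exact norm_pow_succ_lt_one hq m)
      rwa [sub_neg_eq_add] at this
    have e3 : ((m : ℂ) + 1) ≠ 0 := Nat.cast_add_one_ne_zero m
    have e4 : 1 - (q ^ 2) ^ (m + 1) = (1 - q ^ (m + 1)) * (1 + q ^ (m + 1)) := by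
      rw [← pow_mul, mul_comm 2, pow_mul]; ring
    rw [e4]
    field_simp
    rw [← pow_mul]
    ring
  have h4 := Complex.hasSum_re h3
  refine ⟨h4.summable, ?_⟩
  change HasSum (logQuotientTerm q) _ at h4
  rw [h4.tsum_eq, qPochhammerInf, qPochhammerInf, ← Complex.exp_neg, neg_neg, ← Complex.exp_add,
    Complex.norm_exp]

lemma norm_product_le {q : ℂ} (hq : ‖q‖ < 1) {c : ℕ → ℝ} {t S C : ℝ} {L : ℕ} (hc : HasSum c S)
    (h : ∀ m, logQuotientTerm q m ≤ c m * t⁻¹ + if m < L then C else 0) :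
    ‖qPochhammerInf q (q ^ 2) * (qPochhammerInf (q ^ 2) (q ^ 2))⁻¹‖
      ≤ Real.exp (S * t⁻¹ + L * C) := by
  obtain ⟨h1, h2⟩ := norm_product_eq hq
  rw [h2]
  refine Real.exp_le_exp.mpr ?_
  exact hasSum_le h h1.hasSum ((hc.mul_right t⁻¹).add (hasSum_initial_segment L C))

lemma logQuotientTerm_le_norm (q : ℂ) (m : ℕ) :
    logQuotientTerm q m ≤ ‖q‖ ^ (m + 1) / ((m + 1) * ‖1 + q ^ (m + 1)‖) := by
  refine (Complex.re_le_norm _).trans ?_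
  rw [norm_neg, norm_div, norm_mul, norm_pow, norm_natCast_add_one]

lemma logQuotientTerm_le_inv_sq {t : ℝ} (ht : 0 < t) (φ : ℝ) (m : ℕ) :
    logQuotientTerm (negNome t φ) m ≤ 1 / ((m : ℝ) + 1) ^ 2 * t⁻¹ := by
  refine (logQuotientTerm_le_norm _ m).trans ?_
  have hM : (0 : ℝ) < m + 1 := by positivity
  have h1 := exp_neg_div_one_sub_exp_neg_le (a := (m + 1) * t) (by positivity)
  have h2 : ‖negNome t φ‖ ^ (m + 1) = Real.exp (-((m + 1) * t)) := by
    rw [norm_negNome, ← Real.exp_nat_mul]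
    congr 1
    push_cast
    ring
  have h3 := norm_sub_norm_le (1 : ℂ) (-negNome t φ ^ (m + 1))
  rw [norm_neg, norm_one, norm_pow, h2, sub_neg_eq_add] at h3
  have h4 : Real.exp (-((m + 1) * t)) < 1 := by
    rw [Real.exp_lt_one_iff]
    nlinarith
  rw [h2]
  calc _ ≤ Real.exp (-((m + 1) * t)) / ((m + 1) * (1 - Real.exp (-((m + 1) * t)))) := by
        gcongr
    _ = 1 / (m + 1) * (Real.exp (-((m + 1) * t)) / (1 - Real.exp (-((m + 1) * t)))) := by
        rw [div_mul_div_comm, one_mul]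
    _ ≤ 1 / (m + 1) * ((m + 1) * t)⁻¹ := by gcongr
    _ = _ := by rw [mul_inv]; field_simp

/-- Re(1 + q^(m+1)) ≥ κ keeps the denominator away from zero, so the term contributes no multiple of
1/t. -/
lemma logQuotientTerm_le_of_cos {t φ κ : ℝ} (ht : 0 < t) (hκ : 0 < κ) (hκ1 : κ ≤ 1) {m : ℕ}
    (h : -(1 - κ) ≤ (-1) ^ (m + 1) * Real.cos ((m + 1 : ℕ) * φ)) :
    logQuotientTerm (negNome t φ) m ≤ κ⁻¹ := by
  refine (logQuotientTerm_le_norm _ m).trans ?_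
  have hM : (1 : ℝ) ≤ m + 1 := by linarith [(m.cast_nonneg : (0 : ℝ) ≤ m)]
  have h1 : ‖negNome t φ‖ ^ (m + 1) ≤ 1 :=
    pow_le_one₀ (norm_nonneg _) (norm_negNome_lt_one ht φ).le
  have h2 : κ ≤ ‖1 + negNome t φ ^ (m + 1)‖ := by
    refine le_trans ?_ (Complex.re_le_norm _)
    rw [Complex.add_re, Complex.one_re, negNome_pow_re, mul_left_comm]
    have h3 : Real.exp (-((m + 1 : ℕ) * t)) ≤ 1 := by
      rw [Real.exp_le_one_iff]
      have : (0 : ℝ) ≤ (m + 1 : ℕ) * t := by positivity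
      linarith
    have h4 := Real.exp_pos (-((m + 1 : ℕ) * t))
    nlinarith
  calc _ ≤ 1 / (1 * κ) := by gcongr
    _ = _ := by rw [one_mul, one_div]

/-- For an odd exponent M the term is Re 1/(M(e^(Mτ) - 1)) with τ = t - iφ, whose pole part is
Re(1/τ)/M². Since Re(1/τ) = t/(t² + φ²), the condition |φ| ≥ 3t/2 gives the factor 1/(1 + 9/4) =
4/13. -/
lemma logQuotientTerm_le_of_odd {t φ : ℝ} (ht : 0 < t) {m : ℕ} (hm : ¬ 2 ∣ m + 1)
    (h1 : (m + 1 : ℝ) * t ≤ 1 / 4) (h2 : (m + 1 : ℝ) * |φ| ≤ 1 / 4) (h3 : 3 / 2 * t ≤ |φ|) :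
    logQuotientTerm (negNome t φ) m ≤ 4 / 13 * (1 / ((m : ℝ) + 1) ^ 2) * t⁻¹ + 2 := by
  set τ : ℂ := (t : ℂ) - φ * Complex.I with hτ
  have hM : (1 : ℝ) ≤ m + 1 := by linarith [(m.cast_nonneg : (0 : ℝ) ≤ m)]
  have hτre : τ.re = t := by simp [hτ]
  have hτim : τ.im = -φ := by simp [hτ]
  have hMτ : (((m + 1 : ℕ) : ℂ) * τ).re = (m + 1) * t := by
    rw [← Complex.ofReal_natCast, Complex.re_ofReal_mul, hτre]; push_cast; ring
  have hz0 : ((m + 1 : ℕ) : ℂ) * τ ≠ 0 := by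
    intro h
    rw [h, Complex.zero_re] at hMτ
    nlinarith
  have hτn : ‖τ‖ ≤ t + |φ| := by
    refine (Complex.norm_le_abs_re_add_abs_im τ).trans ?_
    rw [hτre, hτim, abs_neg, abs_of_pos ht]
  have hz : ‖((m + 1 : ℕ) : ℂ) * τ‖ ≤ 1 / 2 := by
    rw [norm_mul, Complex.norm_natCast]
    push_cast
    nlinarith
  have h4 := norm_inv_exp_sub_one_sub_inv_le hz0 hz
  have hodd : (-1 : ℂ) ^ (m + 1) = -1 := Odd.neg_one_pow (by rw [Nat.odd_iff]; omega)
  have h5 : -(negNome t φ ^ (m + 1) / ((m + 1) * (1 + negNome t φ ^ (m + 1))))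
      = (((m + 1 : ℝ)⁻¹ : ℝ) : ℂ) * (Complex.exp (((m + 1 : ℕ) : ℂ) * τ) - 1)⁻¹ := by
    rw [negNome_pow, hodd, ← hτ, Complex.exp_neg]
    have e1 := Complex.exp_ne_zero (((m + 1 : ℕ) : ℂ) * τ)
    have e2 : Complex.exp (((m + 1 : ℕ) : ℂ) * τ) - 1 ≠ 0 :=
      sub_ne_zero.mpr (exp_ne_one_of_re_pos (by rw [hMτ]; positivity))
    have e3 : ((m : ℂ) + 1) ≠ 0 := Nat.cast_add_one_ne_zero m
    set w := Complex.exp (((m + 1 : ℕ) : ℂ) * τ)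
    have e4 : 1 + -1 * w⁻¹ = (w - 1) / w := by
      field_simp
      ring
    rw [e4]
    push_cast
    field_simp
  have h6 : ((((m + 1 : ℕ) : ℂ) * τ)⁻¹).re ≤ 4 / 13 * (1 / (m + 1)) * t⁻¹ := by
    rw [mul_inv, ← Complex.ofReal_natCast, ← Complex.ofReal_inv, Complex.re_ofReal_mul,
      Complex.inv_re, hτre, Complex.normSq_apply, hτre, hτim]
    have e1 : 13 / 4 * (t * t) ≤ t * t + -φ * -φ := by
      have := mul_self_le_mul_self (by positivity) h3
      rw [abs_mul_abs_self] at this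
      nlinarith
    have e2 : t / (t * t + -φ * -φ) ≤ 4 / 13 * t⁻¹ := by
      rw [div_le_iff₀ (by nlinarith [mul_pos ht ht])]
      have : 4 / 13 * t⁻¹ * (13 / 4 * (t * t)) = t := by field_simp
      calc t = 4 / 13 * t⁻¹ * (13 / 4 * (t * t)) := this.symm
        _ ≤ _ := by gcongr
    push_cast
    calc ((m : ℝ) + 1)⁻¹ * (t / (t * t + -φ * -φ)) ≤ ((m : ℝ) + 1)⁻¹ * (4 / 13 * t⁻¹) := by gcongr
      _ = _ := by ring
  rw [logQuotientTerm, h5, Complex.re_ofReal_mul]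
  have h7 : (Complex.exp (((m + 1 : ℕ) : ℂ) * τ) - 1)⁻¹.re
      ≤ 4 / 13 * (1 / (m + 1)) * t⁻¹ + 2 := by
    have := (Complex.re_le_norm _).trans h4
    rw [Complex.sub_re] at this
    linarith
  have hinv : ((m : ℝ) + 1)⁻¹ ≤ 1 := inv_le_one_of_one_le₀ hM
  calc _ ≤ ((m : ℝ) + 1)⁻¹ * (4 / 13 * (1 / (m + 1)) * t⁻¹ + 2) := by gcongr
    _ = 4 / 13 * (1 / ((m : ℝ) + 1) ^ 2) * t⁻¹ + ((m : ℝ) + 1)⁻¹ * 2 := by field_simp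
    _ ≤ _ := by linarith

lemma norm_product_le_near {L : ℕ} {s t φ : ℝ}
    (hs : HasSum (fun m : ℕ => if L ≤ m then 1 / ((m : ℝ) + 1) ^ 2 else 0) s) (ht : 0 < t)
    (h1 : (L : ℝ) * t ≤ 1 / 4) (h2 : (L : ℝ) * |φ| ≤ 1 / 4) (h3 : 3 / 2 * t ≤ |φ|) :
    ‖qPochhammerInf (negNome t φ) (negNome t φ ^ 2) *
      (qPochhammerInf (negNome t φ ^ 2) (negNome t φ ^ 2))⁻¹‖
      ≤ Real.exp ((4 / 13 * (Real.pi ^ 2 / 8) + s) * t⁻¹ + L * 2) := by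
  refine norm_product_le (norm_negNome_lt_one ht φ) ((hasSum_inv_sq_odd.mul_left (4 / 13)).add hs)
    fun m => ?_
  have hinv : 0 < t⁻¹ := inv_pos.mpr ht
  by_cases hm : m < L
  · rw [if_neg (show ¬ L ≤ m by omega), if_pos hm, add_zero]
    have hmL : (m + 1 : ℝ) ≤ L := by exact_mod_cast hm
    have e2 : (m + 1 : ℝ) * |φ| ≤ 1 / 4 := le_trans (by gcongr) h2
    by_cases hodd : 2 ∣ m + 1
    · rw [if_pos hodd, mul_zero, zero_mul, zero_add]
      refine (logQuotientTerm_le_of_cos ht one_pos le_rfl ?_).trans (by norm_num)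
      rw [Even.neg_one_pow (even_iff_two_dvd.mpr hodd), one_mul, sub_self, neg_zero]
      refine Real.cos_nonneg_of_mem_Icc ?_
      have e3 : |((m + 1 : ℕ) : ℝ) * φ| ≤ 1 / 4 := by
        rw [abs_mul, Nat.abs_cast]; push_cast; exact e2
      have := Real.pi_gt_three
      rw [abs_le] at e3
      constructor <;> linarith
    · rw [if_neg hodd]
      exact logQuotientTerm_le_of_odd ht hodd (le_trans (by gcongr) h1) e2 h3
  · rw [if_pos (show L ≤ m by omega), if_neg hm, add_zero]
    refine (logQuotientTerm_le_inv_sq ht φ m).trans ?_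
    have : (0 : ℝ) ≤ 4 / 13 * (if 2 ∣ m + 1 then 0 else 1 / ((m : ℝ) + 1) ^ 2) := by
      split_ifs <;> positivity
    gcongr
    linarith

/-- Here q is close in argument to ±i, so among the first L exponents only those ≡ 2 mod 4 bring q^m
near -1. For the others Re(1 + q^m) ≥ 1/2. -/
lemma norm_product_le_quarter {L : ℕ} {s t φ : ℝ}
    (hs : HasSum (fun m : ℕ => if L ≤ m then 1 / ((m : ℝ) + 1) ^ 2 else 0) s) (ht : 0 < t)
    (h1 : (L : ℝ) * |(|φ| - Real.pi / 2)| ≤ 1 / 4) :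
    ‖qPochhammerInf (negNome t φ) (negNome t φ ^ 2) *
      (qPochhammerInf (negNome t φ ^ 2) (negNome t φ ^ 2))⁻¹‖
      ≤ Real.exp ((Real.pi ^ 2 / 32 + s) * t⁻¹ + L * 2) := by
  refine norm_product_le (norm_negNome_lt_one ht φ) (hasSum_inv_sq_two_mod_four.add hs) fun m => ?_
  have hinv : 0 < t⁻¹ := inv_pos.mpr ht
  by_cases hm : m < L
  · rw [if_neg (show ¬ L ≤ m by omega), if_pos hm, add_zero]
    have hmL : (m + 1 : ℝ) ≤ L := by exact_mod_cast hm
    by_cases h4 : (m + 1) % 4 = 2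
    · rw [if_pos h4]
      exact (logQuotientTerm_le_inv_sq ht φ m).trans (by linarith)
    · rw [if_neg h4, zero_mul, zero_add]
      refine (logQuotientTerm_le_of_cos (κ := 1 / 2) ht (by norm_num) (by norm_num) ?_).trans
        (by norm_num)
      set ψ := |φ| - Real.pi / 2 with hψ
      have e1 : |((m + 1 : ℕ) : ℝ) * ψ| ≤ 1 / 4 := by
        rw [abs_mul, Nat.abs_cast]; push_cast
        exact le_trans (by gcongr) h1
      have e2 : Real.cos ((m + 1 : ℕ) * φ)
          = Real.cos ((m + 1 : ℕ) * (Real.pi / 2) + (m + 1 : ℕ) * ψ) := by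
        rw [← Real.cos_abs, abs_mul, Nat.abs_cast, hψ]
        congr 1
        ring
      rw [e2]
      by_cases hodd : 2 ∣ m + 1
      · obtain ⟨k, hk⟩ : 4 ∣ m + 1 := by omega
        rw [Even.neg_one_pow (even_iff_two_dvd.mpr hodd), one_mul,
          show ((m + 1 : ℕ) : ℝ) * (Real.pi / 2) + (m + 1 : ℕ) * ψ
            = (m + 1 : ℕ) * ψ + k * (2 * Real.pi) by rw [hk]; push_cast; ring,
          Real.cos_add_nat_mul_two_pi]
        have := Real.one_sub_sq_div_two_le_cos (x := ((m + 1 : ℕ) : ℝ) * ψ)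
        rw [abs_le] at e1
        nlinarith
      · have e3 : Real.cos ((m + 1 : ℕ) * (Real.pi / 2)) = 0 := by
          rw [Real.cos_eq_zero_iff]
          obtain ⟨k, hk⟩ : ∃ k, m + 1 = 2 * k + 1 := ⟨m / 2, by omega⟩
          exact ⟨k, by rw [hk]; push_cast; ring⟩
        have e4 : |Real.sin ((m + 1 : ℕ) * ψ)| ≤ 1 / 4 := Real.abs_sin_le_abs.trans e1
        have e5 : |Real.sin ((m + 1 : ℕ) * (Real.pi / 2))| ≤ 1 := Real.abs_sin_le_one _
        have e6 : |(-1 : ℝ) ^ (m + 1) * Real.cos ((m + 1 : ℕ) * (Real.pi / 2) + (m + 1 : ℕ) * ψ)|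
            ≤ 1 / 4 := by
          rw [Real.cos_add, e3, zero_mul, zero_sub, abs_mul, abs_pow, abs_neg, abs_one, one_pow,
            one_mul, abs_neg, abs_mul]
          calc _ ≤ 1 * (1 / 4 : ℝ) := by gcongr
            _ = _ := by norm_num
        have := (abs_le.mp e6).1
        linarith
  · rw [if_pos (show L ≤ m by omega), if_neg hm, add_zero]
    refine (logQuotientTerm_le_inv_sq ht φ m).trans ?_
    gcongr
    split_ifs
    · have : (0 : ℝ) < 1 / ((m : ℝ) + 1) ^ 2 := by positivity
      linarith
    · linarith

/-- Once q and q² both stay away from -1 in argument, the exponents 1 and 2 cost O(1), and the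
trivial bound for the rest leaves π²/6 - 1 - 1/4. -/
lemma norm_product_le_far {η t φ : ℝ} (hη : 0 < η) (hη1 : η ≤ 1) (ht : 0 < t)
    (h0 : |φ| ≤ Real.pi) (h1 : η ≤ |φ|) (h2 : η ≤ |(|φ| - Real.pi / 2)|) :
    ‖qPochhammerInf (negNome t φ) (negNome t φ ^ 2) *
      (qPochhammerInf (negNome t φ ^ 2) (negNome t φ ^ 2))⁻¹‖
      ≤ Real.exp ((Real.pi ^ 2 / 6 - 5 / 4) * t⁻¹ + 2 * (1 - Real.cos η)⁻¹) := by
  have hpi := Real.pi_gt_three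
  have hcos0 : 0 < Real.cos η :=
    Real.cos_pos_of_mem_Ioo ⟨by linarith, by linarith⟩
  have hcos1 : Real.cos η < 1 := by
    rw [← Real.cos_zero]
    exact Real.cos_lt_cos_of_nonneg_of_le_pi le_rfl (by linarith) hη
  have hs := hasSum_inv_sq_tail 2
  rw [show ∑ m ∈ range 2, 1 / ((m : ℝ) + 1) ^ 2 = 5 / 4 by
    rw [Finset.sum_range_succ, Finset.sum_range_one]; norm_num] at hs
  have := norm_product_le (norm_negNome_lt_one ht φ) (t := t) (C := (1 - Real.cos η)⁻¹) (L := 2) hs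
    fun m => ?_
  · exact_mod_cast this
  by_cases hm : m < 2
  · rw [if_neg (show ¬ 2 ≤ m by omega), if_pos hm, zero_mul, zero_add]
    refine logQuotientTerm_le_of_cos ht (by linarith) (by linarith) ?_
    rw [sub_sub_cancel]
    interval_cases m
    · norm_num
      rw [← Real.cos_abs φ]
      exact Real.cos_le_cos_of_nonneg_of_le_pi hη.le h0 h1
    · norm_num
      have e1 : Real.cos (2 * φ) = -Real.cos (|2 * (|φ| - Real.pi / 2)|) := by
        rw [Real.cos_abs, show 2 * (|φ| - Real.pi / 2) = 2 * |φ| - Real.pi by ring,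
          Real.cos_sub_pi, neg_neg, ← Real.cos_abs (2 * φ), abs_mul, abs_two]
      have e2 : |2 * (|φ| - Real.pi / 2)| ≤ Real.pi := by
        rw [abs_le]; constructor <;> linarith [abs_nonneg φ]
      have e3 : η ≤ |2 * (|φ| - Real.pi / 2)| := by rw [abs_mul, abs_two]; linarith
      rw [e1]
      have := Real.cos_le_cos_of_nonneg_of_le_pi hη.le e2 e3
      linarith
  · rw [if_pos (show 2 ≤ m by omega), if_neg hm, add_zero]
    exact logQuotientTerm_le_inv_sq ht φ m

/-- Away from `q = -1` the product is exponentially smaller than `e^(π² / 24t)`. -/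
lemma exists_norm_product_le :
    ∃ A < Real.pi ^ 2 / 24, ∃ C t₀ : ℝ, 0 < t₀ ∧ ∀ t φ : ℝ, 0 < t → t ≤ t₀ → |φ| ≤ Real.pi →
      3 / 2 * t ≤ |φ| → ‖qPochhammerInf (negNome t φ) (negNome t φ ^ 2) *
        (qPochhammerInf (negNome t φ ^ 2) (negNome t φ ^ 2))⁻¹‖ ≤ Real.exp (A * t⁻¹ + C) := by
  obtain ⟨L, s, hs, hsum⟩ := exists_inv_sq_tail_le (show (0 : ℝ) < 1 / 100 by norm_num)
  have hpi := Real.pi_gt_d2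
  have hpi2 := Real.pi_lt_d2
  -- Lη ≤ 1/4 keeps the first L multiples of t and of the angular offset within 1/4, as the near and
  -- quarter estimates require.
  set η : ℝ := 1 / (4 * (L + 1)) with hη
  have hη0 : 0 < η := by positivity
  have hL : (L : ℝ) * η ≤ 1 / 4 := by
    rw [hη, mul_one_div, div_le_div_iff₀ (by positivity) (by norm_num)]
    linarith
  have hη1 : η ≤ 1 := by
    rw [hη, div_le_one (by positivity)]
    linarith [(L.cast_nonneg : (0 : ℝ) ≤ L)]
  -- The leading constants π²/32, π²/26 and π²/6 - 5/4 are about 0.308, 0.380 and 0.395, against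
  -- π²/24 ≈ 0.411; the first two leave room for the tail 1/100.
  have hA2 : Real.pi ^ 2 / 32 + s ≤ Real.pi ^ 2 / 24 - 1 / 1000 := by nlinarith
  have hA1 : 4 / 13 * (Real.pi ^ 2 / 8) + s ≤ Real.pi ^ 2 / 24 - 1 / 1000 := by nlinarith
  have hA3 : Real.pi ^ 2 / 6 - 5 / 4 ≤ Real.pi ^ 2 / 24 - 1 / 1000 := by nlinarith
  have hcos1 : Real.cos η < 1 := by
    rw [← Real.cos_zero]
    exact Real.cos_lt_cos_of_nonneg_of_le_pi le_rfl (by linarith) hη0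
  have hκ : 0 < (1 - Real.cos η)⁻¹ := inv_pos.mpr (by linarith)
  refine ⟨Real.pi ^ 2 / 24 - 1 / 1000, by linarith, L * 2 + 2 * (1 - Real.cos η)⁻¹, η, hη0,
    fun t φ ht htη h0 h3 => ?_⟩
  have hinv : 0 < t⁻¹ := inv_pos.mpr ht
  have hL0 : (0 : ℝ) ≤ L := L.cast_nonneg
  by_cases h1 : |φ| ≤ η
  · refine (norm_product_le_near hsum ht (le_trans (by gcongr) hL) (le_trans (by gcongr) hL)
      h3).trans (Real.exp_le_exp.mpr ?_)
    have := mul_le_mul_of_nonneg_right hA1 hinv.le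
    linarith
  · by_cases h2 : |(|φ| - Real.pi / 2)| ≤ η
    · refine (norm_product_le_quarter hsum ht (le_trans (by gcongr) hL)).trans
        (Real.exp_le_exp.mpr ?_)
      have := mul_le_mul_of_nonneg_right hA2 hinv.le
      linarith
    · refine (norm_product_le_far hη0 hη1 ht h0 (not_le.mp h1).le (not_le.mp h2).le).trans
        (Real.exp_le_exp.mpr ?_)
      have := mul_le_mul_of_nonneg_right hA3 hinv.le
      linarith

/-! ### Estimates near `q = -1` -/

lemma exp_neg_one_bounds : 0.36 ≤ Real.exp (-1) ∧ Real.exp (-1) ≤ 0.37 := by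
  have h1 := Real.exp_one_gt_d9
  have h2 := Real.exp_one_lt_d9
  have h3 : Real.exp (-1) * Real.exp 1 = 1 := by rw [← Real.exp_add]; simp
  constructor <;> nlinarith [Real.exp_pos (-1)]

/-- Since |Im z| ≤ 3/2 < π/2, Jordan's inequality gives cos(Im z) ≥ 0.04. Hence Re(1 + e^(-z)) ≥ 1 +
0.36 · 0.04 = 1.0144, which exceeds e^(1/100). -/
lemma le_norm_one_add_exp_neg {z : ℂ} (h1 : z.re ≤ 1)
    (h : |z.im| ≤ 3 / 2 * z.re) : Real.exp (1 / 100) ≤ ‖1 + Complex.exp (-z)‖ := by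
  have h2 : |z.im| ≤ 3 / 2 := by linarith
  have hpi := Real.pi_gt_d2
  have h3 : 0.04 ≤ Real.cos z.im := by
    have h4 := Real.one_sub_mul_le_cos (x := |z.im|) (abs_nonneg _) (by linarith)
    rw [Real.cos_abs] at h4
    have h5 : 2 / Real.pi * |z.im| ≤ 0.96 := by
      rw [div_mul_eq_mul_div, div_le_iff₀ Real.pi_pos]
      nlinarith
    linarith
  have h6 : 0.36 ≤ Real.exp (-z.re) :=
    exp_neg_one_bounds.1.trans (Real.exp_le_exp.mpr (by linarith))
  have h7 : Real.exp (1 / 100) ≤ 1.0144 := by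
    have h8 := Real.add_one_le_exp (-(1 / 100) : ℝ)
    have h9 : Real.exp (-(1 / 100)) * Real.exp (1 / 100) = 1 := by rw [← Real.exp_add]; simp
    nlinarith [Real.exp_pos (1 / 100)]
  refine le_trans ?_ (Complex.re_le_norm _)
  rw [Complex.add_re, Complex.one_re, Complex.exp_re, Complex.neg_re, Complex.neg_im, Real.cos_neg]
  nlinarith

lemma half_le_norm_one_add_exp_neg {z : ℂ} (h : |z.im| ≤ 3 / 2 * z.re) :
    1 / 2 ≤ ‖1 + Complex.exp (-z)‖ := by
  rcases le_total z.re 1 with h1 | h1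
  · have h2 := le_norm_one_add_exp_neg h1 h
    have h3 := Real.one_le_exp (show (0 : ℝ) ≤ 1 / 100 by norm_num)
    linarith
  · have h2 := norm_sub_norm_le (1 : ℂ) (-Complex.exp (-z))
    rw [norm_neg, norm_one, Complex.norm_exp, Complex.neg_re, sub_neg_eq_add] at h2
    have h3 : Real.exp (-z.re) ≤ Real.exp (-1) := Real.exp_le_exp.mpr (by linarith)
    have := exp_neg_one_bounds.2
    linarith

lemma negNome_sq_pow (t φ : ℝ) (n : ℕ) :
    (negNome t φ ^ 2) ^ n = Complex.exp (-(2 * (n * ((t : ℂ) - φ * Complex.I)))) := by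
  rw [← pow_mul, negNome_pow, Even.neg_one_pow (even_two_mul n), one_mul]
  push_cast
  ring_nf

lemma natCast_mul_re (n : ℕ) (t φ : ℝ) :
    (2 * ((n : ℂ) * ((t : ℂ) - φ * Complex.I))).re = 2 * (n * t) := by
  simp

lemma natCast_mul_im (n : ℕ) (t φ : ℝ) :
    (2 * ((n : ℂ) * ((t : ℂ) - φ * Complex.I))).im = -(2 * (n * φ)) := by
  simp

lemma abs_natCast_mul_im_le {t φ : ℝ} (hφ : |φ| ≤ 3 / 2 * t) (n : ℕ) :
    |(2 * ((n : ℂ) * ((t : ℂ) - φ * Complex.I))).im|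
      ≤ 3 / 2 * (2 * ((n : ℂ) * ((t : ℂ) - φ * Complex.I))).re := by
  rw [natCast_mul_re, natCast_mul_im, abs_neg, abs_mul, abs_mul, abs_two, Nat.abs_cast]
  have : (n : ℝ) * |φ| ≤ n * (3 / 2 * t) := by gcongr
  linarith

/-- The ratio `(q; q²)_n / (-q²; q²)_n` is bounded in a sector at `q = -1`. -/
lemma norm_qPochhammer_ratio_le {t φ : ℝ} (ht : 0 < t) (ht1 : t ≤ 1 / 4) (hφ : |φ| ≤ 3 / 2 * t)
    (n : ℕ) : ‖qPochhammer (negNome t φ) (negNome t φ ^ 2) n *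
      (qPochhammer (-negNome t φ ^ 2) (negNome t φ ^ 2) n)⁻¹‖ ≤ Real.exp 10 := by
  set q := negNome t φ with hq
  have hqn : ‖q‖ = Real.exp (-t) := norm_negNome t φ
  have hq1 : ‖q‖ < 1 := norm_negNome_lt_one ht φ
  have hqq : ‖q ^ 2‖ < 1 := norm_pow_succ_lt_one hq1 1
  have h1 : ‖1 + q‖ ≤ 5 * t := by
    set τ : ℂ := -(t : ℂ) + φ * Complex.I with hτ
    have hτn : ‖τ‖ ≤ 5 / 2 * t := by
      refine (Complex.norm_le_abs_re_add_abs_im τ).trans ?_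
      have e1 : τ.re = -t := by simp [hτ]
      have e2 : τ.im = φ := by simp [hτ]
      rw [e1, e2, abs_neg, abs_of_pos ht]
      linarith
    have h2 := Complex.norm_exp_sub_one_le (x := τ) (by linarith)
    rw [hq, negNome, ← sub_eq_add_neg, ← norm_neg, neg_sub]
    linarith
  have hfac (i : ℕ) : ‖(1 - q * (q ^ 2) ^ i) * (1 - -q ^ 2 * (q ^ 2) ^ i)⁻¹‖
      ≤ Real.exp (10 * t * (‖q ^ 2‖ ^ i)) := by
    have e1 : 1 - -q ^ 2 * (q ^ 2) ^ i = 1 + (q ^ 2) ^ (i + 1) := by ring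
    have e2 : 1 / 2 ≤ ‖1 + (q ^ 2) ^ (i + 1)‖ := by
      rw [hq, negNome_sq_pow]
      exact half_le_norm_one_add_exp_neg (abs_natCast_mul_im_le hφ _)
    have e3 : 1 + (q ^ 2) ^ (i + 1) ≠ 0 := norm_pos_iff.mp (by linarith)
    -- Numerator and denominator differ by q(1 + q)q^(2i), and |1 + q| ≤ 5t. The geometric sum of
    -- these deviations costs a factor 1/t, so the whole ratio stays bounded.
    have e4 : (1 - q * (q ^ 2) ^ i) * (1 + (q ^ 2) ^ (i + 1))⁻¹
        = 1 - q * (1 + q) * (q ^ 2) ^ i * (1 + (q ^ 2) ^ (i + 1))⁻¹ := by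
      field_simp
      ring
    rw [e1, e4]
    refine (norm_sub_le _ _).trans ?_
    rw [norm_one]
    have e5 : ‖(1 + (q ^ 2) ^ (i + 1))⁻¹‖ ≤ 2 := by
      rw [norm_inv, inv_le_comm₀ (by linarith) (by norm_num)]
      linarith
    have e6 : ‖q * (1 + q) * (q ^ 2) ^ i * (1 + (q ^ 2) ^ (i + 1))⁻¹‖
        ≤ 10 * t * (‖q ^ 2‖ ^ i) := by
      rw [norm_mul, norm_mul, norm_mul, norm_pow (q ^ 2)]
      calc _ ≤ 1 * (5 * t) * ‖q ^ 2‖ ^ i * 2 := by gcongr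
        _ = _ := by ring
    have := Real.add_one_le_exp (10 * t * (‖q ^ 2‖ ^ i))
    linarith
  rw [qPochhammer, qPochhammer, ← Finset.prod_inv_distrib, ← Finset.prod_mul_distrib, norm_prod]
  refine (Finset.prod_le_prod (fun i _ => norm_nonneg _) fun i _ => hfac i).trans ?_
  rw [← Real.exp_sum, ← Finset.mul_sum]
  refine Real.exp_le_exp.mpr ?_
  have h2 : ∑ i ∈ range n, ‖q ^ 2‖ ^ i ≤ (1 - ‖q ^ 2‖)⁻¹ := by
    rw [← tsum_geometric_of_lt_one (norm_nonneg _) hqq]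
    exact (summable_geometric_of_lt_one (norm_nonneg _) hqq).sum_le_tsum _
      fun i _ => by positivity
  have h3 : t ≤ 1 - ‖q ^ 2‖ := by
    rw [norm_pow, hqn, ← Real.exp_nat_mul]
    have := half_le_one_sub_exp_neg (a := 2 * t) (by positivity) (by linarith)
    rw [show ((2 : ℕ) : ℝ) * -t = -(2 * t) by push_cast; ring]
    linarith
  have h4 : (1 - ‖q ^ 2‖)⁻¹ ≤ t⁻¹ := inv_anti₀ ht h3
  calc _ ≤ 10 * t * t⁻¹ := by gcongr; exact h2.trans h4
    _ = 10 := by field_simp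

/-- The logarithm of (-e^(-t); e^(-2t))_∞ is ∑ (-1)^m/((m+1) · 2 sinh((m+1)t)). Replacing 2 sinh x
by 2x gives half the alternating sum π²/12, which is the critical constant π²/24. -/
lemma evenProduct_exp_neg_le {L : ℕ} {s t : ℝ}
    (hs : HasSum (fun m : ℕ => if L ≤ m then 1 / ((m : ℝ) + 1) ^ 2 else 0) s) (ht : 0 < t)
    (hL : (L : ℝ) * t ≤ 1 / 4) :
    evenProduct (Real.exp (-t)) ≤ Real.exp ((Real.pi ^ 2 / 24 + s) * t⁻¹ + L * 4) := by
  have hr1 : Real.exp (-t) < 1 := Real.exp_lt_one_iff.mpr (by linarith)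
  have hz : ‖-(Real.exp (-t) : ℂ)‖ < 1 := by
    rw [norm_neg, Complex.norm_real, Real.norm_of_nonneg (Real.exp_pos _).le]
    exact hr1
  have hp : ‖(Real.exp (-t) : ℂ) ^ 2‖ < 1 := by
    rw [norm_neg] at hz
    exact norm_pow_succ_lt_one hz 1
  have h1 := Complex.hasSum_re (summable_logTerm hz hp).hasSum.neg
  rw [evenProduct, qPochhammerInf, Complex.norm_exp]
  refine Real.exp_le_exp.mpr ?_
  have h2 := ((hasSum_alternating_inv_sq.mul_left (1 / 2)).add hs).mul_right t⁻¹ |>.add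
    (hasSum_initial_segment L 4)
  rw [show 1 / 2 * (Real.pi ^ 2 / 12) = Real.pi ^ 2 / 24 by ring] at h2
  refine hasSum_le (fun m => ?_) h1 h2
  have hM : (1 : ℝ) ≤ m + 1 := by linarith [(m.cast_nonneg : (0 : ℝ) ≤ m)]
  set a : ℝ := (m + 1) * t with ha
  have ha0 : 0 < a := by positivity
  set F : ℝ := Real.exp (-a) / (1 - Real.exp (-(2 * a))) with hF
  have hexp (c : ℕ) : Real.exp (-t) ^ c = Real.exp (-(c * t)) := by
    rw [← Real.exp_nat_mul]; ring_nf
  have e1 : (-((-(Real.exp (-t) : ℂ)) ^ (m + 1) /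
      ((m + 1) * (1 - ((Real.exp (-t) : ℂ) ^ 2) ^ (m + 1))))).re = (-1) ^ m / (m + 1) * F := by
    rw [show (-((-(Real.exp (-t) : ℂ)) ^ (m + 1) /
      ((m + 1) * (1 - ((Real.exp (-t) : ℂ) ^ 2) ^ (m + 1))))) = (((-((-Real.exp (-t)) ^ (m + 1) /
      ((m + 1) * (1 - (Real.exp (-t) ^ 2) ^ (m + 1))))) : ℝ) : ℂ) by push_cast; rfl,
      Complex.ofReal_re, neg_pow, ← pow_mul, hexp, hexp, hF, ha]
    push_cast
    rw [div_mul_div_comm, pow_succ]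
    ring_nf
  rw [e1]
  have e2 : (m + 1 : ℝ)⁻¹ * (2 * a)⁻¹ = 1 / 2 * (1 / ((m : ℝ) + 1) ^ 2) * t⁻¹ := by
    rw [ha]; field_simp
  have hinv : (m + 1 : ℝ)⁻¹ ≤ 1 := inv_le_one_of_one_le₀ hM
  have hpos : (0 : ℝ) < 1 / ((m : ℝ) + 1) ^ 2 * t⁻¹ := by positivity
  by_cases hm : m < L
  · rw [if_pos hm, if_neg (show ¬ L ≤ m by omega), add_zero]
    have hmL : (m + 1 : ℝ) ≤ L := by exact_mod_cast hm
    have ha1 : a ≤ 1 / 4 := le_trans (by rw [ha]; gcongr) hL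
    have e3 : |F - (2 * a)⁻¹| ≤ 4 := by
      have := norm_exp_neg_div_sub_le (z := (a : ℂ)) (by simpa using ha0)
        (by rw [Complex.norm_real, Real.norm_of_nonneg ha0.le]; exact ha1)
      rw [← Real.norm_eq_abs, ← Complex.norm_real, hF]
      push_cast
      exact this
    have e4 : (-1) ^ m / ((m : ℝ) + 1) * F = (-1) ^ m / (m + 1) * (2 * a)⁻¹
        + (-1) ^ m / (m + 1) * (F - (2 * a)⁻¹) := by ring
    have e5 : |(-1) ^ m / ((m : ℝ) + 1) * (F - (2 * a)⁻¹)| ≤ 1 * 4 := by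
      rw [abs_mul, abs_div, abs_pow, abs_neg, abs_one, one_pow, abs_of_pos (by linarith), one_div]
      gcongr
    have e6 : (-1) ^ m / ((m : ℝ) + 1) * (2 * a)⁻¹ = (-1) ^ m * ((m + 1 : ℝ)⁻¹ * (2 * a)⁻¹) := by
      ring
    rw [e4, e6, e2]
    have := (abs_le.mp e5).2
    calc _ ≤ (-1) ^ m * (1 / 2 * (1 / ((m : ℝ) + 1) ^ 2) * t⁻¹) + 4 := by linarith
      _ = _ := by ring
  · rw [if_neg hm, if_pos (show L ≤ m by omega), add_zero]
    have e3 : F ≤ (2 * a)⁻¹ := exp_neg_div_one_sub_le ha0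
    have e4 : 0 ≤ F := by
      have : Real.exp (-(2 * a)) < 1 := Real.exp_lt_one_iff.mpr (by linarith)
      exact div_nonneg (Real.exp_pos _).le (by linarith)
    have e5 : (-1 : ℝ) ^ m / (m + 1) * F ≤ (m + 1 : ℝ)⁻¹ * (2 * a)⁻¹ := by
      have : (-1 : ℝ) ^ m ≤ 1 := (le_abs_self _).trans (by simp)
      calc _ = (-1 : ℝ) ^ m * ((m + 1 : ℝ)⁻¹ * F) := by ring
        _ ≤ 1 * ((m + 1 : ℝ)⁻¹ * (2 * a)⁻¹) := by gcongr
        _ = _ := one_mul _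
    rw [e2] at e5
    have e6 : -1 ≤ (-1 : ℝ) ^ m := (abs_le.mp (show |(-1 : ℝ) ^ m| ≤ 1 by simp)).1
    have e7 : (1 / 2 * ((-1) ^ m / ((m : ℝ) + 1) ^ 2) + 1 / ((m : ℝ) + 1) ^ 2) * t⁻¹
      = (1 / 2 * (-1) ^ m + 1) * (1 / ((m : ℝ) + 1) ^ 2 * t⁻¹) := by ring
    rw [e7]
    nlinarith

/-- As long as 4kt ≤ 1 every factor lies in the range of `le_norm_one_add_exp_neg`, so each gains
e^(1/100). -/
lemma exp_le_norm_qPochhammer_short {t φ : ℝ} (ht : 0 < t) (hφ : |φ| ≤ 3 / 2 * t) {k : ℕ}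
    (hk : (k : ℝ) * t ≤ 1 / 4) :
    Real.exp (k / 100) ≤ ‖qPochhammer (-negNome t φ ^ 2) ((negNome t φ ^ 2) ^ 2) k‖ := by
  rw [qPochhammer, norm_prod, div_eq_mul_one_div, Real.exp_nat_mul]
  calc _ = ∏ _i ∈ range k, Real.exp (1 / 100) := by simp
    _ ≤ _ := Finset.prod_le_prod (fun _ _ => (Real.exp_pos _).le) fun i hi => ?_
  have e1 : 1 - -negNome t φ ^ 2 * ((negNome t φ ^ 2) ^ 2) ^ i
      = 1 + (negNome t φ ^ 2) ^ (2 * i + 1) := by ring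
  have e2 : ((2 * i + 1 : ℕ) : ℝ) ≤ 2 * k := by
    exact_mod_cast (show 2 * i + 1 ≤ 2 * k by have := Finset.mem_range.mp hi; omega)
  rw [e1, negNome_sq_pow]
  refine le_norm_one_add_exp_neg ?_ (abs_natCast_mul_im_le hφ _)
  rw [natCast_mul_re]
  nlinarith

/-- A majorant of `c ^ (m + 1) / (m + 1) ^ 2` that is eventually geometric. -/
noncomputable def dilogMajorant (c : ℝ) (m : ℕ) : ℝ :=
  -- 8/9 = 1 - 1/9 and 5/36 = 1/4 - 1/9: the first two coefficients are exact, all later ones are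
  -- replaced by 1/9.
  1 / 9 * c ^ (m + 1) + (if m = 0 then 8 / 9 * c else 0) + (if m = 1 then 5 / 36 * c ^ 2 else 0)

lemma pow_div_sq_le_dilogMajorant {c : ℝ} (hc : 0 ≤ c) (m : ℕ) :
    c ^ (m + 1) / ((m : ℝ) + 1) ^ 2 ≤ dilogMajorant c m := by
  rw [dilogMajorant]
  match m with
  | 0 => norm_num; linarith
  | 1 => norm_num; nlinarith [sq_nonneg c]
  | m + 2 =>
    rw [if_neg (by omega), if_neg (by omega), add_zero, add_zero, div_eq_inv_mul]
    gcongr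
    rw [← one_div]
    refine one_div_le_one_div_of_le (by norm_num) ?_
    push_cast
    nlinarith [(m.cast_nonneg : (0 : ℝ) ≤ m)]

lemma hasSum_dilogMajorant {c : ℝ} (h0 : 0 ≤ c) (h1 : c < 1) :
    HasSum (dilogMajorant c) (1 / 9 * (c * (1 - c)⁻¹) + 8 / 9 * c + 5 / 36 * c ^ 2) := by
  have h2 := ((hasSum_geometric_of_lt_one h0 h1).mul_left c).mul_left (1 / 9)
  have h3 := (h2.add (hasSum_ite_eq 0 (8 / 9 * c))).add (hasSum_ite_eq 1 (5 / 36 * c ^ 2))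
  refine hasSum_of_eq h3 (fun m => ?_) rfl
  rw [dilogMajorant, pow_succ']

/-- With z = 2(m+1)τ the kernel is 1/(2 sinh z), with pole part 1/(2z). The part free of w sums to a
multiple of Re(1/τ); the part with w is a dilogarithm, controlled by its majorant at c. For m < L
the remainder is at most 2 · 4 = 8; beyond L the term and its main part together are absorbed by the
inverse-square tail. -/
lemma log_term_lower_bound {τ w : ℂ} {L m : ℕ} {c : ℝ} (hτ : 0 < τ.re) (hw : ‖w‖ ≤ c)
    (hc : c ≤ 1) (hL : 2 * L * ‖τ‖ ≤ 1 / 4) :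
    1 / 4 * ((τ⁻¹).re * ((-1) ^ m / ((m : ℝ) + 1) ^ 2) - ‖τ‖⁻¹ * dilogMajorant c m)
        - (if L ≤ m then 1 / ((m : ℝ) + 1) ^ 2 else 0) * τ.re⁻¹ - (if m < L then 8 else 0)
      ≤ ((-1) ^ m / ((m : ℂ) + 1) * (1 - w ^ (m + 1)) *
          (Complex.exp (-(2 * ((m + 1 : ℕ) * τ))) /
            (1 - Complex.exp (-(2 * (2 * ((m + 1 : ℕ) * τ))))))).re := by
  set z : ℂ := 2 * ((m + 1 : ℕ) * τ) with hz
  set F : ℂ := Complex.exp (-z) / (1 - Complex.exp (-(2 * z))) with hF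
  have hM : (1 : ℝ) ≤ m + 1 := by linarith [(m.cast_nonneg : (0 : ℝ) ≤ m)]
  have hc0 : 0 ≤ c := (norm_nonneg w).trans hw
  have hτ0 : τ ≠ 0 := by rintro rfl; simp at hτ
  have hτn : 0 < ‖τ‖ := norm_pos_iff.mpr hτ0
  have hτle : τ.re ≤ ‖τ‖ := Complex.re_le_norm τ
  have hzre : z.re = 2 * ((m + 1) * τ.re) := by
    rw [hz, ← Complex.ofReal_natCast, ← Complex.ofReal_ofNat, Complex.re_ofReal_mul,
      Complex.re_ofReal_mul]
    push_cast
    ring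
  have hzn : ‖z‖ = 2 * ((m + 1) * ‖τ‖) := by
    rw [hz, norm_mul, norm_mul, Complex.norm_natCast]; norm_num
  have hzpos : 0 < z.re := by rw [hzre]; positivity
  have hwM : ‖w ^ (m + 1)‖ ≤ c ^ (m + 1) := by rw [norm_pow]; gcongr
  have hw1 : ‖1 - w ^ (m + 1)‖ ≤ 2 := by
    refine (norm_sub_le _ _).trans ?_
    have := pow_le_one₀ (n := m + 1) hc0 hc
    rw [norm_one]
    linarith
  have hcoef : ‖(-1) ^ m / ((m : ℂ) + 1) * (1 - w ^ (m + 1))‖ ≤ 2 / (m + 1) := by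
    rw [norm_mul, norm_div, norm_natCast_add_one, norm_pow, norm_neg, norm_one, one_pow,
      one_div_mul_eq_div]
    gcongr
  have hmain : 1 / 4 * ((τ⁻¹).re * ((-1) ^ m / ((m : ℝ) + 1) ^ 2) - ‖τ‖⁻¹ * dilogMajorant c m)
      ≤ ((-1) ^ m / ((m : ℂ) + 1) * (1 - w ^ (m + 1)) * (2 * z)⁻¹).re := by
    have e1 : (-1) ^ m / ((m : ℂ) + 1) * (1 - w ^ (m + 1)) * (2 * z)⁻¹
        = ((1 / 4 * ((-1) ^ m / ((m : ℝ) + 1) ^ 2) : ℝ) : ℂ) * τ⁻¹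
          - ((1 / 4 * ((-1) ^ m / ((m : ℝ) + 1) ^ 2) : ℝ) : ℂ) * (w ^ (m + 1) * τ⁻¹) := by
      have : ((m : ℂ) + 1) ≠ 0 := Nat.cast_add_one_ne_zero m
      rw [hz]
      push_cast
      field_simp
      ring
    have e2 : (((1 / 4 * ((-1) ^ m / ((m : ℝ) + 1) ^ 2) : ℝ) : ℂ) * (w ^ (m + 1) * τ⁻¹)).re
        ≤ 1 / 4 * (‖τ‖⁻¹ * dilogMajorant c m) := by
      refine (Complex.re_le_norm _).trans ?_
      rw [norm_mul, norm_mul, norm_inv, Complex.norm_real, Real.norm_eq_abs, abs_mul,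
        abs_of_pos (by positivity : (0 : ℝ) < 1 / 4), abs_div, abs_pow, abs_neg, abs_one, one_pow,
        abs_of_pos (by positivity : (0 : ℝ) < ((m : ℝ) + 1) ^ 2)]
      calc _ ≤ 1 / 4 * (1 / ((m : ℝ) + 1) ^ 2) * (c ^ (m + 1) * ‖τ‖⁻¹) := by gcongr
        _ = 1 / 4 * (‖τ‖⁻¹ * (c ^ (m + 1) / ((m : ℝ) + 1) ^ 2)) := by ring
        _ ≤ _ := by gcongr; exact pow_div_sq_le_dilogMajorant hc0 m
    rw [e1, Complex.sub_re, Complex.re_ofReal_mul]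
    linarith
  by_cases hm : m < L
  · rw [if_pos hm, if_neg (show ¬ L ≤ m by omega), zero_mul, sub_zero]
    have hmL : (m + 1 : ℝ) ≤ L := by exact_mod_cast hm
    have hz1 : ‖z‖ ≤ 1 / 4 := by
      rw [hzn]
      refine le_trans ?_ hL
      rw [mul_assoc]
      gcongr
    have e1 := norm_exp_neg_div_sub_le hzpos hz1
    have e2 : ‖(-1) ^ m / ((m : ℂ) + 1) * (1 - w ^ (m + 1)) * (F - (2 * z)⁻¹)‖ ≤ 8 := by
      rw [norm_mul]
      calc _ ≤ 2 / ((m : ℝ) + 1) * 4 := by gcongr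
        _ ≤ 2 / 1 * 4 := by gcongr
        _ = 8 := by norm_num
    have e3 := (abs_le.mp ((Complex.abs_re_le_norm _).trans e2)).1
    rw [mul_sub, Complex.sub_re] at e3
    linarith
  · rw [if_neg hm, if_pos (show L ≤ m by omega), sub_zero]
    have e1 : ‖F‖ ≤ (2 * z.re)⁻¹ := norm_exp_neg_div_le hzpos
    have e2 : ‖(-1) ^ m / ((m : ℂ) + 1) * (1 - w ^ (m + 1)) * F‖
        ≤ 1 / 2 * (1 / ((m : ℝ) + 1) ^ 2 * τ.re⁻¹) := by
      rw [norm_mul]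
      calc _ ≤ 2 / ((m : ℝ) + 1) * (2 * z.re)⁻¹ := by gcongr
        _ = _ := by rw [hzre]; field_simp
    have e3 := (abs_le.mp ((Complex.abs_re_le_norm _).trans e2)).1
    have e4 : 1 / 4 * ((τ⁻¹).re * ((-1) ^ m / ((m : ℝ) + 1) ^ 2) - ‖τ‖⁻¹ * dilogMajorant c m)
        ≤ 1 / 4 * (1 / ((m : ℝ) + 1) ^ 2 * τ.re⁻¹) := by
      have e5 : (τ⁻¹).re * ((-1) ^ m / ((m : ℝ) + 1) ^ 2)
          ≤ τ.re⁻¹ * (1 / ((m : ℝ) + 1) ^ 2) := by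
        refine (le_abs_self _).trans ?_
        rw [abs_mul, abs_div, abs_pow, abs_neg, abs_one, one_pow,
          abs_of_pos (by positivity : (0 : ℝ) < ((m : ℝ) + 1) ^ 2)]
        gcongr
        refine (Complex.abs_re_le_norm _).trans ?_
        rw [norm_inv]
        exact inv_anti₀ hτ hτle
      have e6 : 0 ≤ ‖τ‖⁻¹ * dilogMajorant c m :=
        mul_nonneg (inv_nonneg.mpr hτn.le)
          (le_trans (by positivity) (pow_div_sq_le_dilogMajorant hc0 m))
      linarith
    have e7 : 0 < 1 / ((m : ℝ) + 1) ^ 2 * τ.re⁻¹ := by positivity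
    linarith

/-- The finite symbol is the quotient of the infinite products at x and xP^k, so its logarithm is
the difference of their series. -/
lemma hasSum_log_qPochhammer {x P : ℂ} (hx : ‖x‖ < 1) (hP : ‖P‖ < 1) (k : ℕ) :
    ∃ s : ℂ, ‖qPochhammer x P k‖ = Real.exp s.re ∧
      HasSum (fun m : ℕ => -(x ^ (m + 1) * (1 - (P ^ k) ^ (m + 1)) /
        ((m + 1) * (1 - P ^ (m + 1))))) s := by
  have hxk := norm_mul_pow_lt_one hx hP k
  have h1 := (summable_logTerm hx hP).hasSum.neg.add (summable_logTerm hxk hP).hasSum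
  refine ⟨_, ?_, (congrArg (fun f => HasSum f _) ?_).mp h1⟩
  · have h2 := qPochhammer_mul_inf hx hP k
    rw [eq_div_of_mul_eq (qPochhammerInf_ne_zero _ _) h2, qPochhammerInf, qPochhammerInf,
      ← Complex.exp_sub, Complex.norm_exp, sub_neg_eq_add]
  · funext m
    rw [mul_pow]
    ring

/-- To leading order the logarithm is at least (1/4)(Re(1/τ) π²/12 - D/|τ|), where D majorizes the
dilogarithm at 0.37. In the sector Re(1/τ) is still more than half of 1/|τ|, and this suffices for a
positive difference. -/
lemma exp_le_norm_qPochhammer_long {L : ℕ} {s t φ : ℝ}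
    (hs : HasSum (fun m : ℕ => if L ≤ m then 1 / ((m : ℝ) + 1) ^ 2 else 0) s)
    (hs1 : s ≤ 1 / 2000) (ht : 0 < t) (hL : (L : ℝ) * t ≤ 1 / 20) (hφ : |φ| ≤ 3 / 2 * t) {k : ℕ}
    (hk : 1 / 4 ≤ (k : ℝ) * t) :
    Real.exp (1 / 250 * t⁻¹ - L * 8)
      ≤ ‖qPochhammer (-negNome t φ ^ 2) ((negNome t φ ^ 2) ^ 2) k‖ := by
  set q := negNome t φ with hq
  set τ : ℂ := (t : ℂ) - φ * Complex.I with hτ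
  have hτre : τ.re = t := by simp [hτ]
  have hτim : τ.im = -φ := by simp [hτ]
  have hq1 : ‖q‖ < 1 := norm_negNome_lt_one ht φ
  have hx : ‖-q ^ 2‖ < 1 := by rw [norm_neg]; exact norm_pow_succ_lt_one hq1 1
  have hP : ‖(q ^ 2) ^ 2‖ < 1 := by
    rw [norm_neg] at hx; exact norm_pow_succ_lt_one hx 1
  obtain ⟨S, hS, hsum⟩ := hasSum_log_qPochhammer hx hP k
  rw [hS]
  refine Real.exp_le_exp.mpr ?_
  set w : ℂ := ((q ^ 2) ^ 2) ^ k with hw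
  -- |w| = e^(-4kt) ≤ e^(-1), by kt ≥ 1/4.
  have hwn : ‖w‖ ≤ 0.37 := by
    rw [hw, norm_pow, norm_pow, norm_pow, norm_negNome, ← pow_mul, ← pow_mul, ← Real.exp_nat_mul]
    refine le_trans (Real.exp_le_exp.mpr ?_) exp_neg_one_bounds.2
    push_cast
    linarith
  have hnormSq : ‖τ‖ ^ 2 = t ^ 2 + φ ^ 2 := by
    rw [← Complex.normSq_eq_norm_sq, Complex.normSq_apply, hτre, hτim]; ring
  have hφ2 : φ ^ 2 ≤ 9 / 4 * t ^ 2 := by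
    have := pow_le_pow_left₀ (abs_nonneg φ) hφ 2
    rw [sq_abs] at this
    linarith
  have hτpos : 0 < ‖τ‖ := lt_of_lt_of_le (by rw [hτre]; exact ht) (Complex.re_le_norm τ)
  -- √(1 + 9/4) ≈ 1.803; consequently t/|τ| ≥ 0.55.
  have hτle : ‖τ‖ ≤ 1.81 * t := by
    rw [← sq_le_sq₀ (norm_nonneg _) (by positivity), hnormSq]
    nlinarith
  have hτL : 2 * L * ‖τ‖ ≤ 1 / 4 := by
    have : (0 : ℝ) ≤ L := L.cast_nonneg
    calc 2 * L * ‖τ‖ ≤ 2 * L * (1.81 * t) := by gcongr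
      _ ≤ _ := by nlinarith
  have hrew : (fun m : ℕ => -((-q ^ 2) ^ (m + 1) * (1 - w ^ (m + 1)) /
        ((m + 1) * (1 - ((q ^ 2) ^ 2) ^ (m + 1)))))
      = fun m : ℕ => (-1) ^ m / ((m : ℂ) + 1) * (1 - w ^ (m + 1)) *
          (Complex.exp (-(2 * ((m + 1 : ℕ) * τ))) /
            (1 - Complex.exp (-(2 * (2 * ((m + 1 : ℕ) * τ)))))) := by
    funext m
    have e1 : (q ^ 2) ^ (m + 1) = Complex.exp (-(2 * ((m + 1 : ℕ) * τ))) := negNome_sq_pow t φ _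
    have e2 : ((q ^ 2) ^ 2) ^ (m + 1) = Complex.exp (-(2 * (2 * ((m + 1 : ℕ) * τ)))) := by
      rw [← pow_mul, hq, negNome_sq_pow, ← hτ]
      push_cast
      ring_nf
    rw [← e1, ← e2, neg_pow, pow_succ (-1 : ℂ)]
    rw [div_mul_eq_mul_div, div_mul_div_comm, ← neg_div]
    congr 1
    ring
  rw [hrew] at hsum
  have h1 := ((((hasSum_alternating_inv_sq.mul_left (τ⁻¹).re).sub
    ((hasSum_dilogMajorant (c := 0.37) (by norm_num) (by norm_num)).mul_left ‖τ‖⁻¹)).mul_left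
      (1 / 4)).sub (hs.mul_right τ.re⁻¹)).sub (hasSum_initial_segment L 8)
  refine le_trans ?_ (hasSum_le (fun m => log_term_lower_bound (by rw [hτre]; exact ht) hwn
    (by norm_num) hτL) h1 (Complex.hasSum_re hsum))
  rw [hτre, Complex.inv_re, hτre, Complex.normSq_eq_norm_sq]
  set d := ‖τ‖⁻¹ with hd
  have hd0 : 0 < d := inv_pos.mpr hτpos
  have htd : 0.55 ≤ t * d := by
    rw [hd, ← div_eq_mul_inv, le_div_iff₀ hτpos]
    linarith
  have hti : 0 < t⁻¹ := inv_pos.mpr ht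
  have hd1 : 0.55 * t⁻¹ ≤ d := by
    calc 0.55 * t⁻¹ ≤ t * d * t⁻¹ := by gcongr
      _ = d := by field_simp
  have e1 : t / ‖τ‖ ^ 2 = t * d * d := by rw [hd]; field_simp
  rw [e1]
  have hpi := Real.pi_gt_d2
  -- The decisive comparison is 0.451 > 0.4133. A quarter of the difference times 0.55/t exceeds
  -- 0.005/t, which pays for the tail 1/2000 and leaves 1/250.
  have e2 : (0.451 : ℝ) ≤ t * d * (Real.pi ^ 2 / 12) := by
    have : (0.821 : ℝ) ≤ Real.pi ^ 2 / 12 := by nlinarith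
    nlinarith
  have e3 : (1 / 9 * (0.37 * (1 - 0.37)⁻¹) + 8 / 9 * 0.37 + 5 / 36 * 0.37 ^ 2 : ℝ) ≤ 0.4133 := by
    norm_num
  have e4 := mul_le_mul_of_nonneg_right e2 hd0.le
  have e5 := mul_le_mul_of_nonneg_left e3 hd0.le
  have e6 : s * t⁻¹ ≤ 1 / 2000 * t⁻¹ := by gcongr
  have e7 : t * d * d * (Real.pi ^ 2 / 12) = t * d * (Real.pi ^ 2 / 12) * d := by ring
  rw [e7]
  linarith

/-- In a sector at `q = -1` the value of the series is exponentially smaller than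
`e^(π² / 24t)`. -/
lemma exists_norm_baileyR3_le_near :
    ∃ C t₀ : ℝ, 0 < t₀ ∧ ∀ t φ : ℝ, 0 < t → t ≤ t₀ → |φ| ≤ 3 / 2 * t →
      ‖baileyR3 3 (negNome t φ)‖ ≤
        Real.exp ((Real.pi ^ 2 / 24 - 1 / 20000) * t⁻¹ + C) * (1 - Real.exp (-t))⁻¹ ^ 3 := by
  -- The smallest gain below is 1/10000, at kt = 1/100 in the short range; half of it covers the
  -- tail s, leaving 1/20000.
  obtain ⟨L, s, hs, hsum⟩ := exists_inv_sq_tail_le (show (0 : ℝ) < 1 / 20000 by norm_num)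
  have hL0 : (0 : ℝ) ≤ L := L.cast_nonneg
  have hpi := Real.pi_gt_three
  refine ⟨10 + L * 12 + 3, 1 / (20 * (L + 1)), by positivity, fun t φ ht ht1 hφ => ?_⟩
  have hLt : (L + 1) * t ≤ 1 / 20 := by
    rw [le_div_iff₀ (by positivity)] at ht1
    linarith
  have ht2 : t ≤ 1 / 20 := by nlinarith
  have hLt' : L * t ≤ 1 / 20 := by linarith
  have hti : 0 < t⁻¹ := inv_pos.mpr ht
  set q := negNome t φ with hq
  have hq1 : ‖q‖ < 1 := norm_negNome_lt_one ht φ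
  have hqn : ‖q‖ = Real.exp (-t) := norm_negNome t φ
  have hE := evenProduct_exp_neg_le hsum ht (by linarith)
  have hE0 : 0 ≤ evenProduct (Real.exp (-t)) := norm_nonneg _
  have hst : s * t⁻¹ ≤ 1 / 20000 * t⁻¹ := by gcongr
  have hlong (k : ℕ) (hk : 1 / 4 ≤ (k : ℝ) * t) :
      ‖(qPochhammer (-q ^ 2) ((q ^ 2) ^ 2) k)⁻¹‖ * evenProduct (Real.exp (-t))
        ≤ Real.exp ((Real.pi ^ 2 / 24 - 1 / 20000) * t⁻¹ + L * 12) := by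
    have h1 := exp_le_norm_qPochhammer_long hsum (by linarith) ht hLt' hφ hk
    rw [norm_inv]
    calc _ ≤ (Real.exp (1 / 250 * t⁻¹ - L * 8))⁻¹ *
          Real.exp ((Real.pi ^ 2 / 24 + s) * t⁻¹ + L * 4) := by
          gcongr
      _ ≤ _ := by
          rw [← Real.exp_neg, ← Real.exp_add]
          refine Real.exp_le_exp.mpr ?_
          linarith
  have hB (k : ℕ) : ‖(qPochhammer (-q ^ 2) ((q ^ 2) ^ 2) (k + 1))⁻¹‖ *
      min (evenProduct ‖q‖) (realFactInv (‖q‖ ^ 2) (2 * k + 1))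
        ≤ Real.exp ((Real.pi ^ 2 / 24 - 1 / 20000) * t⁻¹ + L * 12) := by
    rw [hqn]
    have hmin : 0 ≤ min (evenProduct (Real.exp (-t)))
        (realFactInv (Real.exp (-t) ^ 2) (2 * k + 1)) := by
      refine le_min hE0 (realFactInv_pos (by positivity) ?_ _).le
      rw [← hqn, ← norm_pow]
      exact norm_pow_succ_lt_one hq1 1
    -- Three ranges of k' = k + 1: for k't ≥ 1/4 the dilogarithm gain; for 1/100 ≤ k't < 1/4 the
    -- gain e^(k'/100); below that the Gaussian binomial itself, with exponent at most (1/10 +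
    -- 6/100)/t, far below critical.
    by_cases hk : 1 / 4 ≤ ((k + 1 : ℕ) : ℝ) * t
    · exact le_trans (by gcongr; exact min_le_left _ _) (hlong _ hk)
    have h1 := exp_le_norm_qPochhammer_short ht hφ (not_le.mp hk).le
    by_cases hk2 : 1 / 100 ≤ ((k + 1 : ℕ) : ℝ) * t
    · have h2 : 1 / 10000 * t⁻¹ ≤ ((k + 1 : ℕ) : ℝ) / 100 := by
        rw [← div_eq_mul_inv, div_le_iff₀ ht]
        linarith
      rw [norm_inv]
      calc _ ≤ (Real.exp (((k + 1 : ℕ) : ℝ) / 100))⁻¹ *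
            Real.exp ((Real.pi ^ 2 / 24 + s) * t⁻¹ + L * 4) := by
            gcongr
            exact (min_le_left _ _).trans hE
        _ ≤ _ := by
            rw [← Real.exp_neg, ← Real.exp_add]
            refine Real.exp_le_exp.mpr ?_
            linarith
    · push_cast at hk2
      have h2 : 2 * t * ((2 * k + 1 : ℕ) : ℝ) ≤ 1 := by push_cast; nlinarith
      have h3 := realFactInv_le ht h2
      have h4 : ‖(qPochhammer (-q ^ 2) ((q ^ 2) ^ 2) (k + 1))⁻¹‖ ≤ 1 := by
        rw [norm_inv]
        exact inv_le_one_of_one_le₀ ((Real.one_le_exp (by positivity)).trans h1)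
      have h5 : Real.exp (-t) ^ 2 = Real.exp (-(2 * t)) := by
        rw [← Real.exp_nat_mul]; push_cast; ring_nf
      have h6 : (k + 1 : ℝ) ≤ 1 / 100 * t⁻¹ := by
        rw [← div_eq_mul_inv, le_div_iff₀ ht]
        linarith
      rw [h5] at hmin ⊢
      calc _ ≤ 1 * Real.exp (t⁻¹ / 10 + 3 * ((2 * k + 1 : ℕ) : ℝ)) := by
            gcongr
            exact (min_le_right _ _).trans h3
        _ ≤ _ := by
            rw [one_mul]
            refine Real.exp_le_exp.mpr ?_
            push_cast
            have h7 : 9 * t⁻¹ ≤ Real.pi ^ 2 * t⁻¹ := by gcongr; nlinarith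
            linarith
  have hB' : ∃ K, ∀ k ≥ K, ‖(qPochhammer (-q ^ 2) ((q ^ 2) ^ 2) k)⁻¹‖ * evenProduct ‖q‖
      ≤ Real.exp ((Real.pi ^ 2 / 24 - 1 / 20000) * t⁻¹ + L * 12) := by
    obtain ⟨K, hK⟩ := exists_nat_ge (t⁻¹)
    refine ⟨K, fun k hk => ?_⟩
    rw [hqn]
    refine hlong k ?_
    have h1 : t⁻¹ ≤ k := hK.trans (by exact_mod_cast hk)
    have h2 : t⁻¹ * t ≤ k * t := by gcongr
    rw [inv_mul_cancel₀ ht.ne'] at h2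
    linarith
  refine (norm_baileyR3_le_expansion hq1
    (norm_qPochhammer_ratio_le ht (by linarith) hφ) hB hB').trans ?_
  rw [hqn]
  have h3 : (3 : ℝ) ≤ Real.exp 3 := by linarith [Real.add_one_le_exp (3 : ℝ)]
  have h4 : Real.exp ((Real.pi ^ 2 / 24 - 1 / 20000) * t⁻¹ + (10 + L * 12 + 3))
      = Real.exp 10 * Real.exp ((Real.pi ^ 2 / 24 - 1 / 20000) * t⁻¹ + L * 12) * Real.exp 3 := by
    rw [← Real.exp_add, ← Real.exp_add]; ring_nf
  have h5 : 0 ≤ (1 - Real.exp (-t))⁻¹ ^ 3 := by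
    rw [← hqn]
    exact pow_nonneg (inv_nonneg.mpr (by linarith)) 3
  rw [h4, ← mul_assoc]
  gcongr

/-! ### Uniform bound on circles and the theorem -/

/-- The cubic loss (1 - |q|)⁻³ is O(t⁻³), and x³/3! ≤ e^x at x = ε/t turns it into an arbitrarily
small loss in the exponent. -/
lemma inv_one_sub_exp_neg_pow_le {ε t : ℝ} (hε : 0 < ε) (ht : 0 < t) (ht1 : t ≤ 1) :
    (1 - Real.exp (-t))⁻¹ ^ 3 ≤ 48 * ε⁻¹ ^ 3 * Real.exp (ε * t⁻¹) := by
  have h1 := half_le_one_sub_exp_neg ht.le ht1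
  have h2 : (1 - Real.exp (-t))⁻¹ ≤ (t / 2)⁻¹ := inv_anti₀ (by positivity) h1
  have h3 := Real.pow_div_factorial_le_exp (x := ε * t⁻¹) (by positivity) 3
  have h4 : 0 ≤ (1 - Real.exp (-t))⁻¹ := inv_nonneg.mpr (by linarith)
  calc _ ≤ (t / 2)⁻¹ ^ 3 := by gcongr
    _ = 48 * ε⁻¹ ^ 3 * ((ε * t⁻¹) ^ 3 / (Nat.factorial 3 : ℕ)) := by
        rw [show Nat.factorial 3 = 6 from rfl]
        push_cast
        field_simp
        norm_num
    _ ≤ _ := by gcongr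

/-- For real `|q| = e^(-t)` with small `t`, the value of the series is exponentially smaller than
`e^(π² / 24t)`. -/
lemma exists_norm_baileyR3_le :
    ∃ A < Real.pi ^ 2 / 24, ∃ C t₀ : ℝ, 0 < t₀ ∧ ∀ t φ : ℝ, 0 < t → t ≤ t₀ → |φ| ≤ Real.pi →
      ‖baileyR3 3 (negNome t φ)‖ ≤ C * Real.exp (A * t⁻¹) := by
  obtain ⟨A, hA, C, t₀, ht₀, h⟩ := exists_norm_product_le
  obtain ⟨C', t₀', ht₀', h'⟩ := exists_norm_baileyR3_le_near
  set A' := max A (Real.pi ^ 2 / 24 - 1 / 20000) with hA'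
  have hA'1 : A' < Real.pi ^ 2 / 24 := max_lt hA (by linarith)
  set C'' := max (C + 4) C' with hC''
  -- Half of the gap to π²/24 is spent on the cubic loss.
  set ε : ℝ := (Real.pi ^ 2 / 24 - A') / 2 with hε
  have hε0 : 0 < ε := by rw [hε]; linarith
  refine ⟨A' + ε, by rw [hε]; linarith, Real.exp C'' * (48 * ε⁻¹ ^ 3), min 1 (min t₀ t₀'),
    by positivity, fun t φ ht ht1 hφ => ?_⟩
  have ht2 : t ≤ 1 := ht1.trans (min_le_left _ _)
  have ht3 : t ≤ t₀ := ht1.trans ((min_le_right _ _).trans (min_le_left _ _))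
  have ht4 : t ≤ t₀' := ht1.trans ((min_le_right _ _).trans (min_le_right _ _))
  have hti : 0 < t⁻¹ := inv_pos.mpr ht
  have h4 : 0 ≤ (1 - Real.exp (-t))⁻¹ ^ 3 := by
    have : Real.exp (-t) < 1 := Real.exp_lt_one_iff.mpr (by linarith)
    exact pow_nonneg (inv_nonneg.mpr (by linarith)) 3
  have key : ‖baileyR3 3 (negNome t φ)‖ ≤ Real.exp (A' * t⁻¹ + C'') * (1 - Real.exp (-t))⁻¹ ^ 3 := by
    rcases le_total |φ| (3 / 2 * t) with h5 | h5
    · refine (h' t φ ht ht4 h5).trans ?_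
      gcongr
      · exact le_max_right _ _
      · exact le_max_right _ _
    · refine (norm_baileyR3_le_product (norm_negNome_lt_one ht φ)).trans ?_
      rw [norm_negNome, ← mul_assoc]
      gcongr
      have h6 : (4 : ℝ) ≤ Real.exp 4 := by linarith [Real.add_one_le_exp (4 : ℝ)]
      calc _ ≤ Real.exp (A * t⁻¹ + C) * Real.exp 4 := by
            gcongr
            exact h t φ ht ht3 hφ h5
        _ = Real.exp (A * t⁻¹ + (C + 4)) := by rw [← Real.exp_add]; ring_nf
        _ ≤ _ := by
            gcongr
            · exact le_max_left _ _
            · exact le_max_left _ _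
  refine key.trans ?_
  calc _ ≤ Real.exp (A' * t⁻¹ + C'') * (48 * ε⁻¹ ^ 3 * Real.exp (ε * t⁻¹)) := by
        gcongr
        exact inv_one_sub_exp_neg_pow_le hε0 ht ht2
    _ = Real.exp C'' * (48 * ε⁻¹ ^ 3) * (Real.exp (A' * t⁻¹) * Real.exp (ε * t⁻¹)) := by
        rw [Real.exp_add]; ring
    _ = _ := by rw [← Real.exp_add, ← add_mul]

lemma exists_nome_eq_negNome (u v : ℝ) :
    ∃ φ, |φ| ≤ Real.pi ∧ nome (u + v * Complex.I) = negNome (2 * Real.pi * v) φ := by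
  obtain ⟨k, hk⟩ : ∃ k : ℤ, |u - 1 / 2 - k| ≤ 1 / 2 := ⟨round (u - 1 / 2), abs_sub_round _⟩
  -- The angle is measured from q = -1, which corresponds to u = 1/2, and reduced modulo 2π by the
  -- nearest integer k.
  refine ⟨2 * Real.pi * (u - 1 / 2 - k), ?_, ?_⟩
  · rw [abs_mul, abs_of_pos Real.two_pi_pos]
    nlinarith [Real.pi_pos]
  · have h1 : 2 * Real.pi * Complex.I * (u + v * Complex.I)
        = (-((2 * Real.pi * v : ℝ) : ℂ) + ((2 * Real.pi * (u - 1 / 2 - k) : ℝ) : ℂ) * Complex.I)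
          + Real.pi * Complex.I + k * (2 * Real.pi * Complex.I) := by
      push_cast
      linear_combination (2 * Real.pi * v : ℂ) * Complex.I_sq
    rw [nome, negNome, h1, Complex.exp_add, Complex.exp_int_mul_two_pi_mul_I, mul_one,
      Complex.exp_add, Complex.exp_pi_mul_I, mul_neg_one]

theorem theorem5p4 (M : ℝ) (hM : 0 < M) :
    ∃ β : ℝ, 0 < β ∧ ∃ C : ℝ, ∃ N : ℕ, ∀ n : ℕ, N ≤ n → ∀ u v : ℝ,
      v = 1 / Real.sqrt (192 * n) → M * v < |u - 1 / 2| →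
        Summable (fun m : {m : Fin 3 → ℕ // Monotone m} =>
          baileyR3Term 3 (nome (u + v * Complex.I)) m.1) ∧
        ‖baileyR3 3 (nome (u + v * Complex.I))‖
          ≤ C * Real.exp (Real.pi * Real.sqrt (n / 12) * (1 - β)) := by
  obtain ⟨A, hA, C, t₀, ht₀, h⟩ := exists_norm_baileyR3_le
  have hpi := Real.pi_pos
  obtain ⟨N, hN⟩ := exists_nat_ge ((2 * Real.pi / t₀) ^ 2)
  -- β is the relative gap between A and π²/24. N makes t = 2πv at most t₀ for n ≥ N, and N + 1 also
  -- ensures n > 0.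
  refine ⟨1 - A / (Real.pi ^ 2 / 24), ?_, C, N + 1, fun n hn u v hv _ => ?_⟩
  · rw [sub_pos, div_lt_one (by positivity)]
    exact hA
  have hn0 : (0 : ℝ) < n := by exact_mod_cast (show 0 < n by omega)
  have hS : 0 < Real.sqrt (192 * n) := Real.sqrt_pos.mpr (by positivity)
  have hv0 : 0 < v := by rw [hv]; positivity
  have ht : 0 < 2 * Real.pi * v := by positivity
  obtain ⟨φ, hφ, hq⟩ := exists_nome_eq_negNome u v
  rw [hq]
  refine ⟨(hasSum_outerTerm (norm_negNome_lt_one ht φ)).1, ?_⟩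
  have ht1 : 2 * Real.pi * v ≤ t₀ := by
    rw [hv, mul_one_div, div_le_comm₀ hS ht₀]
    refine Real.le_sqrt_of_sq_le (hN.trans ?_)
    have : (N : ℝ) ≤ n := by exact_mod_cast (show N ≤ n by omega)
    linarith
  refine (h _ φ ht ht1 hφ).trans (le_of_eq ?_)
  congr 2
  -- With this, (π²/24)/(2πv) = π/(48v) = π√(n/12), and A/t becomes (1 - β) times it.
  have h2 : Real.sqrt (192 * n) = 48 * Real.sqrt (n / 12) := by
    rw [show (192 : ℝ) * n = 48 ^ 2 * (n / 12) by ring, Real.sqrt_mul (by norm_num),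
      Real.sqrt_sq (by norm_num)]
  rw [hv, h2]
  field_simp
  ring
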